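/- \textsc{Diameter} is the following problem: given an undirected, connected, unweighted, finite graph $G=(V,E)$ with $n=|V|$ and $m=|E|$ (by adjacency lists), compute the diameter of $G$, that is, the length of a longest shortest path in $G$. Running times are numbers of steps of a deterministic word RAM: for each algorithm there is a constant $k$ such that it is correct, within the stated time, on every machine whose words have at least $k\log_2 N$ bits, where $N$ is the number of words of the input. The constants hidden in the $O$-notation are absolute. For a connected graph $G$ let $i$ be its distance to interval graphs and $c$ its distance to clique (the smallest size of a vertex set $K$ such that $G-K$ is an interval graph, respectively a complete graph), $a=2m/n$ its average degree, $\Delta$ its maximum degree, $d$ its diameter, and $\gamma$ its domination number. Then there are algorithms that solve \textsc{Diameter} 1. in $O(\max\{1,|K|\}\cdot n^2)$ time, if in addition to $G$ a set $K\subseteq V$ such that $G-K$ is an interval graph is given as input; in particular in $O(\max\{1,i\}\cdot n^2)$ time if $K$ is a smallest such set; 2. in $O(\max\{1,c\}\cdot (n+m))$ time; 3. in $O(\max\{1,a\}\cdot n^2)$ time; 4. in $O(\max\{1,\Delta\}^{2d+3})$ time; 5. in $O(\gamma^2\cdot \max\{1,\Delta\}^3)$ time. In items 2 to 5 only $G$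 is given to the algorithm, not the parameters. The maxima matter only if the respective parameter is $0$ (for $a$ and $\Delta$: only if $n=1$). -/

import Mathlib

/-! ### Word RAM -/

namespace WordRAM

/-- The elementary operations of a word RAM, each of unit cost. The natural numbers `d`, `a`, `b`
are names of registers, except in `const`, where `c` is a constant. -/
inductive Instr where
  /-- `r_d := c` -/
  | const (d c : ℕ)
  /-- `r_d := r_a` -/
  | move (d a : ℕ)
  /-- `r_d := r_a + r_b` -/
  | add (d a b : ℕ)
  /-- `r_d := max (r_a - r_b) 0` -/
  | sub (d a b : ℕ)
  /-- `r_d := r_a * r_b` -/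
  | mul (d a b : ℕ)
  /-- `r_d := M[r_a]` -/
  | load (d a : ℕ)
  /-- `M[r_a] := r_b` -/
  | store (a b : ℕ)

/-- Tests for branching: `r_a < r_b` and `r_a = r_b`. -/
inductive Test where
  | lt (a b : ℕ)
  | eq (a b : ℕ)

/-- RAM programs, with structured control flow. Such a program is a finite object; it mentions
finitely many registers and does not depend on the input or on the word length. -/
inductive Program where
  | instr (i : Instr)
  | seq (p q : Program)
  | ite (b : Test) (p q : Program)
  | loop (b : Test) (p : Program)

/-- A state: the contents of the registers and of the random access memory. -/
structure State where
  reg : ℕ → ℕ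
  mem : ℕ → ℕ

/-- Write the value `v`, reduced to a `w`-bit word, to register `d`. -/
def State.setReg (w : ℕ) (s : State) (d v : ℕ) : State :=
  { s with reg := Function.update s.reg d (v % 2 ^ w) }

/-- The effect of an elementary operation on a machine with words of `w` bits. -/
def Instr.run (w : ℕ) (s : State) : Instr → State
  | .const d c => s.setReg w d c
  | .move d a => s.setReg w d (s.reg a)
  | .add d a b => s.setReg w d (s.reg a + s.reg b)
  | .sub d a b => s.setReg w d (s.reg a - s.reg b)
  | .mul d a b => s.setReg w d (s.reg a * s.reg b)
  | .load d a => s.setReg w d (s.mem (s.reg a))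
  | .store a b => { s with mem := Function.update s.mem (s.reg a) (s.reg b) }

/-- The truth value of a test in a state. -/
def Test.Holds (s : State) : Test → Prop
  | .lt a b => s.reg a < s.reg b
  | .eq a b => s.reg a = s.reg b

/-- `Exec w p s t s'`: on a machine with words of `w` bits, the program `p`, started in state `s`,
halts after exactly `t` steps in state `s'`. Every elementary operation and every evaluation of a
test (also each one made by a loop) counts as one step. -/
inductive Exec (w : ℕ) : Program → State → ℕ → State → Prop where
  | instr (i : Instr) (s : State) : Exec w (.instr i) s 1 (i.run w s)
  | seq {p q : Program} {s s' s'' : State} {t t' : ℕ} :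
      Exec w p s t s' → Exec w q s' t' s'' → Exec w (.seq p q) s (t + t') s''
  | iteTrue {b : Test} {p q : Program} {s s' : State} {t : ℕ} :
      b.Holds s → Exec w p s t s' → Exec w (.ite b p q) s (1 + t) s'
  | iteFalse {b : Test} {p q : Program} {s s' : State} {t : ℕ} :
      ¬ b.Holds s → Exec w q s t s' → Exec w (.ite b p q) s (1 + t) s'
  | loopTrue {b : Test} {p : Program} {s s' s'' : State} {t t' : ℕ} :
      b.Holds s → Exec w p s t s' → Exec w (.loop b p) s' t' s'' →
        Exec w (.loop b p) s (1 + t + t') s''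
  | loopFalse {b : Test} {p : Program} {s : State} :
      ¬ b.Holds s → Exec w (.loop b p) s 1 s

/-- The initial state for the input `x`, a list of numbers: `x` is stored in the memory cells
`0, …, x.length - 1`; all other cells and all registers hold `0`. -/
def initState (x : List ℕ) : State where
  reg := fun _ => 0
  mem := fun a => x.getD a 0

/-- The program `p` outputs `y` (in register `0`) on input `x` within `T` steps, on every machine
whose word length is at least `k * log₂ (x.length)`. -/
def OutputsWithin (p : Program) (k : ℕ) (x : List ℕ) (y : ℕ) (T : ℝ) : Prop :=
  ∀ w : ℕ, x.length ^ k ≤ 2 ^ w →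
    ∃ (t : ℕ) (s : State), Exec w p (initState x) t s ∧ s.reg 0 = y ∧ (t : ℝ) ≤ T

end WordRAM

/-! ### Graphs as inputs -/

/-- `L` consists of adjacency lists for `G`: `L v` lists the neighbours of `v`, in any order. -/
def IsAdjLists {n : ℕ} (G : SimpleGraph (Fin n)) (L : Fin n → List (Fin n)) : Prop :=
  ∀ v, (L v).Nodup ∧ ∀ u, u ∈ L v ↔ G.Adj v u

/-- The total length of the lists `L u` with `u < v`. -/
def listOffset {n : ℕ} (L : Fin n → List (Fin n)) (v : ℕ) : ℕ :=
  ∑ u : Fin n, if (u : ℕ) < v then (L u).length else 0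

/-- Adjacency lists as an input: the number `n` of vertices, then the `n + 1` offsets
`listOffset L 0, …, listOffset L n`, then the lists `L 0, …, L (n - 1)` one after the other
(so `L v` starts at the address `n + 2 + listOffset L v`). -/
def encodeGraph {n : ℕ} (L : Fin n → List (Fin n)) : List ℕ :=
  n :: ((List.range (n + 1)).map (listOffset L) ++
    (List.finRange n).flatMap fun v => (L v).map Fin.val)

/-- Adjacency lists, followed by a list of vertices (its length, then its entries). -/
def encodeGraphAndList {n : ℕ} (L : Fin n → List (Fin n)) (S : List (Fin n)) : List ℕ :=
  encodeGraph L ++ S.length :: S.map Fin.val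

/-! ### Graph parameters -/

/-- Interval graphs: intersection graphs of closed intervals of the real line. -/
def IsIntervalGraph {V : Type*} (G : SimpleGraph V) : Prop :=
  ∃ l r : V → ℝ, (∀ v, l v ≤ r v) ∧
    ∀ u v, u ≠ v → (G.Adj u v ↔ (Set.Icc (l u) (r u) ∩ Set.Icc (l v) (r v)).Nonempty)

/-- `K` is a deletion set to interval graphs: `G - K` is an interval graph. -/
def IsIntervalDeletionSet {V : Type*} (G : SimpleGraph V) (K : Finset V) : Prop :=
  IsIntervalGraph (G.induce {v | v ∉ K})

/-- `K` is a deletion set to cliques: `G - K` is a complete graph. -/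
def IsCliqueDeletionSet {V : Type*} (G : SimpleGraph V) (K : Finset V) : Prop :=
  G.induce {v | v ∉ K} = ⊤

/-- The (vertex deletion) distance to interval graphs. -/
noncomputable def distToInterval {V : Type*} (G : SimpleGraph V) : ℕ :=
  sInf {k | ∃ K : Finset V, IsIntervalDeletionSet G K ∧ K.card = k}

/-- The (vertex deletion) distance to clique. -/
noncomputable def distToClique {V : Type*} (G : SimpleGraph V) : ℕ :=
  sInf {k | ∃ K : Finset V, IsCliqueDeletionSet G K ∧ K.card = k}

/-- The average degree. -/
noncomputable def averageDegree {V : Type*} [Fintype V] (G : SimpleGraph V)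
    [DecidableRel G.Adj] : ℝ :=
  (∑ v, (G.degree v : ℝ)) / Fintype.card V

/-- The domination number: the smallest size of a set `D` such that each vertex is in `D` or has a
neighbour in `D`. -/
noncomputable def dominationNumber {V : Type*} (G : SimpleGraph V) : ℕ :=
  sInf {k | ∃ D : Finset V, (∀ v, v ∈ D ∨ ∃ u ∈ D, G.Adj u v) ∧ D.card = k}

/-! Items 3 to 5 rest on one algorithm, breadth-first search from every vertex, with time `O(n (n +
m))` (`exists_program_allEcc`). This quantity is estimated by `n + 2m = n (1 + a)`; by `n + 2m ≤ n
(1 + Δ)` and the Moore-type bound `n ≤ 2 max(1, Δ)^(d+1)` (`card_le_two_mul_pow`); and by `n ≤ γ (1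
+ Δ)` (`card_le_dominationNumber_mul`).

For item 2, greedily deleting disjoint pairs of nonadjacent vertices leaves a clique. A clique
deletion set contains a vertex of every such pair, so at most `2c` vertices are deleted
(`card_add_two_le`). Searches from these give all distances except those between remaining vertices,
which are at most `1`.

For item 1, searches from `K` give the distances from `K`. A shortest walk from `u` to `v` that
meets `K` in `x` has length `dist x u + dist x v`; minimising over `x` costs `O(|K|)` per pair. A
shortest walk that avoids `K` lives in the interval graph `G - K`, whose distances must therefore be
available in constant time per pair after `O(n^2)` preprocessing. In a component take `y` farthest
from some `x`, with as few neighbours as possible in the level before its own. If `y` has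
eccentricity at most `2`, nonadjacent vertices have a common neighbour (`exists_common_neighbor`).
Otherwise the vertices farthest from `y` form an end segment of the interval representation
(`exists_isEnd`). The levels of a search from this segment follow the line, so the upper
neighbourhoods of the vertices of a level are nested (`IsEnd.isLadder`), and climbing greedily
through best upper neighbours is optimal. Vertices whose levels differ by `j ≥ 1` have distance `j`,
`j + 1` or `j + 2`; which one is decided by climbing from the lower vertex and from its best
neighbour in its own level (`IsLadder.dist_eq`). The interval representation occurs only in the
proof, never in the algorithm.

The algorithms are written in a small imperative language with a calculus for total correctness and
running time (`WP`). Values grow by at most a constant per step and so remain polynomial; hence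
words of logarithmic length suffice, and compilation to the word RAM costs a constant factor
(`compile_exec`, `outputsWithin_of_big`). -/

/-! ### A structured imperative language with arrays -/

namespace Imp

open WordRAM

/-- Expressions over variables and arrays, both named by natural numbers. -/
inductive Expr where
  | const (c : ℕ)
  | var (x : ℕ)
  | arr (a : ℕ) (i : Expr)
  | add (e f : Expr)
  | sub (e f : Expr)
  | mul (e f : Expr)

/-- Tests on expressions. -/
inductive Cond where
  | lt (e f : Expr)
  | eq (e f : Expr)

/-- Commands; `cmin x e` is `x := min x e`, and `store a i e` is `a[i] := e`. -/
inductive Cmd where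
  | skip
  | set (x : ℕ) (e : Expr)
  | cmin (x : ℕ) (e : Expr)
  | store (a : ℕ) (i e : Expr)
  | seq (c d : Cmd)
  | ite (b : Cond) (c d : Cmd)
  | loop (b : Cond) (c : Cmd)

/-- The values of the variables and of the arrays. -/
structure St where
  v : ℕ → ℕ
  a : ℕ → ℕ → ℕ

/-- Assignment to a variable. -/
def St.setV (σ : St) (x k : ℕ) : St := { σ with v := Function.update σ.v x k }

/-- Assignment to an array entry. -/
def St.setA (σ : St) (a i k : ℕ) : St :=
  { σ with a := Function.update σ.a a (Function.update (σ.a a) i k) }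

/-- The value of an expression. -/
def Expr.eval (σ : St) : Expr → ℕ
  | .const c => c
  | .var x => σ.v x
  | .arr a i => σ.a a (i.eval σ)
  | .add e f => e.eval σ + f.eval σ
  | .sub e f => e.eval σ - f.eval σ
  | .mul e f => e.eval σ * f.eval σ

/-- The truth value of a test. -/
def Cond.Holds (σ : St) : Cond → Prop
  | .lt e f => e.eval σ < f.eval σ
  | .eq e f => e.eval σ = f.eval σ

/-- Big-step semantics with unit cost for assignments and tests. -/
inductive Big : Cmd → St → ℕ → St → Prop where
  | skip (σ : St) : Big .skip σ 1 σ
  | set (x : ℕ) (e : Expr) (σ : St) : Big (.set x e) σ 1 (σ.setV x (e.eval σ))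
  | cmin (x : ℕ) (e : Expr) (σ : St) :
      Big (.cmin x e) σ 1 (σ.setV x (min (σ.v x) (e.eval σ)))
  | store (a : ℕ) (i e : Expr) (σ : St) :
      Big (.store a i e) σ 1 (σ.setA a (i.eval σ) (e.eval σ))
  | seq {c d : Cmd} {σ σ' σ'' : St} {t t' : ℕ} :
      Big c σ t σ' → Big d σ' t' σ'' → Big (.seq c d) σ (t + t') σ''
  | iteTrue {b : Cond} {c d : Cmd} {σ σ' : St} {t : ℕ} :
      b.Holds σ → Big c σ t σ' → Big (.ite b c d) σ (1 + t) σ'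
  | iteFalse {b : Cond} {c d : Cmd} {σ σ' : St} {t : ℕ} :
      ¬ b.Holds σ → Big d σ t σ' → Big (.ite b c d) σ (1 + t) σ'
  | whileTrue {b : Cond} {c : Cmd} {σ σ' σ'' : St} {t t' : ℕ} :
      b.Holds σ → Big c σ t σ' → Big (.loop b c) σ' t' σ'' →
        Big (.loop b c) σ (1 + t + t') σ''
  | whileFalse {b : Cond} {c : Cmd} {σ : St} : ¬ b.Holds σ → Big (.loop b c) σ 1 σ

/-! ### Syntactic restrictions that bound the values -/

/-- A size that bounds the degree of an expression and its constants. -/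
def Expr.size : Expr → ℕ
  | .const c => c + 1
  | .var _ => 1
  | .arr _ i => i.size + 2
  | .add e f => e.size + f.size
  | .sub e f => e.size + f.size
  | .mul e f => e.size + f.size

/-- Only the arrays `0, …, 31` occur. -/
def Expr.ok : Expr → Bool
  | .const _ => true
  | .var _ => true
  | .arr a i => decide (a < 32) && i.ok
  | .add e f => e.ok && f.ok
  | .sub e f => e.ok && f.ok
  | .mul e f => e.ok && f.ok

/-- Expressions whose values exceed the current values by at most a constant. -/
def Expr.flat : Expr → Bool
  | .const _ => true
  | .var _ => true
  | .arr _ _ => true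
  | .add e (.const _) => e.flat
  | .add _ _ => false
  | .sub e _ => e.flat
  | .mul _ _ => false

def Cond.size : Cond → ℕ
  | .lt e f => e.size + f.size
  | .eq e f => e.size + f.size

def Cond.ok : Cond → Bool
  | .lt e f => e.ok && f.ok
  | .eq e f => e.ok && f.ok

def Cmd.size : Cmd → ℕ
  | .skip => 1
  | .set _ e => e.size
  | .cmin _ e => e.size
  | .store _ i e => i.size + 2 + e.size
  | .seq c d => c.size + d.size
  | .ite b c d => b.size + c.size + d.size
  | .loop b c => b.size + c.size

/-- Commands that stay within the arrays `0, …, 31` and assign flat expressions only. -/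
def Cmd.ok : Cmd → Bool
  | .skip => true
  | .set _ e => e.ok && e.flat
  | .cmin _ e => e.ok
  | .store a i e => decide (a < 32) && i.ok && e.ok && e.flat
  | .seq c d => c.ok && d.ok
  | .ite b c d => b.ok && c.ok && d.ok
  | .loop b c => b.ok && c.ok

/-- All values are at most `b`. -/
structure Bounded (σ : St) (b : ℕ) : Prop where
  v : ∀ x, σ.v x ≤ b
  a : ∀ a i, σ.a a i ≤ b

theorem Bounded.mono {σ : St} {b b' : ℕ} (h : Bounded σ b) (hb : b ≤ b') : Bounded σ b' :=
  ⟨fun x => (h.v x).trans hb, fun a i => (h.a a i).trans hb⟩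

theorem Bounded.setV {σ : St} {b : ℕ} (h : Bounded σ b) {x k : ℕ} (hk : k ≤ b) :
    Bounded (σ.setV x k) b := by
  refine ⟨fun y => ?_, h.a⟩
  simp only [St.setV, Function.update_apply]
  split_ifs
  exacts [hk, h.v y]

theorem Bounded.setA {σ : St} {b : ℕ} (h : Bounded σ b) {a i k : ℕ} (hk : k ≤ b) :
    Bounded (σ.setA a i k) b := by
  refine ⟨h.v, fun a' j => ?_⟩
  simp only [St.setA, Function.update_apply]
  split_ifs with h1
  · subst h1
    simp only [Function.update_apply]
    split_ifs
    exacts [hk, h.a a' j]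
  · exact h.a a' j

theorem Expr.one_le_size (e : Expr) : 1 ≤ e.size := by
  induction e <;> simp only [Expr.size] <;> omega

theorem Expr.eval_le_of_flat {σ : St} {b : ℕ} (h : Bounded σ b) (e : Expr) (he : e.flat = true) :
    e.eval σ ≤ b + e.size := by
  induction e with
  | const c => simp only [Expr.eval, Expr.size]; omega
  | var x => exact (h.v x).trans (by omega)
  | arr a i => exact (h.a a _).trans (by omega)
  | add e f ihe ihf =>
    cases f <;> simp_all only [Expr.flat, Expr.eval, Expr.size, Bool.false_eq_true,
      forall_const]
    omega
  | sub e f ihe ihf =>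
    simp only [Expr.flat] at he
    have := ihe he
    simp only [Expr.eval, Expr.size]; omega
  | mul e f => simp [Expr.flat] at he

/-- Each step assigns a flat expression or a minimum with an old value, so it raises the largest
value by at most the size of the command. Polynomial time thus means polynomial values. -/
theorem Big.bounded {c : Cmd} {σ σ' : St} {t Z : ℕ} (hbig : Big c σ t σ') :
    ∀ {b : ℕ}, c.ok = true → c.size ≤ Z → Bounded σ b → Bounded σ' (b + Z * t) := by
  induction hbig with
  | skip σ => exact fun _ _ h => h.mono (by omega)
  | set x e σ =>
    intro b hok hZ h
    simp only [Cmd.ok, Bool.and_eq_true] at hok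
    simp only [Cmd.size] at hZ
    exact (h.mono (by omega)).setV ((e.eval_le_of_flat h hok.2).trans (by omega))
  | cmin x e σ =>
    intro b hok hZ h
    exact (h.mono (by omega)).setV (((min_le_left _ _).trans (h.v x)).trans (by omega))
  | store a i e σ =>
    intro b hok hZ h
    simp only [Cmd.ok, Bool.and_eq_true] at hok
    simp only [Cmd.size] at hZ
    exact (h.mono (by omega)).setA ((e.eval_le_of_flat h hok.2).trans (by omega))
  | @seq c d σ σ' σ'' t t' _ _ ih1 ih2 =>
    intro b hok hZ h
    simp only [Cmd.ok, Bool.and_eq_true] at hok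
    simp only [Cmd.size] at hZ
    rw [mul_add, ← add_assoc]
    exact ih2 hok.2 (by omega) (ih1 hok.1 (by omega) h)
  | iteTrue _ _ ih =>
    intro b hok hZ h
    simp only [Cmd.ok, Bool.and_eq_true] at hok
    simp only [Cmd.size] at hZ
    exact (ih hok.1.2 (by omega) h).mono (by gcongr; omega)
  | iteFalse _ _ ih =>
    intro b hok hZ h
    simp only [Cmd.ok, Bool.and_eq_true] at hok
    simp only [Cmd.size] at hZ
    exact (ih hok.2 (by omega) h).mono (by gcongr; omega)
  | @whileTrue b c σ σ' σ'' t t' _ _ _ ih1 ih2 =>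
    intro b hok hZ h
    have hok' := hok
    simp only [Cmd.ok, Bool.and_eq_true] at hok
    have hZ' := hZ
    simp only [Cmd.size] at hZ
    refine (ih2 hok' hZ' (ih1 hok.2 (by omega) h)).mono ?_
    rw [add_assoc, ← mul_add]
    gcongr
    omega
  | whileFalse _ => exact fun _ _ h => h.mono (by omega)

/-! ### Compilation to the word RAM -/

/-- The registers that hold intermediate results. -/
abbrev tmp (d : ℕ) : ℕ := 2 * d + 7

/-- Sequential composition of RAM programs. -/
infixr:65 " ⨾ " => Program.seq

/-- Add the start of array `a` to the index in register `tmp d`. -/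
def compileAddr (a d d' : ℕ) : Program :=
  .instr (.mul (tmp d) (tmp d) 3) ⨾ .instr (.add (tmp d) (tmp d) 1) ⨾
    .instr (.const (tmp d') a) ⨾ .instr (.add (tmp d) (tmp d) (tmp d'))

/-- Evaluate an expression into register `tmp d`. -/
def compileE : Expr → ℕ → Program
  | .const c, d => .instr (.const (tmp d) c)
  | .var x, d => .instr (.move (tmp d) (2 * x))
  | .arr a i, d => compileE i d ⨾ compileAddr a d (d + 1) ⨾ .instr (.load (tmp d) (tmp d))
  | .add e f, d => compileE e d ⨾ compileE f (d + 1) ⨾ .instr (.add (tmp d) (tmp d) (tmp (d + 1)))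
  | .sub e f, d => compileE e d ⨾ compileE f (d + 1) ⨾ .instr (.sub (tmp d) (tmp d) (tmp (d + 1)))
  | .mul e f, d => compileE e d ⨾ compileE f (d + 1) ⨾ .instr (.mul (tmp d) (tmp d) (tmp (d + 1)))

def compileCond : Cond → Program
  | .lt e f => compileE e 0 ⨾ compileE f 1
  | .eq e f => compileE e 0 ⨾ compileE f 1

def compileTest : Cond → Test
  | .lt _ _ => .lt (tmp 0) (tmp 1)
  | .eq _ _ => .eq (tmp 0) (tmp 1)

def compile : Cmd → Program
  | .skip => .instr (.const (tmp 0) 0)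
  | .set x e => compileE e 0 ⨾ .instr (.move (2 * x) (tmp 0))
  | .cmin x e => compileE e 0 ⨾
      .ite (.lt (tmp 0) (2 * x)) (.instr (.move (2 * x) (tmp 0))) (.instr (.const (tmp 0) 0))
  | .store a i e => compileE i 0 ⨾ compileE e 1 ⨾ compileAddr a 0 2 ⨾
      .instr (.store (tmp 0) (tmp 1))
  | .seq c d => compile c ⨾ compile d
  | .ite b c d => compileCond b ⨾ .ite (compileTest b) (compile c) (compile d)
  | .loop b c => compileCond b ⨾ .loop (compileTest b) (compile c ⨾ compileCond b)

/-- The RAM state `s` represents `σ`, with the arrays interleaved from address `B` on. -/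
structure Rel (B : ℕ) (σ : St) (s : State) : Prop where
  reg : ∀ x, s.reg (2 * x) = σ.v x
  base : s.reg 1 = B
  width : s.reg 3 = 32
  mem : ∀ a < 32, ∀ i, s.mem (i * 32 + B + a) = σ.a a i

/-- Products add exponents. Sums obey the same bound because both powers are at least `2`, and an
array access returns a stored value whatever its index. -/
theorem Expr.eval_le {σ : St} {b : ℕ} (h : Bounded σ b) (e : Expr) :
    e.eval σ ≤ (b + 2) ^ e.size := by
  have h1 : 1 ≤ b + 2 := by omega
  have key : ∀ p q : ℕ, 1 ≤ p → 1 ≤ q → (b + 2) ^ p + (b + 2) ^ q ≤ (b + 2) ^ (p + q) := by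
    intro p q hp hq
    have hp2 : 2 ≤ (b + 2) ^ p := (by omega : 2 ≤ b + 2).trans (Nat.le_self_pow (by omega) _)
    have hq2 : 2 ≤ (b + 2) ^ q := (by omega : 2 ≤ b + 2).trans (Nat.le_self_pow (by omega) _)
    rw [pow_add]
    nlinarith
  induction e with
  | const c =>
    exact (Nat.lt_pow_self (by omega : 1 < b + 2)).le.trans
      (Nat.pow_le_pow_right h1 (Nat.le_succ c))
  | var x => exact (h.v x).trans (by simp [Expr.size])
  | arr a i =>
    exact ((h.a a _).trans (by omega : b ≤ b + 2)).trans (Nat.le_self_pow (by simp [Expr.size]) _)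
  | add e f ihe ihf =>
    exact (Nat.add_le_add ihe ihf).trans (key _ _ e.one_le_size f.one_le_size)
  | sub e f ihe ihf =>
    exact ((Nat.sub_le _ _).trans ihe).trans (Nat.pow_le_pow_right h1 (by simp [Expr.size]))
  | mul e f ihe ihf =>
    simp only [Expr.size, pow_add]
    exact Nat.mul_le_mul ihe ihf

/-- The extra `2` in the size of an array access pays here for the stride `32` and the base address.
-/
theorem address_lt {b B i a p w : ℕ} (hB : B ≤ b) (hb : 32 ≤ b) (ha : a < 32)
    (hp : 1 ≤ p) (hi : i ≤ (b + 2) ^ p) (hw : (b + 2) ^ (p + 2) < 2 ^ w) :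
    i * 32 + B + a < 2 ^ w := by
  have hp2 : b + 2 ≤ (b + 2) ^ p := Nat.le_self_pow (by omega) _
  rw [pow_add] at hw
  nlinarith [Nat.mul_le_mul hi hb]

theorem exec_instr {w : ℕ} {i : Instr} {s s' : State} (h : i.run w s = s') :
    Exec w (.instr i) s 1 s' := h ▸ Exec.instr i s

theorem compileAddr_exec {w B a d d' i : ℕ} {s : State} (hd : d < d') (h1 : s.reg 1 = B)
    (h3 : s.reg 3 = 32) (hi : s.reg (tmp d) = i) (ha : a < 32) (hw : i * 32 + B + a < 2 ^ w) :
    ∃ s', Exec w (compileAddr a d d') s 4 s' ∧ s'.mem = s.mem ∧ s'.reg (tmp d) = i * 32 + B + a ∧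
      ∀ r, r ≠ tmp d → r ≠ tmp d' → s'.reg r = s.reg r := by
  refine ⟨_, .seq (.instr _ _) (.seq (.instr _ _) (.seq (.instr _ _) (.instr _ _))), rfl, ?_, ?_⟩
  · have e1 : (1 : ℕ) ≠ tmp d := by simp only [tmp]; omega
    have e2 : tmp d ≠ tmp d' := by simp only [tmp]; omega
    simp only [Instr.run, State.setReg, Function.update_self, Function.update_of_ne e1,
      Function.update_of_ne e2, h1, h3, hi]
    rw [Nat.mod_eq_of_lt (by omega : i * 32 < 2 ^ w), Nat.mod_eq_of_lt (by omega : a < 2 ^ w),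
      Nat.mod_eq_of_lt (by omega : i * 32 + B < 2 ^ w), Nat.mod_eq_of_lt hw]
  · intro r hr hr'
    simp only [Instr.run, State.setReg, Function.update_of_ne hr, Function.update_of_ne hr']

/-- The number of steps for evaluating an expression. -/
def Expr.cost : Expr → ℕ
  | .const _ => 1
  | .var _ => 1
  | .arr _ i => i.cost + (4 + 1)
  | .add e f => e.cost + (f.cost + 1)
  | .sub e f => e.cost + (f.cost + 1)
  | .mul e f => e.cost + (f.cost + 1)

/-- Variables occupy the even registers, base and stride the registers `1` and `3`, and intermediate
results the odd registers from `7` on. Changes to the latter do not affect the represented state. -/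
theorem Rel.of_agree {B : ℕ} {σ : St} {s s' : State} (h : Rel B σ s) (hm : s'.mem = s.mem)
    (hr : ∀ r, (Even r ∨ r < 7) → s'.reg r = s.reg r) : Rel B σ s' :=
  ⟨fun x => (hr _ (.inl (even_two_mul x))).trans (h.reg x), (hr 1 (.inr (by omega))).trans h.base,
    (hr 3 (.inr (by omega))).trans h.width, fun a ha i => hm ▸ h.mem a ha i⟩

/-- The registers `tmp d` act as a stack: evaluation at depth `d` leaves everything below `tmp d`
intact, so a left operand survives the evaluation of the right one. The bound on `2 ^ w` ensures
that no value is truncated. -/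
theorem compileE_exec {w b B : ℕ} {σ : St} (hσ : Bounded σ b) (hB : B ≤ b) (hb : 32 ≤ b)
    (e : Expr) : ∀ {d : ℕ} {s : State}, e.ok = true → (b + 2) ^ e.size < 2 ^ w → Rel B σ s →
      ∃ s', Exec w (compileE e d) s e.cost s' ∧ s'.mem = s.mem ∧ s'.reg (tmp d) = e.eval σ ∧
        ∀ r, (Even r ∨ r < tmp d) → s'.reg r = s.reg r := by
  have hne : ∀ r d : ℕ, (Even r ∨ r < tmp d) → r ≠ tmp d := by
    rintro r d (h | h) rfl
    · rw [Nat.even_iff] at h; simp only [tmp] at h; omega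
    · omega
  have hup : ∀ r d : ℕ, (Even r ∨ r < tmp d) → (Even r ∨ r < tmp (d + 1)) := by
    rintro r d (h | h)
    · exact .inl h
    · exact .inr (by simp only [tmp] at *; omega)
  induction e with
  | const c =>
    intro d s hok hw hR
    refine ⟨_, .instr _ _, rfl, ?_, fun r hr => ?_⟩
    · have := (Expr.eval_le hσ (.const c)).trans_lt hw
      simp only [Instr.run, State.setReg, Function.update_self]
      exact Nat.mod_eq_of_lt this
    · simp only [Instr.run, State.setReg, Function.update_of_ne (hne r d hr)]
  | var x =>
    intro d s hok hw hR
    refine ⟨_, .instr _ _, rfl, ?_, fun r hr => ?_⟩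
    · have := (Expr.eval_le hσ (.var x)).trans_lt hw
      simp only [Instr.run, State.setReg, Function.update_self, hR.reg]
      exact Nat.mod_eq_of_lt this
    · simp only [Instr.run, State.setReg, Function.update_of_ne (hne r d hr)]
  | arr a i ih =>
    intro d s hok hw hR
    simp only [Expr.ok, Bool.and_eq_true, decide_eq_true_eq] at hok
    simp only [Expr.size] at hw
    have hw1 : (b + 2) ^ i.size < 2 ^ w :=
      (Nat.pow_le_pow_right (by omega) (by omega)).trans_lt hw
    obtain ⟨s1, x1, m1, v1, r1⟩ := ih (d := d) hok.2 hw1 hR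
    have hR1 := hR.of_agree m1 fun r hr => r1 r (hr.imp_right fun h => by simp only [tmp]; omega)
    obtain ⟨s2, x2, m2, v2, r2⟩ := compileAddr_exec (d' := d + 1) (by omega) hR1.base hR1.width v1
      hok.1 (address_lt hB hb hok.1 i.one_le_size (i.eval_le hσ) hw)
    refine ⟨_, .seq x1 (.seq x2 (.instr _ _)), m2.trans m1, ?_, fun r hr => ?_⟩
    · have := (Expr.eval_le hσ (.arr a i)).trans_lt (by simpa only [Expr.size] using hw)
      simp only [Instr.run, State.setReg, Function.update_self, v2, m2]
      rw [hR1.mem a hok.1]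
      exact Nat.mod_eq_of_lt this
    · simp only [Instr.run, State.setReg, Function.update_of_ne (hne r d hr)]
      rw [r2 r (hne r d hr) (hne r _ (hup r d hr)), r1 r hr]
  | add e f ihe ihf | sub e f ihe ihf | mul e f ihe ihf =>
    intro d s hok hw hR
    have hv := (Expr.eval_le hσ _).trans_lt hw
    simp only [Expr.ok, Bool.and_eq_true] at hok
    simp only [Expr.size] at hw
    have hwe : (b + 2) ^ e.size < 2 ^ w :=
      (Nat.pow_le_pow_right (by omega) (by omega)).trans_lt hw
    have hwf : (b + 2) ^ f.size < 2 ^ w :=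
      (Nat.pow_le_pow_right (by omega) (by omega)).trans_lt hw
    obtain ⟨s1, x1, m1, v1, r1⟩ := ihe (d := d) hok.1 hwe hR
    have hR1 := hR.of_agree m1 fun r hr => r1 r (hr.imp_right fun h => by simp only [tmp]; omega)
    obtain ⟨s2, x2, m2, v2, r2⟩ := ihf (d := d + 1) hok.2 hwf hR1
    refine ⟨_, .seq x1 (.seq x2 (.instr _ _)), m2.trans m1, ?_, fun r hr => ?_⟩
    · simp only [Instr.run, State.setReg, Function.update_self, v2,
        r2 (tmp d) (.inr (by simp only [tmp]; omega)), v1]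
      exact Nat.mod_eq_of_lt hv
    · simp only [Instr.run, State.setReg, Function.update_of_ne (hne r d hr)]
      rw [r2 r (hup r d hr), r1 r hr]

def Cond.cost : Cond → ℕ
  | .lt e f => e.cost + f.cost
  | .eq e f => e.cost + f.cost

theorem compileCond_exec {w b B : ℕ} {σ : St} (hσ : Bounded σ b) (hB : B ≤ b) (hb : 32 ≤ b)
    (c : Cond) {s : State} (hok : c.ok = true) (hw : (b + 2) ^ c.size < 2 ^ w) (hR : Rel B σ s) :
    ∃ s', Exec w (compileCond c) s c.cost s' ∧ Rel B σ s' ∧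
      ((compileTest c).Holds s' ↔ c.Holds σ) := by
  cases c with
  | lt e f | eq e f =>
    simp only [Cond.ok, Bool.and_eq_true] at hok
    simp only [Cond.size] at hw
    have hwe : (b + 2) ^ e.size < 2 ^ w :=
      (Nat.pow_le_pow_right (by omega) (by omega)).trans_lt hw
    have hwf : (b + 2) ^ f.size < 2 ^ w :=
      (Nat.pow_le_pow_right (by omega) (by omega)).trans_lt hw
    obtain ⟨s1, x1, m1, v1, r1⟩ := compileE_exec hσ hB hb e (d := 0) hok.1 hwe hR
    have hR1 := hR.of_agree m1 fun r hr => r1 r hr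
    obtain ⟨s2, x2, m2, v2, r2⟩ := compileE_exec hσ hB hb f (d := 1) hok.2 hwf hR1
    refine ⟨s2, .seq x1 x2, hR1.of_agree m2 fun r hr => r2 r (hr.imp_right fun h => by
      simp only [tmp]; omega), ?_⟩
    simp only [compileTest, Test.Holds, Cond.Holds, v2, r2 (tmp 0) (.inr (by simp)), v1]

/-- A bound for the overhead of compilation, per step. -/
def Cmd.cost : Cmd → ℕ
  | .skip => 1
  | .set _ e => e.cost + 1
  | .cmin _ e => e.cost + 2
  | .store _ i e => i.cost + e.cost + 5
  | .seq c d => c.cost + d.cost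
  | .ite b c d => b.cost + 1 + c.cost + d.cost
  | .loop b c => 2 * b.cost + 1 + c.cost

theorem Rel.setV {B w : ℕ} {σ : St} {s : State} (h : Rel B σ s) {x k : ℕ} (hk : k < 2 ^ w) :
    Rel B (σ.setV x k) (s.setReg w (2 * x) k) := by
  refine ⟨fun y => ?_, ?_, ?_, h.mem⟩
  · simp only [State.setReg, St.setV, Function.update_apply, Nat.mod_eq_of_lt hk]
    by_cases hxy : y = x
    · simp [hxy]
    · rw [if_neg (by omega), if_neg hxy, h.reg]
  · simp only [State.setReg, Function.update_of_ne (show 1 ≠ 2 * x by omega), h.base]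
  · simp only [State.setReg, Function.update_of_ne (show 3 ≠ 2 * x by omega), h.width]

/-- The overhead of the compiled program is a constant factor. -/
theorem compile_exec {w B W Z : ℕ} (hB : B ≤ W) (hb : 32 ≤ W) {c : Cmd} {σ σ' : St} {t : ℕ}
    (hbig : Big c σ t σ') : ∀ {b κ : ℕ} {s : State}, c.ok = true → c.size ≤ Z → c.cost ≤ κ →
      (W + 2) ^ Z < 2 ^ w → Bounded σ b → b + Z * t ≤ W → Rel B σ s →
      ∃ (t' : ℕ) (s' : State), Exec w (compile c) s t' s' ∧ Rel B σ' s' ∧ t' ≤ κ * t := by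
  have hpow : ∀ {p : ℕ}, p ≤ Z → (W + 2) ^ Z < 2 ^ w → (W + 2) ^ p < 2 ^ w := fun hp h =>
    (Nat.pow_le_pow_right (by omega) hp).trans_lt h
  have cond_step : ∀ {β : Cond} {σ : St} {b : ℕ} {s : State}, β.ok = true → β.size ≤ Z →
      (W + 2) ^ Z < 2 ^ w → Bounded σ b → b ≤ W → Rel B σ s →
      ∃ s', Exec w (compileCond β) s β.cost s' ∧ Rel B σ s' ∧
        ((compileTest β).Holds s' ↔ β.Holds σ) := fun {β} _ _ _ h1 h2 h3 h4 h5 h6 =>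
    compileCond_exec (h4.mono h5) hB hb β h1 (hpow h2 h3) h6
  induction hbig with
  | skip σ =>
    intro b κ s hok hZ hκ hw hσ hW hR
    refine ⟨1, _, .instr _ _, hR.of_agree rfl fun r hr => ?_, ?_⟩
    · simp only [Instr.run, State.setReg]
      refine Function.update_of_ne ?_ _ _
      rintro rfl
      simp [Nat.even_iff] at hr
    · simp only [Cmd.cost] at hκ; omega
  | set x e σ =>
    intro b κ s hok hZ hκ hw hσ hW hR
    simp only [Cmd.ok, Bool.and_eq_true] at hok
    simp only [Cmd.size] at hZ
    have hσ' := hσ.mono (by omega : b ≤ W)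
    obtain ⟨s1, x1, m1, v1, r1⟩ := compileE_exec hσ' hB hb e (d := 0) hok.1 (hpow hZ hw) hR
    have hR1 := hR.of_agree m1 fun r hr => r1 r hr
    refine ⟨_, _, .seq x1 (.instr _ _), ?_, ?_⟩
    · have := hR1.setV (x := x) ((e.eval_le hσ').trans_lt (hpow hZ hw))
      simpa only [Instr.run, v1] using this
    · simp only [Cmd.cost] at hκ; omega
  | cmin x e σ =>
    intro b κ s hok hZ hκ hw hσ hW hR
    simp only [Cmd.ok] at hok
    simp only [Cmd.size] at hZ
    have hσ' := hσ.mono (by omega : b ≤ W)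
    obtain ⟨s1, x1, m1, v1, r1⟩ := compileE_exec hσ' hB hb e (d := 0) hok (hpow hZ hw) hR
    have hR1 := hR.of_agree m1 fun r hr => r1 r hr
    simp only [Cmd.cost] at hκ
    by_cases hlt : e.eval σ < σ.v x
    · refine ⟨_, _, .seq x1 (.iteTrue ?_ (.instr _ _)), ?_, ?_⟩
      · simp only [Test.Holds, v1, hR1.reg, hlt]
      · have := hR1.setV (x := x) ((e.eval_le hσ').trans_lt (hpow hZ hw))
        simpa only [Instr.run, v1, min_eq_right hlt.le] using this
      · omega
    · refine ⟨_, _, .seq x1 (.iteFalse ?_ (.instr _ _)), ?_, ?_⟩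
      · simp only [Test.Holds, v1, hR1.reg, hlt, not_false_eq_true]
      · have : σ.setV x (min (σ.v x) (e.eval σ)) = σ := by
          rw [min_eq_left (not_lt.1 hlt)]
          simp [St.setV]
        rw [this]
        refine hR1.of_agree rfl fun r hr => ?_
        simp only [Instr.run, State.setReg]
        refine Function.update_of_ne ?_ _ _
        rintro rfl
        simp [Nat.even_iff] at hr
      · omega
  | store a i e σ =>
    intro b κ s hok hZ hκ hw hσ hW hR
    simp only [Cmd.ok, Bool.and_eq_true, decide_eq_true_eq] at hok
    obtain ⟨⟨⟨ha, hi⟩, he⟩, -⟩ := hok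
    simp only [Cmd.size] at hZ
    have hσ' := hσ.mono (by omega : b ≤ W)
    obtain ⟨s1, x1, m1, v1, r1⟩ := compileE_exec hσ' hB hb i (d := 0) hi
      (hpow (by omega) hw) hR
    have hR1 := hR.of_agree m1 fun r hr => r1 r hr
    obtain ⟨s2, x2, m2, v2, r2⟩ := compileE_exec hσ' hB hb e (d := 1) he
      (hpow (by omega) hw) hR1
    have hR2 := hR1.of_agree m2 fun r hr => r2 r (hr.imp_right fun h => by simp only [tmp]; omega)
    have v2' : s2.reg (tmp 0) = i.eval σ := by rw [r2 (tmp 0) (.inr (by simp)), v1]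
    obtain ⟨s3, x3, m3, v3, r3⟩ := compileAddr_exec (d' := 2) (by omega) hR2.base hR2.width v2'
      ha (address_lt hB hb ha i.one_le_size (i.eval_le hσ') (hpow (by omega) hw))
    refine ⟨_, _, .seq x1 (.seq x2 (.seq x3 (.instr _ _))), ?_, ?_⟩
    · have hR3 : Rel B σ s3 := hR2.of_agree m3 fun r hr => r3 r
        (by rintro rfl; simp [Nat.even_iff] at hr) (by rintro rfl; simp [Nat.even_iff] at hr)
      refine ⟨hR3.reg, hR3.base, hR3.width, fun a' ha' j => ?_⟩
      have := hR3.mem a' ha' j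
      simp only [Instr.run, v3, r3 (tmp 1) (by simp) (by simp), v2, St.setA,
        Function.update_apply]
      by_cases h : a' = a
      · subst h
        simp only [if_true, Function.update_apply]
        by_cases hj : j = i.eval σ
        · simp [hj]
        · rw [if_neg (by omega), if_neg hj, this]
      · rw [if_neg (by omega), if_neg h, this]
    · simp only [Cmd.cost] at hκ; omega
  | @seq c d σ σ' σ'' t t' h1 _ ih1 ih2 =>
    intro b κ s hok hZ hκ hw hσ hW hR
    simp only [Cmd.ok, Bool.and_eq_true] at hok
    simp only [Cmd.size] at hZ
    simp only [Cmd.cost] at hκ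
    rw [mul_add] at hW
    obtain ⟨t1, s1, x1, R1, T1⟩ := ih1 hok.1 (by omega) (by omega : c.cost ≤ κ) hw hσ
      (by omega) hR
    obtain ⟨t2, s2, x2, R2, T2⟩ := ih2 hok.2 (by omega) (by omega : d.cost ≤ κ) hw
      (h1.bounded hok.1 (by omega : c.size ≤ Z) hσ) (by omega) R1
    exact ⟨_, _, .seq x1 x2, R2, by rw [mul_add]; omega⟩
  | @iteTrue β c d σ σ' t hβ _ ih =>
    intro b κ s hok hZ hκ hw hσ hW hR
    simp only [Cmd.ok, Bool.and_eq_true] at hok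
    simp only [Cmd.size] at hZ
    simp only [Cmd.cost] at hκ
    rw [mul_add] at hW
    obtain ⟨s1, x1, R1, T1⟩ := cond_step hok.1.1 (by omega) hw hσ (by omega) hR
    obtain ⟨t2, s2, x2, R2, T2⟩ := ih hok.1.2 (by omega) (by omega : c.cost ≤ κ) hw hσ
      (by omega) R1
    exact ⟨_, _, .seq x1 (.iteTrue (T1.2 hβ) x2), R2, by rw [mul_add]; omega⟩
  | @iteFalse β c d σ σ' t hβ _ ih =>
    intro b κ s hok hZ hκ hw hσ hW hR
    simp only [Cmd.ok, Bool.and_eq_true] at hok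
    simp only [Cmd.size] at hZ
    simp only [Cmd.cost] at hκ
    rw [mul_add] at hW
    obtain ⟨s1, x1, R1, T1⟩ := cond_step hok.1.1 (by omega) hw hσ (by omega) hR
    obtain ⟨t2, s2, x2, R2, T2⟩ := ih hok.2 (by omega) (by omega : d.cost ≤ κ) hw hσ
      (by omega) R1
    exact ⟨_, _, .seq x1 (.iteFalse (fun h => hβ (T1.1 h)) x2), R2, by rw [mul_add]; omega⟩
  | @whileTrue β c σ σ' σ'' t t' hβ h1 _ ih1 ih2 =>
    intro b κ s hok hZ hκ hw hσ hW hR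
    have hok' := hok
    have hZ' := hZ
    have hκ' := hκ
    simp only [Cmd.ok, Bool.and_eq_true] at hok
    simp only [Cmd.size] at hZ
    simp only [Cmd.cost] at hκ
    rw [mul_add, mul_add] at hW
    obtain ⟨s1, x1, R1, T1⟩ := cond_step hok.1 (by omega) hw hσ (by omega) hR
    obtain ⟨t2, s2, x2, R2, T2⟩ := ih1 hok.2 (by omega) (by omega : c.cost ≤ c.cost) hw hσ
      (by omega) R1
    obtain ⟨t3, s3, x3, R3, T3⟩ := ih2 hok' hZ' hκ' hw
      (h1.bounded hok.2 (by omega : c.size ≤ Z) hσ) (by omega) R2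
    simp only [compile] at x3
    -- The RAM loop evaluates its condition before it is entered and again at the end of each body.
    -- Splitting the run of the remaining loop yields the evaluation `x4` that belongs to the body
    -- of the present round.
    cases x3 with
    | @seq _ _ _ s4 _ t4 t5 x4 x5 =>
      refine ⟨_, _, .seq x1 (.loopTrue (T1.2 hβ) (.seq x2 x4) x5), R3, ?_⟩
      have ht : 1 ≤ t := by
        clear * - h1
        induction h1 <;> omega
      have e1 : β.cost + 1 + c.cost * t ≤ κ + κ * t := by
        have : c.cost * t ≤ κ * t := Nat.mul_le_mul_right _ (by omega)
        omega
      rw [mul_add, mul_add]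
      omega
  | @whileFalse β c σ hβ =>
    intro b κ s hok hZ hκ hw hσ hW hR
    simp only [Cmd.ok, Bool.and_eq_true] at hok
    simp only [Cmd.size] at hZ
    simp only [Cmd.cost] at hκ
    obtain ⟨s1, x1, R1, T1⟩ := cond_step hok.1 (by omega) hw hσ (by omega) hR
    exact ⟨_, _, .seq x1 (.loopFalse fun h => hβ (T1.1 h)), R1, by omega⟩

end Imp

/-! ### Running compiled commands on inputs -/

namespace Imp

open WordRAM

/-- The initial state for an input `x`, stored in array `1`. -/
def St.init (x : List ℕ) : St where
  v := fun _ => 0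
  a := fun a i => if a = 1 then x.getD i 0 else 0

/-- A number of cells, computed from the input, that contains the input. -/
def cells (x : List ℕ) : ℕ :=
  let q := x.getD 0 0 + 1 + 1 + x.getD (x.getD 0 0 + 1) 0
  q + 1 + x.getD q 0

/-- Compute `cells` and put the constants in place. -/
def prelude : Program :=
  .instr (.const 7 0) ⨾ .instr (.load 9 7) ⨾ .instr (.const 11 1) ⨾ .instr (.add 13 9 11) ⨾
  .instr (.load 15 13) ⨾ .instr (.add 13 13 11) ⨾ .instr (.add 13 13 15) ⨾
  .instr (.load 15 13) ⨾ .instr (.add 13 13 11) ⨾ .instr (.add 1 13 15) ⨾ .instr (.const 3 32)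

/-- Copy the input to array `1`. -/
def copyInput : Program :=
  .loop (.lt 7 1) (.instr (.load 9 7) ⨾ .instr (.mul 13 7 3) ⨾ .instr (.add 13 13 1) ⨾
    .instr (.add 13 13 11) ⨾ .instr (.store 13 9) ⨾ .instr (.add 7 7 11))

theorem prelude_exec {w : ℕ} {x : List ℕ} (hw : cells x < 2 ^ w) (hw32 : 32 < 2 ^ w) :
    ∃ s, Exec w prelude (initState x) 11 s ∧ s.mem = (fun i => x.getD i 0) ∧ s.reg 1 = cells x ∧
      s.reg 3 = 32 ∧ s.reg 7 = 0 ∧ s.reg 11 = 1 ∧ ∀ y, s.reg (2 * y) = 0 := by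
  unfold cells at hw ⊢
  set n := x.getD 0 0 with hn
  set m := x.getD (n + 1) 0 with hm
  set k := x.getD (n + 1 + 1 + m) 0 with hk
  simp only at hw
  refine ⟨_, .seq (exec_instr rfl) (.seq (exec_instr rfl) (.seq (exec_instr rfl)
    (.seq (exec_instr rfl) (.seq (exec_instr rfl) (.seq (exec_instr rfl) (.seq (exec_instr rfl)
    (.seq (exec_instr rfl) (.seq (exec_instr rfl) (.seq (exec_instr rfl)
    (exec_instr rfl)))))))))), rfl, ?_, ?_, ?_, ?_, ?_⟩
  · simp [Instr.run, State.setReg, initState, -List.getD_eq_getElem?_getD,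
      Nat.mod_eq_of_lt (show 1 < 2 ^ w by omega)]
    rw [← hn, Nat.mod_eq_of_lt (show n + 1 < 2 ^ w by omega), ← hm,
      Nat.mod_eq_of_lt (show n + 1 + 1 + m < 2 ^ w by omega), Nat.mod_eq_of_lt hw]
  · simp [Instr.run, State.setReg, Nat.mod_eq_of_lt hw32]
  · simp [Instr.run, State.setReg]
  · simp [Instr.run, State.setReg, Nat.mod_eq_of_lt (show 1 < 2 ^ w by omega)]
  · intro y
    have h : ∀ d, 2 * y ≠ 2 * d + 1 := fun d => by omega
    simp [Instr.run, State.setReg, h 0, h 1, h 4, h 5, h 6, h 7, initState]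

/-- Copies are written beyond address `B` and originals are read below it, so nothing is overwritten
before it is read. The other cells from `B` on remain `0`, which provides the arrays that are
initially zero. -/
theorem copyInput_exec {w B : ℕ} {f : ℕ → ℕ} (hf : ∀ i, f i < 2 ^ w) (hw : B * 32 + B + 1 < 2 ^ w) :
    ∀ (j i : ℕ) (s : State), i + j = B → s.reg 1 = B → s.reg 3 = 32 → s.reg 7 = i →
      s.reg 11 = 1 → (∀ y, s.reg (2 * y) = 0) → (∀ l < B, s.mem l = f l) →
      (∀ l < i, s.mem (l * 32 + B + 1) = f l) →
      (∀ p, B ≤ p → (∀ l < i, p ≠ l * 32 + B + 1) → s.mem p = 0) →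
      ∃ s', Exec w copyInput s (7 * j + 1) s' ∧ s'.reg 1 = B ∧ s'.reg 3 = 32 ∧
        (∀ y, s'.reg (2 * y) = 0) ∧ (∀ l < B, s'.mem (l * 32 + B + 1) = f l) ∧
        (∀ p, B ≤ p → (∀ l < B, p ≠ l * 32 + B + 1) → s'.mem p = 0) := by
  intro j
  induction j with
  | zero =>
    intro i s hij h1 h3 h7 h11 hev hlo hcp hz
    obtain rfl : i = B := by omega
    exact ⟨s, .loopFalse (by simp [Test.Holds, h1, h7]), h1, h3, hev, hcp, hz⟩
  | succ j ih =>
    intro i s hij h1 h3 h7 h11 hev hlo hcp hz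
    have m1 : (i * 32) % 2 ^ w = i * 32 := Nat.mod_eq_of_lt (by omega)
    have m2 : (i * 32 + B) % 2 ^ w = i * 32 + B := Nat.mod_eq_of_lt (by omega)
    have m3 : (i * 32 + B + 1) % 2 ^ w = i * 32 + B + 1 := Nat.mod_eq_of_lt (by omega)
    have m4 : (i + 1) % 2 ^ w = i + 1 := Nat.mod_eq_of_lt (by omega)
    have key : ∃ s1, Exec w (.instr (.load 9 7) ⨾ .instr (.mul 13 7 3) ⨾ .instr (.add 13 13 1) ⨾
        .instr (.add 13 13 11) ⨾ .instr (.store 13 9) ⨾ .instr (.add 7 7 11)) s 6 s1 ∧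
        s1.reg 1 = B ∧ s1.reg 3 = 32 ∧ s1.reg 7 = i + 1 ∧ s1.reg 11 = 1 ∧
        (∀ y, s1.reg (2 * y) = 0) ∧ s1.mem = Function.update s.mem (i * 32 + B + 1) (f i) := by
      refine ⟨_, .seq (exec_instr rfl) (.seq (exec_instr rfl) (.seq (exec_instr rfl)
        (.seq (exec_instr rfl) (.seq (exec_instr rfl) (exec_instr rfl))))), ?_⟩
      simp only [Instr.run, State.setReg, Function.update_apply, h1, h3, h7, h11]
      simp [m1, m2, m3, m4, hlo i (by omega), Nat.mod_eq_of_lt (hf i)]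
      intro y
      simp [show 2 * y ≠ 13 by omega, show 2 * y ≠ 9 by omega, hev]
      omega
    obtain ⟨s1, x1, a1, a3, a7, a11, aev, am⟩ := key
    obtain ⟨s2, x2, r⟩ := ih (i + 1) s1 (by omega) a1 a3 a7 a11 aev
      (fun l hl => by rw [am, Function.update_of_ne (by omega), hlo l hl])
      (fun l hl => by
        rw [am, Function.update_apply]
        split_ifs with h
        · rw [show l = i by omega]
        · exact hcp l (by omega))
      (fun p hp hpl => by
        rw [am, Function.update_of_ne (hpl i (by omega))]
        exact hz p hp fun l hl => hpl l (by omega))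
    refine ⟨s2, ?_, r⟩
    have := Exec.loopTrue (w := w) (b := .lt 7 1) (by simp only [Test.Holds]; omega) x1 x2
    rwa [show 7 * (j + 1) + 1 = 1 + 6 + (7 * j + 1) by ring]

theorem exists_rel_init {w : ℕ} {x : List ℕ} (hx : ∀ i, x.getD i 0 < 2 ^ w)
    (hw : cells x * 32 + cells x + 33 < 2 ^ w) (hlen : x.length ≤ cells x) :
    ∃ s, Exec w (prelude ⨾ copyInput) (initState x) (11 + (7 * cells x + 1)) s ∧
      Rel (cells x) (St.init x) s := by
  obtain ⟨s1, x1, m1, h1, h3, h7, h11, hev⟩ := prelude_exec (x := x) (w := w) (by omega) (by omega)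
  obtain ⟨s2, x2, g1, g3, gev, gc, gz⟩ := copyInput_exec (f := fun i => x.getD i 0) hx
    (by omega) (cells x) 0 s1 (by omega) h1 h3 h7 h11 hev (fun l _ => by rw [m1])
    (fun l hl => by omega) (fun p hp _ => by
      rw [m1]
      exact List.getD_eq_default _ _ (by omega))
  refine ⟨s2, .seq x1 x2, gev, g1, g3, fun a ha i => ?_⟩
  simp only [St.init]
  split_ifs with h
  · subst h
    by_cases hi : i < cells x
    · exact gc i hi
    · rw [List.getD_eq_default _ _ (by omega)]
      exact gz _ (by omega) fun l hl => by omega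
  · exact gz _ (by omega) fun l hl => by omega

/-- Upper bounds for commands are upper bounds for the word RAM, up to constant factors. -/
theorem outputsWithin_of_big (c : Cmd) (hok : c.ok = true) (C e : ℕ) :
    ∃ (p : Program) (k κ : ℕ), ∀ (x : List ℕ) (t : ℕ) (σ : St), 2 ≤ x.length →
      (∀ i, x.getD i 0 ≤ x.length) → x.length ≤ cells x → cells x ≤ x.length + 1 →
      Big c (St.init x) t σ → t ≤ C * x.length ^ e → ∀ T : ℝ, (κ * (t + x.length : ℕ) : ℝ) ≤ T →
      OutputsWithin p k x (σ.v 0) T := by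
  set Z := c.size + 2 with hZ
  set M := 300 + Z * C + e + 1 with hM
  refine ⟨(prelude ⨾ copyInput) ⨾ compile c, M * Z + 1, c.cost + 26, ?_⟩
  intro x t σ h2 hx hlen hcells hbig ht T hT w hw
  set N := x.length with hN
  -- `W` dominates every value that occurs: the addresses used in copying, at most `33 (N + 1) +
  -- 33`, and the initial bound `N` plus the growth `Z * t`. As `W + 2 ≤ N ^ M`, the exponent `M * Z
  -- + 1` is enough for the word length.
  set W := 200 * N + Z * (C * N ^ e) with hW
  have hWM : W + 2 ≤ N ^ M := by
    have e1 : 300 + Z * C ≤ N ^ (300 + Z * C) :=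
      (Nat.lt_two_pow_self).le.trans (Nat.pow_le_pow_left h2 _)
    have e2 : N ≤ N ^ (e + 1) := Nat.le_self_pow (by omega) N
    have e3 : N ^ e ≤ N ^ (e + 1) := Nat.pow_le_pow_right (by omega) (by omega)
    calc W + 2 ≤ 300 * N ^ (e + 1) + Z * (C * N ^ (e + 1)) := by
          rw [hW]
          have := Nat.mul_le_mul_left Z (Nat.mul_le_mul_left C e3)
          omega
      _ = (300 + Z * C) * N ^ (e + 1) := by ring
      _ ≤ N ^ (300 + Z * C) * N ^ (e + 1) := Nat.mul_le_mul_right _ e1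
      _ = N ^ M := by rw [← pow_add, hM, add_assoc, add_assoc, add_assoc]
  have hWw : (W + 2) ^ Z < 2 ^ w := by
    calc (W + 2) ^ Z ≤ (N ^ M) ^ Z := Nat.pow_le_pow_left hWM Z
      _ = N ^ (M * Z) := (pow_mul _ _ _).symm
      _ < N ^ (M * Z + 1) := Nat.pow_lt_pow_right (by omega) (by omega)
      _ ≤ 2 ^ w := hw
  have hW1 : W + 2 < 2 ^ w := (Nat.le_self_pow (by omega) _).trans_lt hWw
  obtain ⟨s1, x1, R1⟩ := exists_rel_init (w := w) (x := x) (fun i => (hx i).trans_lt (by omega))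
    (by omega) hlen
  have hZt : Z * t ≤ Z * (C * N ^ e) := Nat.mul_le_mul_left _ ht
  obtain ⟨t2, s2, x2, R2, T2⟩ := compile_exec (w := w) (B := cells x) (W := W) (Z := Z) (by omega)
    (by omega) hbig (b := N) (κ := c.cost) hok (by omega) le_rfl hWw
    ⟨fun y => Nat.zero_le _, fun a i => by
      simp only [St.init]
      split_ifs
      exacts [hx i, Nat.zero_le _]⟩ (by omega) R1
  refine ⟨_, _, .seq x1 x2, R2.reg 0, le_trans ?_ hT⟩
  have : 11 + (7 * cells x + 1) + t2 ≤ (c.cost + 26) * (t + N) := by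
    nlinarith
  exact_mod_cast this

/-! ### Total correctness with running times -/

/-- The command `c`, started in `σ`, halts after `t` steps in a state `σ'` with `Q t σ'`. -/
def WP (c : Cmd) (σ : St) (Q : ℕ → St → Prop) : Prop :=
  ∃ t σ', Big c σ t σ' ∧ Q t σ'

/-- The variables that a command may change. -/
def Cmd.vars : Cmd → List ℕ
  | .skip => []
  | .set x _ => [x]
  | .cmin x _ => [x]
  | .store _ _ _ => []
  | .seq c d => c.vars ++ d.vars
  | .ite _ c d => c.vars ++ d.vars
  | .loop _ c => c.vars

/-- The arrays that a command may change. -/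
def Cmd.arrs : Cmd → List ℕ
  | .skip => []
  | .set _ _ => []
  | .cmin _ _ => []
  | .store a _ _ => [a]
  | .seq c d => c.arrs ++ d.arrs
  | .ite _ c d => c.arrs ++ d.arrs
  | .loop _ c => c.arrs

/-- `σ` and `σ'` differ only in what `c` may change. -/
structure Frame (c : Cmd) (σ σ' : St) : Prop where
  v : ∀ x, x ∉ c.vars → σ'.v x = σ.v x
  a : ∀ a, a ∉ c.arrs → σ'.a a = σ.a a

theorem Frame.refl (c : Cmd) (σ : St) : Frame c σ σ := ⟨fun _ _ => rfl, fun _ _ => rfl⟩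

theorem Frame.trans {c : Cmd} {σ σ' σ'' : St} (h : Frame c σ σ') (h' : Frame c σ' σ'') :
    Frame c σ σ'' :=
  ⟨fun x hx => (h'.v x hx).trans (h.v x hx), fun a ha => (h'.a a ha).trans (h.a a ha)⟩

theorem Frame.mono {c d : Cmd} {σ σ' : St} (h : Frame c σ σ') (hv : ∀ x ∈ c.vars, x ∈ d.vars)
    (ha : ∀ a ∈ c.arrs, a ∈ d.arrs) : Frame d σ σ' :=
  ⟨fun x hx => h.v x fun hx' => hx (hv x hx'), fun a hx => h.a a fun hx' => hx (ha a hx')⟩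

theorem Big.frame {c : Cmd} {σ σ' : St} {t : ℕ} (h : Big c σ t σ') : Frame c σ σ' := by
  induction h with
  | skip σ => exact .refl _ _
  | set x e σ | cmin x e σ =>
    exact ⟨fun y hy => Function.update_of_ne (by simpa [Cmd.vars] using hy) _ _, fun _ _ => rfl⟩
  | store a i e σ =>
    exact ⟨fun _ _ => rfl, fun y hy => Function.update_of_ne (by simpa [Cmd.arrs] using hy) _ _⟩
  | seq _ _ h1 h2 =>
    exact (h1.mono (fun x hx => List.mem_append_left _ hx)
      (fun x hx => List.mem_append_left _ hx)).trans
      (h2.mono (fun x hx => List.mem_append_right _ hx) (fun x hx => List.mem_append_right _ hx))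
  | iteTrue _ _ h =>
    exact h.mono (fun x hx => List.mem_append_left _ hx) (fun x hx => List.mem_append_left _ hx)
  | iteFalse _ _ h =>
    exact h.mono (fun x hx => List.mem_append_right _ hx) (fun x hx => List.mem_append_right _ hx)
  | whileTrue _ _ _ h1 h2 => exact (h1.mono (d := .loop _ _) (fun _ h => h) (fun _ h => h)).trans h2
  | whileFalse _ => exact .refl _ _

/-- The frame condition is handed to the continuation, so postconditions need to mention only what a
command changes. -/
theorem WP.mono {c : Cmd} {σ : St} {Q R : ℕ → St → Prop} (h : WP c σ Q)
    (hQR : ∀ t σ', Frame c σ σ' → Q t σ' → R t σ') : WP c σ R := by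
  obtain ⟨t, σ', hb, hQ⟩ := h
  exact ⟨t, σ', hb, hQR t σ' hb.frame hQ⟩

theorem WP.skip {σ : St} {Q : ℕ → St → Prop} (h : Q 1 σ) : WP .skip σ Q := ⟨_, _, .skip σ, h⟩

theorem WP.set {x : ℕ} {e : Expr} {σ : St} {Q : ℕ → St → Prop}
    (h : Q 1 (σ.setV x (e.eval σ))) : WP (.set x e) σ Q := ⟨_, _, .set x e σ, h⟩

theorem WP.cmin {x : ℕ} {e : Expr} {σ : St} {Q : ℕ → St → Prop}
    (h : Q 1 (σ.setV x (min (σ.v x) (e.eval σ)))) : WP (.cmin x e) σ Q := ⟨_, _, .cmin x e σ, h⟩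

theorem WP.store {a : ℕ} {i e : Expr} {σ : St} {Q : ℕ → St → Prop}
    (h : Q 1 (σ.setA a (i.eval σ) (e.eval σ))) : WP (.store a i e) σ Q := ⟨_, _, .store a i e σ, h⟩

theorem WP.seq {c d : Cmd} {σ : St} {Q : ℕ → St → Prop}
    (h : WP c σ fun t σ' => WP d σ' fun t' σ'' => Q (t + t') σ'') : WP (.seq c d) σ Q := by
  obtain ⟨t, σ', h1, t', σ'', h2, hQ⟩ := h
  exact ⟨_, _, .seq h1 h2, hQ⟩

theorem WP.seq' {c d : Cmd} {σ : St} {Q R : ℕ → St → Prop} (hc : WP c σ R)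
    (h : ∀ t σ', Frame c σ σ' → R t σ' → WP d σ' fun t' σ'' => Q (t + t') σ'') :
    WP (.seq c d) σ Q := .seq (hc.mono h)

theorem WP.ite {b : Cond} {c d : Cmd} {σ : St} {Q : ℕ → St → Prop}
    (h1 : b.Holds σ → WP c σ fun t σ' => Q (1 + t) σ')
    (h2 : ¬ b.Holds σ → WP d σ fun t σ' => Q (1 + t) σ') : WP (.ite b c d) σ Q := by
  by_cases hb : b.Holds σ
  · obtain ⟨t, σ', h, hQ⟩ := h1 hb
    exact ⟨_, _, .iteTrue hb h, hQ⟩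
  · obtain ⟨t, σ', h, hQ⟩ := h2 hb
    exact ⟨_, _, .iteFalse hb h, hQ⟩

/-- Loops: `I t σ` is an invariant, `t` being the time that has passed, and `μ` a variant. -/
theorem WP.loop {b : Cond} {c : Cmd} (I : ℕ → St → Prop) (μ : St → ℕ)
    {σ : St} (h0 : I 0 σ)
    (hstep : ∀ t σ', Frame c σ σ' → I t σ' → b.Holds σ' →
      WP c σ' fun t' σ'' => I (t + 1 + t') σ'' ∧ μ σ'' < μ σ') :
    WP (.loop b c) σ fun t σ' => ∃ s, t = s + 1 ∧ I s σ' ∧ ¬ b.Holds σ' := by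
  have key : ∀ (m t : ℕ) (σ' : St), μ σ' ≤ m → Frame c σ σ' → I t σ' →
      WP (.loop b c) σ' fun t' σ'' => ∃ s, t + t' = s + 1 ∧ I s σ'' ∧ ¬ b.Holds σ'' := by
    intro m
    induction m with
    | zero =>
      intro t σ' hm hF hI
      by_cases hb : b.Holds σ'
      · obtain ⟨t', σ'', _, _, h⟩ := hstep t σ' hF hI hb
        omega
      · exact ⟨1, σ', .whileFalse hb, t, rfl, hI, hb⟩
    | succ m ih =>
      intro t σ' hm hF hI
      by_cases hb : b.Holds σ'
      · obtain ⟨t', σ'', h1, h2, h3⟩ := hstep t σ' hF hI hb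
        obtain ⟨t2, σ2, h4, s, h5, h6⟩ := ih (t + 1 + t') σ'' (by omega) (hF.trans h1.frame) h2
        exact ⟨_, _, .whileTrue hb h1 h4, s, by omega, h6⟩
      · exact ⟨1, σ', .whileFalse hb, t, rfl, hI, hb⟩
  simpa using key (μ σ) 0 σ le_rfl (.refl _ _) h0

/-- `for x := lo, …, hi - 1 do c`. -/
def Cmd.for (x : ℕ) (lo hi : Expr) (c : Cmd) : Cmd :=
  .seq (.set x lo) (.loop (.lt (.var x) hi) (.seq c (.set x (.add (.var x) (.const 1)))))

/-- Counting loops; `I k t σ` is an invariant, `t` being the time that has passed. -/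
theorem WP.forT {x : ℕ} {lo hi : Expr} {c : Cmd} (I : ℕ → ℕ → St → Prop) (l n : ℕ)
    {σ : St} (hl : lo.eval σ = l) (hln : l ≤ n) (hx : x ∉ c.vars)
    (hhi : ∀ σ', Frame (.for x lo hi c) σ σ' → hi.eval σ' = n)
    (h0 : I l 0 (σ.setV x l))
    (hstep : ∀ k t σ', l ≤ k → k < n → Frame (.for x lo hi c) σ σ' → σ'.v x = k → I k t σ' →
      WP c σ' fun t' σ'' => I (k + 1) (t + (t' + 2)) (σ''.setV x (k + 1))) :
    WP (.for x lo hi c) σ fun t σ' => ∃ s, t = s + 2 ∧ I n s σ' := by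
  have hF0 : Frame (.for x lo hi c) σ (σ.setV x l) :=
    (hl ▸ (Big.set x lo σ).frame).mono (by simp [Cmd.vars, Cmd.for]) (by simp [Cmd.arrs])
  have hFl : ∀ {σ' : St}, Frame (.loop (.lt (.var x) hi) (.seq c (.set x (.add (.var x) (.const 1)))))
      (σ.setV x l) σ' → Frame (.for x lo hi c) σ σ' := fun h =>
    hF0.trans (h.mono (by simp +contextual [Cmd.vars, Cmd.for]) (by simp [Cmd.arrs, Cmd.for]))
  refine .seq (.set ?_)
  rw [hl]
  refine (WP.loop (fun t σ' => ∃ k, l ≤ k ∧ k ≤ n ∧ σ'.v x = k ∧ I k t σ')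
    (fun σ' => n - σ'.v x) ⟨l, le_rfl, hln, by simp [St.setV], h0⟩ ?_).mono ?_
  · rintro t σ' hF ⟨k, hlk, hkn, hxk, hI⟩ hb
    replace hF := hFl ⟨hF.v, hF.a⟩
    simp only [Cond.Holds, Expr.eval, hxk, hhi _ hF] at hb
    refine .seq ((hstep k t σ' hlk hb hF hxk hI).mono ?_)
    rintro t' σ'' hF' hI'
    have hx' : σ''.v x = k := (hF'.v x hx).trans hxk
    refine .set ⟨⟨k + 1, by omega, hb, ?_, ?_⟩, ?_⟩
    · simp [St.setV, Expr.eval, hx']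
    · rw [show t + 1 + (t' + 1) = t + (t' + 2) by omega]
      simpa [Expr.eval, hx'] using hI'
    · simp only [St.setV, Expr.eval, hx', Function.update_self]
      omega
  · rintro t σ' hF ⟨s, hs, ⟨k, hlk, hkn, hxk, hI⟩, hb⟩
    simp only [Cond.Holds, Expr.eval, hxk, hhi _ (hFl hF)] at hb
    obtain rfl : k = n := by omega
    exact ⟨s, by omega, hI⟩

/-- Each round pays `2` for the test and the increment; the final `2` covers the initialisation and
the failing test. -/
theorem WP.for {x : ℕ} {lo hi : Expr} {c : Cmd} (I : ℕ → St → Prop) (cost : ℕ → ℕ) (l n : ℕ)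
    {σ : St} (hl : lo.eval σ = l) (hln : l ≤ n) (hx : x ∉ c.vars)
    (hhi : ∀ σ', Frame (.for x lo hi c) σ σ' → hi.eval σ' = n)
    (h0 : I l (σ.setV x l))
    (hstep : ∀ k σ', l ≤ k → k < n → Frame (.for x lo hi c) σ σ' → σ'.v x = k → I k σ' →
      WP c σ' fun t σ'' => t ≤ cost k ∧ I (k + 1) (σ''.setV x (k + 1))) :
    WP (.for x lo hi c) σ fun t σ' =>
      t ≤ ∑ k ∈ Finset.Ico l n, (cost k + 2) + 2 ∧ I n σ' := by
  refine (WP.forT (fun k t σ' => l ≤ k ∧ t ≤ ∑ j ∈ Finset.Ico l k, (cost j + 2) ∧ I k σ') l n hl hln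
    hx hhi ⟨le_rfl, by simp, h0⟩ ?_).mono ?_
  · rintro k t σ' hlk hkn hF hxk ⟨-, ht, hI⟩
    refine (hstep k σ' hlk hkn hF hxk hI).mono ?_
    rintro t' σ'' - ⟨ht', hI'⟩
    refine ⟨by omega, ?_, hI'⟩
    rw [Finset.sum_Ico_succ_top hlk]
    omega
  · rintro t σ' - ⟨s, rfl, -, hs, hI⟩
    exact ⟨by omega, hI⟩

end Imp

namespace Imp

open Imp.Expr

@[simp] theorem St.setV_v (σ : St) (x k y : ℕ) :
    (σ.setV x k).v y = if y = x then k else σ.v y := Function.update_apply ..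

@[simp] theorem St.setV_a (σ : St) (x k : ℕ) : (σ.setV x k).a = σ.a := rfl

@[simp] theorem St.setA_v (σ : St) (a i k : ℕ) : (σ.setA a i k).v = σ.v := rfl

@[simp] theorem St.setA_a (σ : St) (a i k b : ℕ) :
    (σ.setA a i k).a b = if b = a then Function.update (σ.a a) i k else σ.a b :=
  Function.update_apply ..

attribute [simp] Expr.eval Cond.Holds

/-! ### Reading adjacency lists -/

theorem listOffset_succ {n : ℕ} (L : Fin n → List (Fin n)) (v : Fin n) :
    listOffset L (v + 1) = listOffset L v + (L v).length := by
  have h : ∀ u : Fin n, (if (u : ℕ) < v + 1 then (L u).length else 0) =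
      (if (u : ℕ) < v then (L u).length else 0) + if u = v then (L u).length else 0 := fun u => by
    rcases lt_trichotomy (u : ℕ) v with h | h | h
    · rw [if_pos (by omega), if_pos h, if_neg (by rintro rfl; omega)]; rfl
    · rw [if_pos (by omega), if_neg (by omega), if_pos (Fin.ext h), zero_add]
    · rw [if_neg (by omega), if_neg (by omega), if_neg (by rintro rfl; omega)]
  simp only [listOffset, h, Finset.sum_add_distrib, Finset.sum_ite_eq', Finset.mem_univ, if_true]

theorem listOffset_zero {n : ℕ} (L : Fin n → List (Fin n)) : listOffset L 0 = 0 := by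
  simp [listOffset]

theorem listOffset_eq_sum {n : ℕ} (L : Fin n → List (Fin n)) :
    listOffset L n = ∑ v, (L v).length :=
  Finset.sum_congr rfl fun u _ => by simp [u.2]

theorem length_flatMap_take {n : ℕ} (L : Fin n → List (Fin n)) {v : ℕ} (hv : v ≤ n) :
    (((List.finRange n).take v).flatMap fun v => (L v).map Fin.val).length = listOffset L v := by
  induction v with
  | zero => simp [listOffset_zero]
  | succ v ih =>
    rw [List.take_succ_eq_append_getElem (by simpa using hv), List.flatMap_append,
      List.length_append, ih (by omega)]
    simpa using (listOffset_succ L ⟨v, hv⟩).symm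

theorem length_encodeGraph {n : ℕ} (L : Fin n → List (Fin n)) :
    (encodeGraph L).length = n + 2 + listOffset L n := by
  have := length_flatMap_take L le_rfl
  rw [List.take_of_length_le (by simp)] at this
  simp only [encodeGraph, List.length_cons, List.length_append, List.length_map, List.length_range,
    this]
  omega

theorem encodeGraph_getD_zero {n : ℕ} (L : Fin n → List (Fin n)) (r : List ℕ) :
    (encodeGraph L ++ r).getD 0 0 = n := rfl

theorem encodeGraph_getD_offset {n : ℕ} (L : Fin n → List (Fin n)) (r : List ℕ) {v : ℕ}
    (hv : v ≤ n) : (encodeGraph L ++ r).getD (v + 1) 0 = listOffset L v := by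
  have h : v < ((List.range (n + 1)).map (listOffset L)).length := by simp; omega
  simp only [encodeGraph, List.cons_append, List.getD_cons_succ, List.append_assoc]
  rw [List.getD_append _ _ _ _ h, List.getD_eq_getElem _ _ h]
  simp

theorem encodeGraph_getD_nbr {n : ℕ} (L : Fin n → List (Fin n)) (r : List ℕ) (v : Fin n) {j : ℕ}
    (hj : j < (L v).length) :
    (encodeGraph L ++ r).getD (n + 2 + (listOffset L v + j)) 0 = ((L v)[j] : ℕ) := by
  have h1 : (List.finRange n).flatMap (fun v => (L v).map Fin.val) =
      ((List.finRange n).take v).flatMap (fun v => (L v).map Fin.val) ++ ((L v).map Fin.val ++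
        ((List.finRange n).drop (v + 1)).flatMap (fun v => (L v).map Fin.val)) := by
    conv_lhs => rw [← List.take_append_drop (v + 1) (List.finRange n)]
    rw [List.take_succ_eq_append_getElem (by simp), List.flatMap_append,
      List.flatMap_append, List.append_assoc]
    simp
  rw [show n + 2 + (listOffset L v + j) = (n + 1 + (listOffset L v + j)) + 1 by omega]
  simp only [encodeGraph, List.cons_append, List.getD_cons_succ, List.append_assoc, h1]
  rw [List.getD_append_right _ _ _ _ (by simp)]
  rw [List.getD_append_right _ _ _ _ (by rw [length_flatMap_take L v.2.le]; simp)]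
  rw [length_flatMap_take L v.2.le]
  simp only [List.length_map, List.length_range]
  rw [show n + 1 + (listOffset L v + j) - (n + 1) - listOffset L v = j by omega]
  rw [List.getD_append _ _ _ _ (by simpa using hj), List.getD_eq_getElem _ _ (by simpa using hj)]
  simp

-- Variables and arrays are plain numerals, so that `decide` can settle which of them a command may
-- change.
notation "vAns" => (0 : ℕ)
notation "vN" => (1 : ℕ)
notation "vHead" => (2 : ℕ)
notation "vTail" => (3 : ℕ)
notation "vU" => (4 : ℕ)
notation "vI" => (5 : ℕ)
notation "vW" => (6 : ℕ)
notation "vV" => (7 : ℕ)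

notation "aIn" => (1 : ℕ)
notation "aD" => (2 : ℕ)
notation "aQ" => (3 : ℕ)
notation "aSrc" => (4 : ℕ)
notation "aZero" => (5 : ℕ)
notation "aFlag" => (6 : ℕ)

/-- Sequential composition of commands. -/
infixr:60 " ;; " => Cmd.seq

/-- `x := x + 1`. -/
abbrev Cmd.inc (x : ℕ) : Cmd := .set x (add (var x) (const 1))

/-- Conditionals without alternative. -/
abbrev Cmd.when (b : Cond) (c : Cmd) : Cmd := .ite b c .skip

/-- The array `1` contains adjacency lists and the variable `1` the number of vertices. -/
structure Input {n : ℕ} (L : Fin n → List (Fin n)) (σ : St) : Prop where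
  size : σ.v vN = n
  off : ∀ v ≤ n, σ.a aIn (v + 1) = listOffset L v
  nbr : ∀ (v : Fin n) (j : ℕ) (hj : j < (L v).length),
    σ.a aIn (n + 2 + (listOffset L v + j)) = ((L v)[j] : ℕ)

theorem Input.of_eq {n : ℕ} {L : Fin n → List (Fin n)} {σ σ' : St} (h : Input L σ)
    (hv : σ'.v vN = σ.v vN) (ha : σ'.a aIn = σ.a aIn) : Input L σ' :=
  ⟨hv.trans h.size, fun v hv => by rw [ha, h.off v hv], fun v j hj => by rw [ha, h.nbr v j hj]⟩

/-- `for w ∈ L u do c`, with index variable `i`. -/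
def Cmd.forNbr (i w u : ℕ) (c : Cmd) : Cmd :=
  .for i (arr aIn (add (var u) (const 1))) (arr aIn (add (var u) (const 2)))
    (.set w (arr aIn (add (add (var vN) (const 2)) (var i))) ;; c)

/-- The counter runs through absolute positions in the input, whereas the invariant speaks of the
number of neighbours already visited. It is therefore required for every value of the counter. -/
theorem WP.forNbr {n : ℕ} {L : Fin n → List (Fin n)} {i w u : ℕ} {c : Cmd} (I : ℕ → St → Prop)
    (cost : ℕ) {σ : St} (hin : Input L σ) (x : Fin n) (hx : σ.v u = x)
    (hvars : i ≠ w ∧ i ≠ u ∧ w ≠ u ∧ i ≠ vN ∧ w ≠ vN ∧ i ∉ c.vars ∧ u ∉ c.vars ∧ vN ∉ c.vars ∧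
      aIn ∉ c.arrs)
    (h0 : ∀ m, I 0 (σ.setV i m))
    (hstep : ∀ k (hk : k < (L x).length) σ', Frame (.forNbr i w u c) σ σ' → I k σ' →
      WP c (σ'.setV w ((L x)[k] : ℕ)) fun t σ'' => t ≤ cost ∧ ∀ m, I (k + 1) (σ''.setV i m)) :
    WP (.forNbr i w u c) σ fun t σ' => t ≤ (L x).length * (cost + 3) + 2 ∧ I (L x).length σ' := by
  obtain ⟨h1, h2, h3, h4, h5, h6, h7, h8, h9⟩ := hvars
  have hN : ∀ σ', Frame (.forNbr i w u c) σ σ' → σ'.v vN = n := fun σ' hF =>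
    (hF.v _ (by simp [Cmd.forNbr, Cmd.for, Cmd.vars, h4.symm, h5.symm, h8])).trans hin.size
  have hA : ∀ σ', Frame (.forNbr i w u c) σ σ' → σ'.a aIn = σ.a aIn := fun σ' hF =>
    hF.a _ (by simp [Cmd.forNbr, Cmd.for, Cmd.arrs, h9])
  have hU : ∀ σ', Frame (.forNbr i w u c) σ σ' → σ'.v u = x := fun σ' hF =>
    (hF.v _ (by simp [Cmd.forNbr, Cmd.for, Cmd.vars, h2.symm, h3.symm, h7])).trans hx
  refine (WP.for (fun k σ' => I (k - listOffset L x) σ') (fun _ => cost + 1) (listOffset L x)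
    (listOffset L (x + 1)) ?_ ?_ ?_ ?_ ?_ ?_).mono ?_
  · simp only [Expr.eval, hx]
    exact hin.off _ x.2.le
  · rw [listOffset_succ]; omega
  · simp [Cmd.vars, h1, h6]
  · intro σ' hF
    simp only [Expr.eval, hU σ' hF, hA σ' hF]
    exact hin.off (x + 1) x.2
  · simpa using h0 _
  · intro k σ' hlk hkn hF hik hI
    rw [listOffset_succ] at hkn
    have hk : k - listOffset L x < (L x).length := by omega
    refine .seq (.set ?_)
    have hv : (arr aIn (add (add (var vN) (const 2)) (var i))).eval σ' =
        ((L x)[k - listOffset L x] : ℕ) := by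
      simp only [Expr.eval, hN σ' hF, hA σ' hF, hik, ← hin.nbr x _ hk]
      congr 1
      omega
    rw [hv]
    refine (hstep _ hk σ' hF hI).mono fun t σ'' _ ⟨ht, hI'⟩ => ⟨by omega, ?_⟩
    rw [show k + 1 - listOffset L x = k - listOffset L x + 1 by omega]
    exact hI' _
  · rintro t σ' - ⟨ht, hI⟩
    rw [listOffset_succ, Nat.add_sub_cancel_left] at hI
    refine ⟨ht.trans ?_, hI⟩
    simp [listOffset_succ]

end Imp

/-! ### Breadth-first search -/

/-- `D - 1` is the distance in `H` from the set `S`, where `D v = 0` for the vertices `v` that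
cannot be reached from `S`. -/
structure IsLevel {V : Type*} (H : SimpleGraph V) (S : Set V) (D : V → ℕ) : Prop where
  src : ∀ v, D v = 1 ↔ v ∈ S
  pred : ∀ v, 2 ≤ D v → ∃ u, H.Adj u v ∧ D v = D u + 1
  closed : ∀ u w, H.Adj u w → D u ≠ 0 → D w ≠ 0 ∧ D w ≤ D u + 1

/-- The state of a breadth-first search with the queue `done ++ todo`. -/
structure BfsInv {V : Type*} (H : SimpleGraph V) (S : Set V) (D : V → ℕ) (m : ℕ)
    (done todo : List V) : Prop where
  nodup : (done ++ todo).Nodup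
  mem : ∀ v, v ∈ done ++ todo ↔ D v ≠ 0
  sorted : todo.Pairwise fun u v => D u ≤ D v
  upper : ∀ v, D v ≤ m + 1
  lower : ∀ v ∈ todo, m ≤ D v
  src : ∀ v, D v = 1 ↔ v ∈ S
  pred : ∀ v, 2 ≤ D v → ∃ u, H.Adj u v ∧ D v = D u + 1

namespace BfsInv

variable {V : Type*} {H : SimpleGraph V} {S : Set V} {D : V → ℕ} {m : ℕ} {done todo : List V}

/-- The queue is sorted and holds levels `m` and `m + 1` only. Its head has the least level, which
can take over the role of `m`. -/
theorem pop {u : V} (h : BfsInv H S D m done (u :: todo)) :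
    BfsInv H S D (D u) (done ++ [u]) todo where
  nodup := by simpa using h.nodup
  mem := by simpa using h.mem
  sorted := (List.pairwise_cons.1 h.sorted).2
  upper v := (h.upper v).trans (Nat.succ_le_succ (h.lower u (by simp)))
  lower := (List.pairwise_cons.1 h.sorted).1
  src := h.src
  pred := h.pred

/-- The new level `m + 1` is the largest one present, so the queue stays sorted when `w` is
appended. -/
theorem push [DecidableEq V] {u w : V} (h : BfsInv H S D m done todo) (hu : D u = m) (hm : m ≠ 0)
    (huw : H.Adj u w) (hw : D w = 0) :
    BfsInv H S (Function.update D w (m + 1)) m done (todo ++ [w]) where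
  nodup := by
    rw [← List.append_assoc, List.nodup_append]
    refine ⟨h.nodup, by simp, ?_⟩
    rintro a ha b hb rfl
    rw [List.mem_singleton] at hb
    exact (h.mem a).1 ha (hb ▸ hw)
  mem v := by
    rw [← List.append_assoc, List.mem_append, h.mem, Function.update_apply]
    by_cases hv : v = w <;> simp [hv]
  sorted := by
    have hne : ∀ v ∈ todo, v ≠ w := by
      rintro v hv rfl
      exact (h.mem v).1 (List.mem_append_right _ hv) hw
    rw [List.pairwise_append]
    refine ⟨h.sorted.imp_of_mem fun {a b} ha hb hab => ?_, by simp, ?_⟩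
    · rwa [Function.update_of_ne (hne a ha), Function.update_of_ne (hne b hb)]
    · intro a ha b hb
      rw [List.mem_singleton.1 hb, Function.update_of_ne (hne a ha), Function.update_self]
      exact h.upper a
  upper v := by
    rw [Function.update_apply]
    split_ifs
    exacts [le_rfl, h.upper v]
  lower v hv := by
    rw [Function.update_apply]
    split_ifs with hvw
    · omega
    · exact h.lower v (by simpa [hvw] using hv)
  src v := by
    rw [Function.update_apply]
    split_ifs with hvw
    · have := (h.src v).2
      subst hvw
      exact ⟨fun h => by omega, fun h => by have := this h; omega⟩
    · exact h.src v
  pred v hv := by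
    have huw' : u ≠ w := by rintro rfl; omega
    have key : ∀ x, D x ≠ 0 → Function.update D w (m + 1) x = D x := fun x hx =>
      Function.update_of_ne (by rintro rfl; exact hx hw) _ _
    by_cases hvw : v = w
    · subst hvw
      exact ⟨u, huw, by rw [Function.update_self, key u (by omega), hu]⟩
    · rw [Function.update_of_ne hvw] at hv ⊢
      obtain ⟨x, hx, hxv⟩ := h.pred v hv
      by_cases hxw : x = w
      · subst hxw
        have h1 := (h.src v).1 (by omega)
        omega
      · exact ⟨x, hx, by rw [Function.update_of_ne hxw]; exact hxv⟩

end BfsInv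

namespace Imp

open Imp.Expr

/-- Fill the queue with the sources. -/
def bfsInit (mask : ℕ) : Cmd :=
  .for vV (const 0) (var vN) (.store aD (var vV) (arr mask (var vV))) ;;
  .set vTail (const 0) ;;
  .for vV (const 0) (var vN) (.when (.eq (arr aSrc (var vV)) (const 1))
    (.store aD (var vV) (const 1) ;; .store aQ (var vTail) (var vV) ;; .inc vTail))

/-- Visit the neighbours of `vU`. -/
def bfsScan : Cmd :=
  .forNbr vI vW vU (.when (.eq (arr aD (var vW)) (const 0))
    (.store aD (var vW) (add (arr aD (var vU)) (const 1)) ;; .store aQ (var vTail) (var vW) ;;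
      .inc vTail))

/-- Work off the queue. -/
def bfsMain : Cmd :=
  .set vHead (const 0) ;;
  .loop (.lt (var vHead) (var vTail))
    (.set vU (arr aQ (var vHead)) ;; .inc vHead ;; bfsScan)

/-- Breadth-first search from the vertices `v` with `src[v] = 1`, avoiding the vertices `v` with
`mask[v] = 1`. -/
def bfs (mask : ℕ) : Cmd :=
  bfsInit mask ;; bfsMain ;;
  .for vV (const 0) (var vN) (.when (.eq (arr mask (var vV)) (const 1))
    (.store aD (var vV) (const 0)))

/-- The array `a` is the characteristic function of `K`. -/
def IsFlag {n : ℕ} (a : ℕ) (K : Finset (Fin n)) (σ : St) : Prop :=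
  ∀ v : Fin n, σ.a a v = if v ∈ K then 1 else 0

theorem IsFlag.of_eq {n : ℕ} {a : ℕ} {K : Finset (Fin n)} {σ σ' : St} (h : IsFlag a K σ)
    (ha : σ'.a a = σ.a a) : IsFlag a K σ' := fun v => by rw [ha, h v]

/-- The graph `G - K`, on the same vertex set. -/
def delGraph {n : ℕ} (G : SimpleGraph (Fin n)) (K : Finset (Fin n)) : SimpleGraph (Fin n) where
  Adj u v := G.Adj u v ∧ u ∉ K ∧ v ∉ K
  symm := ⟨fun _ _ h => ⟨h.1.symm, h.2.2, h.2.1⟩⟩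
  loopless := ⟨fun _ h => G.irrefl h.1⟩

/-- The arrays represent the state of a breadth-first search in `G - K`. -/
structure BfsState {n : ℕ} (K : Finset (Fin n)) (D : Fin n → ℕ) (q : List (Fin n)) (σ : St) :
    Prop where
  dist : ∀ v ∉ K, σ.a aD v = D v
  mask : ∀ v ∈ K, σ.a aD v ≠ 0 ∧ D v = 0
  tail : σ.v vTail = q.length
  queue : ∀ (k : ℕ) (hk : k < q.length), σ.a aQ k = (q[k] : ℕ)

theorem BfsState.of_eq {n : ℕ} {K : Finset (Fin n)} {D : Fin n → ℕ} {q : List (Fin n)} {σ σ' : St}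
    (h : BfsState K D q σ) (h1 : σ'.v vTail = σ.v vTail) (h2 : σ'.a aD = σ.a aD)
    (h3 : σ'.a aQ = σ.a aQ) : BfsState K D q σ' :=
  ⟨fun v hv => by rw [h2, h.dist v hv], fun v hv => by rw [h2]; exact h.mask v hv,
    h1.trans h.tail, fun k hk => by rw [h3, h.queue k hk]⟩

theorem BfsState.push {n : ℕ} {K : Finset (Fin n)} {D : Fin n → ℕ} {q : List (Fin n)} {σ σ' : St}
    (h : BfsState K D q σ) {w : Fin n} (hw : w ∉ K) {d : ℕ}
    (h1 : σ'.v vTail = σ.v vTail + 1) (h2 : σ'.a aD = Function.update (σ.a aD) w d)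
    (h3 : σ'.a aQ = Function.update (σ.a aQ) (σ.v vTail) w) :
    BfsState K (Function.update D w d) (q ++ [w]) σ' where
  dist v hv := by
    rw [h2]
    by_cases hvw : v = w
    · subst hvw; simp
    · rw [Function.update_of_ne hvw, Function.update_of_ne (fun h => hvw (Fin.ext h)), h.dist v hv]
  mask v hv := by
    have hvw : v ≠ w := by rintro rfl; exact hw hv
    rw [h2, Function.update_of_ne hvw, Function.update_of_ne (fun h => hvw (Fin.ext h))]
    exact h.mask v hv
  tail := by rw [h1, h.tail]; simp
  queue k hk := by
    rw [h3, h.tail, Function.update_apply]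
    split_ifs with hkq
    · subst hkq; simp
    · rw [List.getElem_append_left (by simp at hk; omega), h.queue]

/-- Masked vertices receive a nonzero entry and so count as already visited; this keeps the search
inside `G - K`. The sources are disjoint from the mask and form the whole queue, at level `1`. -/
theorem WP.bfsInit {n : ℕ} {G : SimpleGraph (Fin n)} {L : Fin n → List (Fin n)}
    {K S : Finset (Fin n)} {mask : ℕ} {σ : St} (hin : Input L σ) (hK : IsFlag mask K σ)
    (hS : IsFlag aSrc S σ) (hSK : Disjoint S K) (hmask : mask ≠ aD ∧ mask ≠ aQ) :
    WP (bfsInit mask) σ fun t σ' => t ≤ 10 * n + 10 ∧ ∃ D q, BfsState K D q σ' ∧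
      BfsInv (delGraph G K) S D 1 [] q := by
  have hN : ∀ σ', Frame (Imp.bfsInit mask) σ σ' → σ'.v vN = n := fun σ' hF =>
    (hF.v _ (by simp [Imp.bfsInit, Cmd.for, Cmd.vars])).trans hin.size
  refine .seq' (WP.for (fun k σ' => ∀ v : Fin n, (v : ℕ) < k → σ'.a aD v = if v ∈ K then 1 else 0)
    (fun _ => 1) 0 n rfl (Nat.zero_le n) (by simp [Cmd.vars]) ?_ ?_ ?_) ?_
  · intro σ' hF
    exact (hF.v _ (by simp [Cmd.for, Cmd.vars])).trans hin.size
  · intro v hv; omega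
  · intro k σ' _ hk hF hv hI
    refine .store ⟨le_rfl, fun v hvk => ?_⟩
    simp only [Expr.eval, hv, St.setV_a, St.setA_a, if_true, Function.update_apply]
    split_ifs with h1 h2 h2
    · rw [hF.a _ (by simpa [Cmd.for, Cmd.arrs] using hmask.1), ← h1, hK v, if_pos h2]
    · rw [hF.a _ (by simpa [Cmd.for, Cmd.arrs] using hmask.1), ← h1, hK v, if_neg h2]
    · rw [hI v (by omega), if_pos h2]
    · rw [hI v (by omega), if_neg h2]
  rintro t1 σ1 hF1 ⟨ht1, hD1⟩
  refine .seq (.set ?_)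
  have hS1 : σ1.a aSrc = σ.a aSrc := hF1.a _ (by simp [Cmd.for, Cmd.arrs])
  have hN1 : σ1.v vN = n := (hF1.v _ (by simp [Cmd.for, Cmd.vars])).trans hin.size
  refine (WP.for (fun k σ' => ∃ q : List (Fin n), q.Nodup ∧
    (∀ v, v ∈ q ↔ v ∈ S ∧ (v : ℕ) < k) ∧ BfsState K (fun v => if v ∈ q then 1 else 0) q σ')
    (fun _ => 4) 0 n rfl (Nat.zero_le n) (by simp [Cmd.vars]) ?_ ?_ ?_).mono ?_
  · intro σ' hF
    exact (hF.v _ (by simp [Cmd.for, Cmd.vars])).trans (by simpa using hN1)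
  · refine ⟨[], by simp, by simp, ?_, ?_, by simp, by simp⟩
    · intro v hv
      simp [hD1 v v.2, hv]
    · intro v hv
      simp [hD1 v v.2, hv]
  · rintro k σ' - hk hF hv ⟨q, hq, hmem, hst⟩
    have hsrc : σ'.a aSrc k = if (⟨k, hk⟩ : Fin n) ∈ S then 1 else 0 := by
      rw [hF.a _ (by simp [Cmd.for, Cmd.arrs]), St.setV_a, hS1]
      exact hS ⟨k, hk⟩
    refine .ite (fun hb => ?_) fun hb => ?_
    · simp only [Cond.Holds, Expr.eval, hv, hsrc] at hb
      have hkS : (⟨k, hk⟩ : Fin n) ∈ S := by by_contra h; simp [h] at hb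
      have hkq : (⟨k, hk⟩ : Fin n) ∉ q := fun h => by have := ((hmem _).1 h).2; simp at this
      refine .seq (.store (.seq (.store (.set ⟨by omega, q ++ [⟨k, hk⟩], ?_, ?_, ?_⟩))))
      · exact List.nodup_append.2 ⟨hq, by simp, by
          rintro a ha b hb rfl; rw [List.mem_singleton] at hb; exact hkq (hb ▸ ha)⟩
      · intro v
        rw [List.mem_append, hmem, List.mem_singleton]
        constructor
        · rintro (⟨h1, h2⟩ | rfl)
          · exact ⟨h1, by omega⟩
          · exact ⟨hkS, by simp⟩
        · rintro ⟨h1, h2⟩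
          by_cases h : (v : ℕ) = k
          · exact .inr (Fin.ext h)
          · exact .inl ⟨h1, by omega⟩
      · have := hst.push (σ' := ((((σ'.setA aD k 1).setA aQ (σ'.v vTail) k).setV vTail
          (σ'.v vTail + 1)).setV vV (k + 1))) (Finset.disjoint_left.1 hSK hkS) (d := 1)
          (by simp) (by simp) (by simp)
        simp only [Expr.eval, hv, St.setA_v]
        convert this using 1
        funext v
        simp only [List.mem_append, List.mem_singleton, Function.update_apply]
        by_cases h : v = ⟨k, hk⟩ <;> simp [h]
    · simp only [Cond.Holds, Expr.eval, hv, hsrc] at hb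
      have hkS : (⟨k, hk⟩ : Fin n) ∉ S := by by_contra h; simp [h] at hb
      refine .skip ⟨by omega, q, hq, fun v => ?_, hst.of_eq (by simp) (by simp) (by simp)⟩
      rw [hmem]
      refine and_congr_right fun hvS => ⟨fun h => by omega, fun h => ?_⟩
      have : (v : ℕ) ≠ k := by rintro rfl; exact hkS hvS
      omega
  · rintro t2 σ2 hF2 ⟨ht2, q, hq, hmem, hst⟩
    refine ⟨?_, _, q, hst, ?_⟩
    · simp at ht1 ht2
      omega
    · have hmem' : ∀ v, v ∈ q ↔ v ∈ S := fun v => by simp [hmem]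
      refine ⟨by simpa using hq, fun v => by simp, ?_, fun v => ?_, fun v hv => by simp [hv],
        fun v => by simp [hmem'], fun v hv => ?_⟩
      · exact List.pairwise_of_forall_mem_list fun u hu v hv => by simp [hu, hv]
      · split_ifs <;> omega
      · split_ifs at hv <;> omega

/-- While `u` is scanned, closedness holds for the other finished vertices, and for `u` with respect
to the part of its list read so far. A neighbour that was reached before has level at most `m + 1`
by the invariant on the queue. -/
theorem WP.bfsScan {n : ℕ} {G : SimpleGraph (Fin n)} {L : Fin n → List (Fin n)}
    (hL : IsAdjLists G L) {K : Finset (Fin n)} {S : Set (Fin n)} {D : Fin n → ℕ} {m : ℕ}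
    {done todo : List (Fin n)} {u : Fin n} {σ : St} (hin : Input L σ) (hu : σ.v vU = u)
    (hst : BfsState K D (done ++ todo) σ) (hinv : BfsInv (delGraph G K) S D m done todo)
    (hdone : u ∈ done) (hm : D u = m)
    (hcl : ∀ v ∈ done, v ≠ u → ∀ w, (delGraph G K).Adj v w → D w ≠ 0 ∧ D w ≤ D v + 1) :
    WP bfsScan σ fun t σ' => t ≤ 7 * (L u).length + 2 ∧ ∃ D' todo',
      BfsState K D' (done ++ todo') σ' ∧ BfsInv (delGraph G K) S D' m done todo' ∧
      ∀ v ∈ done, ∀ w, (delGraph G K).Adj v w → D' w ≠ 0 ∧ D' w ≤ D' v + 1 := by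
  have hm0 : m ≠ 0 := hm ▸ (hinv.mem u).1 (List.mem_append_left _ hdone)
  have huK : u ∉ K := fun h => hm0 (hm ▸ (hst.mask u h).2)
  refine (WP.forNbr (fun k σ' => ∃ D' todo', BfsState K D' (done ++ todo') σ' ∧
    BfsInv (delGraph G K) S D' m done todo' ∧ D' u = m ∧
    (∀ v ∈ done, ∀ w, (delGraph G K).Adj v w → (v = u → w ∈ (L u).take k) →
      D' w ≠ 0 ∧ D' w ≤ D' v + 1)) 4 hin u hu (by decide) ?_ ?_).mono ?_
  · intro i
    refine ⟨D, todo, hst.of_eq (by simp) (by simp) (by simp), hinv, hm, fun v hv w hvw h => ?_⟩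
    exact hcl v hv (fun h' => by simpa using h h') w hvw
  · rintro k hk σ' hF ⟨D', todo', hst', hinv', hm', hcl'⟩
    have huw : G.Adj u (L u)[k] := ((hL u).2 _).1 (List.getElem_mem hk)
    set w := (L u)[k] with hw
    have htake : ∀ x, x ∈ (L u).take (k + 1) ↔ x ∈ (L u).take k ∨ x = w := fun x => by
      rw [List.take_succ_eq_append_getElem hk, List.mem_append, List.mem_singleton]
    have hu' : σ'.v vU = u := (hF.v _ (by decide)).trans hu
    refine .ite (fun hb => ?_) fun hb => ?_
    · simp only [Cond.Holds, Expr.eval, St.setV_v, St.setV_a, if_true] at hb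
      have hwK : w ∉ K := fun h => (hst'.mask w h).1 hb
      have hw0 : D' w = 0 := (hst'.dist w hwK).symm.trans hb
      have hDu : σ'.a aD u = m := (hst'.dist u huK).trans hm'
      have hadj : (delGraph G K).Adj u w := ⟨huw, huK, hwK⟩
      have key : ∀ x, D' x ≠ 0 → Function.update D' w (m + 1) x = D' x := fun x hx =>
        Function.update_of_ne (by rintro rfl; exact hx hw0) _ _
      refine .seq (.store (.seq (.store (.set ⟨by omega, fun i => ⟨Function.update D' w (m + 1),
        todo' ++ [w], ?_, hinv'.push hm' hm0 hadj hw0, (key u (by omega)).trans hm', ?_⟩⟩))))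
      · rw [← List.append_assoc]
        exact hst'.push hwK (by simp) (by simp [hu', hDu]) (by simp)
      · intro v hv x hvx hx
        have hv0 := (hinv'.mem v).1 (List.mem_append_left _ hv)
        rw [key v hv0]
        by_cases hxw : x = w
        · subst hxw
          rw [Function.update_self]
          refine ⟨by omega, ?_⟩
          by_cases hvu : v = u
          · rw [hvu, hm']
          · exact absurd hw0 (hcl' v hv _ hvx fun h => absurd h hvu).1
        · rw [Function.update_of_ne hxw]
          refine hcl' v hv x hvx fun h => ?_
          exact ((htake x).1 (hx h)).resolve_right hxw
    · simp only [Cond.Holds, Expr.eval, St.setV_v, St.setV_a, if_true] at hb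
      refine .skip ⟨by omega, fun i => ⟨D', todo', hst'.of_eq (by simp) (by simp) (by simp),
        hinv', hm', fun v hv x hvx hx => ?_⟩⟩
      by_cases hvu : v = u
      · subst hvu
        rcases (htake x).1 (hx rfl) with h | h
        · exact hcl' v hv x hvx fun _ => h
        · rw [h, hm', ← hst'.dist w (h ▸ hvx.2.2)]
          exact ⟨hb, (hst'.dist w (h ▸ hvx.2.2)).trans_le (hinv'.upper w)⟩
      · exact hcl' v hv x hvx fun h => absurd h hvu
  · rintro t σ' hF ⟨ht, D', todo', hst', hinv', hm', hcl'⟩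
    refine ⟨by omega, D', todo', hst', hinv', fun v hv w hvw => hcl' v hv w hvw fun h => ?_⟩
    rw [List.take_length]
    exact ((hL u).2 w).2 (h ▸ hvw.1)

/-- The time is charged to the vertices that are reached. This matters later, when components are
searched one at a time. -/
theorem WP.bfsMain {n : ℕ} {G : SimpleGraph (Fin n)} {L : Fin n → List (Fin n)}
    (hL : IsAdjLists G L) {K : Finset (Fin n)} {S : Set (Fin n)} {D : Fin n → ℕ}
    {q : List (Fin n)} {σ : St} (hin : Input L σ)
    (hst : BfsState K D q σ) (hinv : BfsInv (delGraph G K) S D 1 [] q) :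
    WP bfsMain σ fun t σ' => ∃ D', t ≤ ∑ v with D' v ≠ 0, (7 * (L v).length + 5) + 2 ∧
      IsLevel (delGraph G K) S D' ∧ (∀ v ∉ K, σ'.a aD v = D' v) ∧ ∀ v ∈ K, D' v = 0 := by
  refine .seq (.set ?_)
  refine (WP.loop (fun t σ' => ∃ D' m done todo, BfsState K D' (done ++ todo) σ' ∧
    BfsInv (delGraph G K) S D' m done todo ∧ σ'.v vHead = done.length ∧
    (∀ v ∈ done, ∀ w, (delGraph G K).Adj v w → D' w ≠ 0 ∧ D' w ≤ D' v + 1) ∧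
    t ≤ (done.map fun v => 7 * (L v).length + 5).sum) (fun σ' => n - σ'.v vHead) ?_ ?_).mono ?_
  · exact ⟨D, 1, [], q, hst.of_eq (by simp) (by simp) (by simp), hinv, by simp, by simp, by simp⟩
  · rintro t σ' hF ⟨D', m, done, todo, hst', hinv', hhead, hcl, ht⟩ hb
    simp only [Cond.Holds, Expr.eval, hhead, hst'.tail, List.length_append] at hb
    obtain ⟨u, todo, rfl⟩ := List.exists_cons_of_length_pos (show 0 < todo.length by omega)
    have hlen : (done ++ u :: todo).length ≤ n := by
      simpa using hinv'.nodup.length_le_card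
    have hu : σ'.a aQ done.length = u := by
      rw [hst'.queue done.length (by simp)]
      simp
    have hin' : Input L σ' := hin.of_eq ((hF.v _ (by decide)).trans (by simp))
      ((hF.a _ (by decide)).trans (by simp))
    refine .seq (.set (.seq (.set ?_)))
    have hpop := hinv'.pop
    refine (WP.bfsScan (σ := (σ'.setV vU (σ'.a aQ (σ'.v vHead))).setV vHead (σ'.v vHead + 1)) hL
      (hin'.of_eq (by simp) (by simp)) (u := u) (by simp [hhead, hu])
      (BfsState.of_eq (by simpa using hst') (by simp) (by simp) (by simp)) hpop
      (by simp) rfl ?_).mono ?_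
    · intro v hv hvu
      exact hcl v (by simpa [hvu] using hv)
    · rintro t' σ'' hF' ⟨ht', D'', todo'', hst'', hinv'', hcl''⟩
      have hh : σ''.v vHead = done.length + 1 := by
        rw [hF'.v _ (by decide)]; simp [hhead]
      refine ⟨⟨D'', _, _, todo'', hst'', hinv'', by simpa using hh, hcl'', ?_⟩, ?_⟩
      · simp only [List.map_append, List.sum_append, List.map_cons, List.sum_cons, List.map_nil,
          List.sum_nil]
        omega
      · rw [hh, hhead]
        simp at hlen
        omega
  · rintro t σ' hF ⟨s, rfl, ⟨D', m, done, todo, hst', hinv', hhead, hcl, ht⟩, hb⟩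
    simp only [Cond.Holds, Expr.eval, hhead, hst'.tail, List.length_append] at hb
    obtain rfl : todo = [] := List.eq_nil_of_length_eq_zero (by omega)
    have hmem : ∀ v, v ∈ done ↔ D' v ≠ 0 := by simpa using hinv'.mem
    have hnd : done.Nodup := by simpa using hinv'.nodup
    refine ⟨D', ?_, ⟨hinv'.src, hinv'.pred, fun u w huw hu => hcl u ((hmem u).2 hu) w huw⟩,
      hst'.dist, fun v hv => (hst'.mask v hv).2⟩
    have : (done.map fun v => 7 * (L v).length + 5).sum =
        ∑ v with D' v ≠ 0, (7 * (L v).length + 5) := by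
      rw [← List.sum_toFinset _ hnd]
      exact Finset.sum_congr (by ext v; simp [hmem]) fun _ _ => rfl
    omega

/-- The final loop clears the entries by which the mask was marked as visited, so that the array
agrees with the levels everywhere. -/
theorem WP.bfs {n : ℕ} {G : SimpleGraph (Fin n)} {L : Fin n → List (Fin n)}
    (hL : IsAdjLists G L) {K S : Finset (Fin n)} {mask : ℕ} {σ : St} (hin : Input L σ)
    (hK : IsFlag mask K σ) (hS : IsFlag aSrc S σ) (hSK : Disjoint S K)
    (hmask : mask ≠ aD ∧ mask ≠ aQ) :
    WP (bfs mask) σ fun t σ' => ∃ D : Fin n → ℕ,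
      t ≤ 20 * n + 20 + ∑ v : Fin n with D v ≠ 0, (7 * (L v).length + 5) ∧
      IsLevel (delGraph G K) S D ∧ ∀ v : Fin n, σ'.a aD v = D v := by
  refine .seq' (WP.bfsInit (G := G) hin hK hS hSK hmask) ?_
  rintro t1 σ1 hF1 ⟨ht1, D1, q, hst, hinv⟩
  have hin1 := hin.of_eq (hF1.v _ (by simp [Imp.bfsInit, Cmd.for, Cmd.vars]))
    (hF1.a _ (by simp [Imp.bfsInit, Cmd.for, Cmd.arrs]))
  refine .seq' (WP.bfsMain hL hin1 hst hinv) ?_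
  rintro t2 σ2 hF2 ⟨D, ht2, hlev, hD, hDK⟩
  have hN2 : σ2.v vN = n := (hF2.v _ (by decide)).trans hin1.size
  have hm2 : IsFlag mask K σ2 := hK.of_eq <| (hF2.a _ (by
      simpa [Imp.bfsMain, Imp.bfsScan, Cmd.forNbr, Cmd.for, Cmd.arrs] using hmask)).trans
    (hF1.a _ (by simpa [Imp.bfsInit, Cmd.for, Cmd.arrs] using hmask))
  refine (WP.for (fun k σ' => ∀ v : Fin n, σ'.a aD v =
    if v ∈ K ∧ (v : ℕ) < k then 0 else σ2.a aD v)
    (fun _ => 2) 0 n rfl (Nat.zero_le n) (by simp [Cmd.vars]) ?_ ?_ ?_).mono ?_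
  · intro σ' hF
    exact (hF.v _ (by simp [Cmd.for, Cmd.vars])).trans hN2
  · intro v; simp
  · intro k σ' _ hk hF hv hI
    have hmk : σ'.a mask k = if (⟨k, hk⟩ : Fin n) ∈ K then 1 else 0 := by
      rw [hF.a _ (by simpa [Cmd.for, Cmd.arrs] using hmask.1)]
      exact hm2 ⟨k, hk⟩
    refine .ite (fun hb => .store ⟨le_rfl, fun v => ?_⟩) fun hb => .skip ⟨le_rfl, fun v => ?_⟩
    · simp only [Cond.Holds, Expr.eval, hv, hmk] at hb
      have hkK : (⟨k, hk⟩ : Fin n) ∈ K := by by_contra h; simp [h] at hb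
      simp only [Expr.eval, St.setV_a, St.setA_a, if_true, hv, Function.update_apply, hI v]
      by_cases h1 : (v : ℕ) = k
      · have : v = ⟨k, hk⟩ := Fin.ext h1
        simp [h1, this ▸ hkK]
      · rw [if_neg h1]
        congr 2
        exact propext (by omega)
    · simp only [Cond.Holds, Expr.eval, hv, hmk] at hb
      have hkK : (⟨k, hk⟩ : Fin n) ∉ K := by by_contra h; simp [h] at hb
      simp only [St.setV_a, hI v]
      congr 1
      refine propext (and_congr_right fun hvK => ?_)
      have : (v : ℕ) ≠ k := by rintro rfl; exact hkK hvK
      omega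
  · rintro t3 σ3 hF3 ⟨ht3, hI⟩
    refine ⟨D, ?_, hlev, fun v => ?_⟩
    · simp at ht3
      omega
    · rw [hI v]
      by_cases hv : v ∈ K
      · simp [hv, hDK v hv]
      · simp [hv, hD v hv]

end Imp

/-! ### Search levels and graph distances -/

namespace IsLevel

variable {V : Type*} {H : SimpleGraph V} {S : Set V} {D : V → ℕ}

theorem exists_walk (h : IsLevel H S D) : ∀ {j : ℕ} {v : V}, D v = j + 1 →
    ∃ s ∈ S, ∃ p : H.Walk s v, p.length = j := by
  intro j
  induction j with
  | zero => exact fun {v} hv => ⟨v, (h.src v).1 hv, .nil, rfl⟩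
  | succ j ih =>
    intro v hv
    obtain ⟨u, huv, hu⟩ := h.pred v (by omega)
    obtain ⟨s, hs, p, hp⟩ := ih (v := u) (by omega)
    exact ⟨s, hs, p.concat huv, by simp [hp]⟩

theorem le_of_walk (h : IsLevel H S D) {u v : V} (p : H.Walk u v) (hu : D u ≠ 0) :
    D v ≠ 0 ∧ D v ≤ D u + p.length := by
  induction p with
  | nil => simpa using hu
  | cons huw p ih =>
    obtain ⟨h1, h2⟩ := h.closed _ _ huw hu
    obtain ⟨h3, h4⟩ := ih h1
    exact ⟨h3, by simp only [SimpleGraph.Walk.length_cons]; omega⟩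

theorem ne_zero_iff {s : V} (h : IsLevel H {s} D) {v : V} : D v ≠ 0 ↔ H.Reachable s v := by
  constructor
  · intro hv
    obtain ⟨_, rfl, p, -⟩ := h.exists_walk (show D v = (D v - 1) + 1 by omega)
    exact p.reachable
  · rintro ⟨p⟩
    exact (h.le_of_walk p (by rw [(h.src s).2 rfl]; simp)).1

/-- Levels rise by at most one along an edge, which bounds them above; predecessors trace back a
walk of length `D v - 1`, which bounds them below. -/
theorem eq_dist {s : V} (h : IsLevel H {s} D) {v : V} (hv : H.Reachable s v) :
    D v = H.dist s v + 1 := by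
  have hs : D s = 1 := (h.src s).2 rfl
  obtain ⟨p, hp⟩ := hv.exists_walk_length_eq_dist
  obtain ⟨h0, h1⟩ := h.le_of_walk p (by omega)
  obtain ⟨_, rfl, q, hq⟩ := h.exists_walk
    (show D v = (D v - 1) + 1 by omega)
  have := SimpleGraph.dist_le q
  omega

end IsLevel

/-! ### Distances from a set of vertices -/

namespace Imp

open Imp.Expr

notation "vS" => (8 : ℕ)
notation "aRow" => (7 : ℕ)

theorem delGraph_empty {n : ℕ} (G : SimpleGraph (Fin n)) : delGraph G ∅ = G := by
  ext u v; simp [delGraph]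

theorem IsFlag.setA_one {n : ℕ} {a : ℕ} {σ : St} (h : IsFlag a (∅ : Finset (Fin n)) σ)
    (s : Fin n) : IsFlag a {s} (σ.setA a s 1) := fun v => by
  by_cases hv : v = s
  · simp [hv]
  · simp [hv, Function.update_of_ne (fun h => hv (Fin.ext h)), h v]

theorem IsFlag.setA_zero {n : ℕ} {a : ℕ} {s : Fin n} {σ : St} (h : IsFlag a {s} σ) :
    IsFlag a (∅ : Finset (Fin n)) (σ.setA a s 0) := fun v => by
  by_cases hv : v = s
  · simp [hv]
  · simp [Function.update_of_ne (fun h => hv (Fin.ext h)), h v, hv]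

/-- Breadth-first search from the vertex `x` alone. -/
def bfsFrom (mask x : ℕ) : Cmd :=
  .store aSrc (var x) (const 1) ;; bfs mask ;; .store aSrc (var x) (const 0)

/-- The set of sources is emptied again at constant cost, so that searches can be repeated. -/
theorem WP.bfsFrom {n : ℕ} {G : SimpleGraph (Fin n)} {L : Fin n → List (Fin n)}
    (hL : IsAdjLists G L) {K : Finset (Fin n)} {mask x : ℕ} {σ : St} (hin : Input L σ)
    (hK : IsFlag mask K σ) (hS : IsFlag aSrc (∅ : Finset (Fin n)) σ) {s : Fin n} (hx : σ.v x = s)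
    (hs : s ∉ K) (hmask : mask ≠ aD ∧ mask ≠ aQ ∧ mask ≠ aSrc) (hxv : x ∉ (Imp.bfs mask).vars) :
    WP (Imp.bfsFrom mask x) σ fun t σ' => ∃ D : Fin n → ℕ,
      t ≤ 20 * n + 22 + ∑ v : Fin n with D v ≠ 0, (7 * (L v).length + 5) ∧
      IsLevel (delGraph G K) {s} D ∧ (∀ v : Fin n, σ'.a aD v = D v) ∧
      IsFlag aSrc (∅ : Finset (Fin n)) σ' := by
  refine .seq (.store ?_)
  simp only [Expr.eval, hx]
  refine .seq' (WP.bfs (S := {s}) hL (hin.of_eq rfl (by simp))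
    (hK.of_eq (by simp [hmask.2.2])) (hS.setA_one s) (by simpa using hs) ⟨hmask.1, hmask.2.1⟩) ?_
  rintro t σ' hF ⟨D, ht, hlev, hD⟩
  refine .store ⟨D, by omega, by simpa using hlev, fun v => by simp [hD], ?_⟩
  have hx' : σ'.v x = s := (hF.v x hxv).trans hx
  simp only [Expr.eval, hx']
  exact IsFlag.setA_zero ((hS.setA_one s).of_eq (hF.a _ (by
    simp [Imp.bfs, Imp.bfsInit, Imp.bfsMain, Imp.bfsScan, Cmd.forNbr, Cmd.for, Cmd.arrs])))

/-- Compute the distances from the vertices `s` with `flag[s] = 1`, and their maximum. -/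
def eccLoop : Cmd :=
  .for vS (const 0) (var vN) (.when (.eq (arr aFlag (var vS)) (const 1))
    (bfsFrom aZero vS ;;
    .for vV (const 0) (var vN)
      (.store aRow (add (mul (var vS) (var vN)) (var vV)) (sub (arr aD (var vV)) (const 1)) ;;
      .when (.lt (var vAns) (sub (arr aD (var vV)) (const 1)))
        (.set vAns (sub (arr aD (var vV)) (const 1))))))

theorem dist_le_diam_of_connected {n : ℕ} {G : SimpleGraph (Fin n)} (hG : G.Connected)
    (u v : Fin n) : G.dist u v ≤ G.diam :=
  SimpleGraph.dist_le_diam (by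
    have := hG.nonempty
    exact SimpleGraph.connected_iff_ediam_ne_top.1 hG)

theorem pair_index {n a b c d : ℕ} (hb : b < n) (hd : d < n) (h : a * n + b = c * n + d) :
    a = c ∧ b = d := by
  have hn : 0 < n := by omega
  have h1 : (a * n + b) / n = a := by
    rw [add_comm, Nat.add_mul_div_right _ _ hn, Nat.div_eq_of_lt hb, zero_add]
  have h2 : (c * n + d) / n = c := by
    rw [add_comm, Nat.add_mul_div_right _ _ hn, Nat.div_eq_of_lt hd, zero_add]
  obtain rfl : a = c := by rw [← h1, ← h2, h]
  exact ⟨rfl, by omega⟩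

/-- The answer variable may start with any lower bound for the diameter and remains one. Row `s` of
the distance table begins at `s * n`; by `pair_index` different pairs use different cells. -/
theorem WP.eccLoop {n : ℕ} {G : SimpleGraph (Fin n)} {L : Fin n → List (Fin n)}
    (hG : G.Connected) (hL : IsAdjLists G L) {F : Finset (Fin n)} {σ : St} (hin : Input L σ)
    (hF : IsFlag aFlag F σ) (hsrc : IsFlag aSrc (∅ : Finset (Fin n)) σ)
    (hzero : IsFlag aZero (∅ : Finset (Fin n)) σ) (hans : σ.v vAns ≤ G.diam) :
    WP Imp.eccLoop σ fun t σ' =>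
      t ≤ 5 * n + 2 + F.card * (40 * n + 40 + 7 * listOffset L n) ∧
      σ.v vAns ≤ σ'.v vAns ∧ σ'.v vAns ≤ G.diam ∧ IsFlag aSrc (∅ : Finset (Fin n)) σ' ∧
      ∀ s ∈ F, ∀ v : Fin n, G.dist s v ≤ σ'.v vAns ∧ σ'.a aRow (s * n + v) = G.dist s v := by
  set B := 40 * n + 40 + 7 * listOffset L n with hB
  refine (WP.for (fun k σ' => σ.v vAns ≤ σ'.v vAns ∧ σ'.v vAns ≤ G.diam ∧
      IsFlag aSrc (∅ : Finset (Fin n)) σ' ∧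
      ∀ s ∈ F, (s : ℕ) < k → ∀ v : Fin n, G.dist s v ≤ σ'.v vAns ∧
        σ'.a aRow (s * n + v) = G.dist s v)
    (fun k => 3 + if h : k < n then if (⟨k, h⟩ : Fin n) ∈ F then B else 0 else 0) 0 n rfl
    (Nat.zero_le n) (by decide) ?_ ?_ ?_).mono ?_
  · intro σ' hF'
    exact (hF'.v vN (by decide)).trans hin.size
  · exact ⟨by simp, by simpa using hans, hsrc.of_eq (by simp), by simp⟩
  · rintro k σ' - hk hF' hv ⟨hle, hub, hs, hrow⟩
    have hin' : Input L σ' := hin.of_eq (hF'.v _ (by decide)) (hF'.a _ (by decide))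
    have hfl : σ'.a aFlag k = if (⟨k, hk⟩ : Fin n) ∈ F then 1 else 0 := by
      rw [hF'.a _ (by decide)]; exact hF ⟨k, hk⟩
    refine .ite (fun hb => ?_) fun hb => .skip ⟨by omega, hle, hub, hs, fun s hsF hsk => ?_⟩
    · simp only [Cond.Holds, Expr.eval, hv, hfl] at hb
      have hkF : (⟨k, hk⟩ : Fin n) ∈ F := by by_contra h; simp [h] at hb
      refine .seq' (WP.bfsFrom (K := ∅) (s := ⟨k, hk⟩) hL hin'
        (hzero.of_eq (hF'.a _ (by decide))) hs hv (by simp) (by decide) (by decide)) ?_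
      rintro t1 σ1 hF1 ⟨D, ht1, hlev, hD, hs1⟩
      rw [delGraph_empty] at hlev
      have hDd : ∀ v, D v - 1 = G.dist ⟨k, hk⟩ v := fun v => by
        rw [hlev.eq_dist (hG.preconnected _ _)]; rfl
      have hv1 : σ1.v vS = k := (hF1.v _ (by decide)).trans hv
      have hn1 : σ1.v vN = n := (hF1.v _ (by decide)).trans hin'.size
      have ha1 : σ1.v vAns = σ'.v vAns := hF1.v _ (by decide)
      have hr1 : σ1.a aRow = σ'.a aRow := hF1.a _ (by decide)
      refine (WP.for (fun j σ2 => σ'.v vAns ≤ σ2.v vAns ∧ σ2.v vAns ≤ G.diam ∧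
        (∀ v : Fin n, (v : ℕ) < j → G.dist ⟨k, hk⟩ v ≤ σ2.v vAns ∧
          σ2.a aRow (k * n + v) = G.dist ⟨k, hk⟩ v) ∧
        ∀ (s v : Fin n), (s : ℕ) ≠ k → σ2.a aRow (s * n + v) = σ'.a aRow (s * n + v))
        (fun _ => 3) 0 n rfl (Nat.zero_le n) (by decide) ?_ ?_ ?_).mono ?_
      · intro σ2 hF2
        exact (hF2.v vN (by decide)).trans hn1
      · exact ⟨by simp [ha1], by simpa [ha1] using hub, by simp, by simp [hr1]⟩
      · rintro j σ2 - hj hF2 hjv ⟨h1, h2, h3, h4⟩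
        have hDj : σ2.a aD j - 1 = G.dist ⟨k, hk⟩ ⟨j, hj⟩ := by
          rw [hF2.a _ (by decide), ← hDd, ← hD]
        have hvS : σ2.v vS = k := (hF2.v _ (by decide)).trans hv1
        have hvN : σ2.v vN = n := (hF2.v _ (by decide)).trans hn1
        have hrow2 : ∀ (s v : Fin n), ((s : ℕ) = k ∧ (v : ℕ) = j → Function.update (σ2.a aRow)
            (k * n + j) (G.dist ⟨k, hk⟩ ⟨j, hj⟩) (s * n + v) = G.dist ⟨k, hk⟩ ⟨j, hj⟩) ∧
            (¬ ((s : ℕ) = k ∧ (v : ℕ) = j) → Function.update (σ2.a aRow) (k * n + j)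
            (G.dist ⟨k, hk⟩ ⟨j, hj⟩) (s * n + v) = σ2.a aRow (s * n + v)) := fun s v =>
          ⟨fun h => by rw [h.1, h.2, Function.update_self],
            fun h => Function.update_of_ne (fun h' => h (pair_index v.2 hj h')) _ _⟩
        have hrows : ∀ v : Fin n, (v : ℕ) < j + 1 → Function.update (σ2.a aRow)
            (k * n + j) (G.dist ⟨k, hk⟩ ⟨j, hj⟩) (k * n + v) = G.dist ⟨k, hk⟩ v := fun v hvj => by
          by_cases hvj' : (v : ℕ) = j
          · obtain rfl : v = ⟨j, hj⟩ := Fin.ext hvj'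
            exact (hrow2 ⟨k, hk⟩ ⟨j, hj⟩).1 ⟨rfl, rfl⟩
          · rw [(hrow2 ⟨k, hk⟩ v).2 (by tauto)]
            exact (h3 v (by omega)).2
        refine .seq (.store ?_)
        simp only [Expr.eval, hvS, hvN, hjv, hDj]
        refine .ite (fun hb => .set ⟨by omega, ?_, ?_, fun v hvj => ⟨?_, ?_⟩, fun s v hsk => ?_⟩)
          fun hb => .skip ⟨by omega, ?_, ?_, fun v hvj => ⟨?_, ?_⟩, fun s v hsk => ?_⟩
        all_goals simp [hjv, hDj] at hb ⊢
        · omega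
        · exact dist_le_diam_of_connected hG _ _
        · by_cases hvj' : (v : ℕ) = j
          · rw [show v = ⟨j, hj⟩ from Fin.ext hvj']
          · exact (h3 v (by omega)).1.trans hb.le
        · exact hrows v hvj
        · rw [(hrow2 s v).2 (by tauto), h4 s v hsk]
        · exact h1
        · exact h2
        · by_cases hvj' : (v : ℕ) = j
          · rw [show v = ⟨j, hj⟩ from Fin.ext hvj']; exact hb
          · exact (h3 v (by omega)).1
        · exact hrows v hvj
        · rw [(hrow2 s v).2 (by tauto), h4 s v hsk]
      · rintro t2 σ2 hF2 ⟨ht2, h1, h2, h3, h4⟩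
        refine ⟨?_, ?_, ?_, hs1.of_eq (by simpa using hF2.a _ (by decide)), fun s hsF hsk v => ?_⟩
        · simp only [hk, hkF, dif_pos, if_true]
          have hsum : ∑ v : Fin n with D v ≠ 0, (7 * (L v).length + 5) ≤
              7 * listOffset L n + 5 * n := by
            refine (Finset.sum_le_univ_sum_of_nonneg fun _ => Nat.zero_le _).trans ?_
            rw [Finset.sum_add_distrib, ← Finset.mul_sum, listOffset_eq_sum]
            simp [mul_comm]
          simp at ht2
          omega
        · simpa using hle.trans h1
        · simpa using h2
        · simp only [St.setV_v, St.setV_a, show vAns ≠ vS by decide, if_false]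
          by_cases hsk' : (s : ℕ) = k
          · obtain rfl : s = ⟨k, hk⟩ := Fin.ext hsk'
            exact h3 v v.2
          · obtain ⟨g1, g2⟩ := hrow s hsF (by omega) v
            exact ⟨g1.trans h1, (h4 s v hsk').trans g2⟩
    · simp only [Cond.Holds, Expr.eval, hv, hfl] at hb
      refine hrow s hsF ?_
      have : (s : ℕ) ≠ k := by
        rintro rfl
        simp [hsF] at hb
      omega
  · rintro t σ' hF' ⟨ht, h1, h2, h3, h4⟩
    refine ⟨ht.trans ?_, h1, h2, h3, fun s hs v => h4 s hs s.2 v⟩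
    have : ∑ k ∈ Finset.Ico 0 n, (if h : k < n then if (⟨k, h⟩ : Fin n) ∈ F then B else 0 else 0) =
        F.card * B := by
      rw [← Finset.range_eq_Ico, Finset.sum_range]
      simp
    rw [Finset.sum_add_distrib, Finset.sum_add_distrib, this]
    simp
    omega

end Imp

/-! ### The diameter by searches from all vertices -/

namespace Imp

open Imp.Expr WordRAM

theorem listOffset_le {n : ℕ} (L : Fin n → List (Fin n)) (v : ℕ) :
    listOffset L v ≤ listOffset L n := by
  rw [listOffset_eq_sum]
  exact Finset.sum_le_sum fun u _ => by split_ifs <;> simp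

theorem le_of_mem_encodeGraph {n : ℕ} (L : Fin n → List (Fin n)) {m : ℕ} (hm : m ∈ encodeGraph L) :
    m ≤ (encodeGraph L).length := by
  rw [length_encodeGraph]
  simp only [encodeGraph, List.mem_cons, List.mem_append, List.mem_map, List.mem_flatMap] at hm
  rcases hm with rfl | ⟨v, -, rfl⟩ | ⟨v, -, u, -, rfl⟩
  · omega
  · have := listOffset_le L v
    omega
  · have := u.2
    omega

theorem getD_le_of_forall {x : List ℕ} {b : ℕ} (h : ∀ m ∈ x, m ≤ b) (i : ℕ) : x.getD i 0 ≤ b := by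
  by_cases hi : i < x.length
  · rw [List.getD_eq_getElem _ _ hi]
    exact h _ (List.getElem_mem hi)
  · rw [List.getD_eq_default _ _ (not_lt.1 hi)]
    exact Nat.zero_le b

/-- Without a list, the cell that would hold its length lies just behind the input and is read as
`0`; hence one superfluous cell. -/
theorem cells_encodeGraph {n : ℕ} (L : Fin n → List (Fin n)) :
    cells (encodeGraph L) = (encodeGraph L).length + 1 := by
  have h0 := encodeGraph_getD_zero L []
  have h1 := encodeGraph_getD_offset L [] le_rfl
  rw [List.append_nil] at h0 h1
  rw [length_encodeGraph]
  unfold cells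
  simp only [h0, h1]
  rw [List.getD_eq_default _ _ (by rw [length_encodeGraph])]

theorem input_init {n : ℕ} (L : Fin n → List (Fin n)) (r : List ℕ) :
    Input L ((St.init (encodeGraph L ++ r)).setV vN n) :=
  ⟨rfl, fun _ hv => encodeGraph_getD_offset L r hv, fun v _ hj => encodeGraph_getD_nbr L r v hj⟩

/-- Read the number of vertices. -/
def readSize : Cmd := .set vN (arr aIn (const 0))

/-- Breadth-first search from every vertex. -/
def allEcc : Cmd :=
  readSize ;; .for vV (const 0) (var vN) (.store aFlag (var vV) (const 1)) ;; eccLoop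

theorem diam_le_of_forall {n : ℕ} {G : SimpleGraph (Fin n)} (hG : G.Connected) {d : ℕ}
    (h : ∀ u v, G.dist u v ≤ d) : G.diam ≤ d := by
  have := hG.nonempty
  obtain ⟨u, v, huv⟩ := G.exists_dist_eq_diam
  exact huv ▸ h u v

theorem WP.allEcc {n : ℕ} {G : SimpleGraph (Fin n)} {L : Fin n → List (Fin n)}
    (hG : G.Connected) (hL : IsAdjLists G L) :
    WP allEcc (St.init (encodeGraph L)) fun t σ' =>
      t ≤ 10 + 10 * n + n * (40 * n + 40 + 7 * listOffset L n) ∧ σ'.v vAns = G.diam := by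
  have hin := input_init L []
  have h0 := encodeGraph_getD_zero L []
  rw [List.append_nil] at hin h0
  refine .seq (.set ?_)
  rw [show (arr aIn (const 0)).eval (St.init (encodeGraph L)) = n from h0]
  set σ := (St.init (encodeGraph L)).setV vN n with hσ
  refine .seq' (WP.for (fun k σ' => ∀ v : Fin n, (v : ℕ) < k → σ'.a aFlag v = 1)
    (fun _ => 1) 0 n rfl (Nat.zero_le n) (by decide) ?_ ?_ ?_) ?_
  · intro σ' hF
    exact (hF.v vN (by decide)).trans hin.size
  · intro v hv; omega
  · intro k σ' _ hk hF hv hI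
    refine .store ⟨le_rfl, fun v hvk => ?_⟩
    simp only [Expr.eval, hv, St.setV_a, St.setA_a, if_true, Function.update_apply]
    split_ifs with h
    · rfl
    · exact hI v (by omega)
  rintro t1 σ1 hF1 ⟨ht1, h1⟩
  have hz : ∀ a, a ≠ aFlag → a ≠ aIn → IsFlag a (∅ : Finset (Fin n)) σ1 := by
    intro a ha ha' v
    rw [hF1.a a (by simpa [Cmd.for, Cmd.arrs] using ha)]
    simp [hσ, St.init, ha']
  refine (WP.eccLoop (F := Finset.univ) hG hL
    (hin.of_eq (hF1.v _ (by decide)) (hF1.a _ (by decide))) (fun v => by simp [h1 v v.2])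
    (hz aSrc (by decide) (by decide)) (hz aZero (by decide) (by decide)) ?_).mono ?_
  · rw [hF1.v _ (by decide)]
    simp [hσ, St.init]
  · rintro t2 σ2 hF2 ⟨ht2, -, h2, -, h3⟩
    refine ⟨?_, le_antisymm h2 (diam_le_of_forall hG fun u v => (h3 u (Finset.mem_univ u) v).1)⟩
    simp at ht1 ht2
    omega

/-- As `listOffset L n` is the sum of the degrees, this is time `O(n (n + m))`. The results for
average degree, maximum degree and domination number only estimate this product. -/
theorem exists_program_allEcc : ∃ (p : Program) (k κ : ℕ), ∀ (n : ℕ) (G : SimpleGraph (Fin n))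
    (L : Fin n → List (Fin n)), G.Connected → IsAdjLists G L → ∀ T : ℝ,
      (κ * (n * (n + listOffset L n)) : ℝ) ≤ T → OutputsWithin p k (encodeGraph L) G.diam T := by
  obtain ⟨p, k, κ, h⟩ := outputsWithin_of_big allEcc (by decide) 100 2
  refine ⟨p, k, κ * 110, fun n G L hG hL T hT => ?_⟩
  obtain ⟨t, σ, hbig, ht, hans⟩ := WP.allEcc hG hL
  have hlen := length_encodeGraph L
  have hn : 1 ≤ n := by
    obtain ⟨v⟩ := hG.nonempty
    exact v.pos
  rw [← hans]
  refine h _ t σ (by omega) (getD_le_of_forall fun m => le_of_mem_encodeGraph L)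
    (by rw [cells_encodeGraph]; omega) (by rw [cells_encodeGraph]) hbig ?_ T (le_trans ?_ hT)
  · rw [hlen]
    nlinarith
  · rw [hlen]
    have : t + (n + 2 + listOffset L n) ≤ 110 * (n * (n + listOffset L n)) := by
      nlinarith
    calc (κ * (t + (n + 2 + listOffset L n) : ℕ) : ℝ)
        ≤ κ * (110 * (n * (n + listOffset L n)) : ℕ) := by gcongr
      _ = _ := by push_cast; ring

end Imp

/-! ### Bounds for the number of vertices -/

section Bounds

variable {n : ℕ} {G : SimpleGraph (Fin n)} [DecidableRel G.Adj] {L : Fin n → List (Fin n)}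

theorem IsAdjLists.length_eq_degree (hL : IsAdjLists G L) (v : Fin n) :
    (L v).length = G.degree v := by
  rw [← List.toFinset_card_of_nodup (hL v).1, ← G.card_neighborFinset_eq_degree]
  congr 1
  ext u
  simp [(hL v).2 u]

theorem IsAdjLists.listOffset_eq (hL : IsAdjLists G L) :
    listOffset L n = 2 * G.edgeFinset.card := by
  rw [Imp.listOffset_eq_sum, ← G.sum_degrees_eq_twice_card_edges]
  exact Finset.sum_congr rfl fun v _ => hL.length_eq_degree v

theorem IsAdjLists.listOffset_le (hL : IsAdjLists G L) : listOffset L n ≤ n * G.maxDegree := by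
  rw [Imp.listOffset_eq_sum]
  refine (Finset.sum_le_card_nsmul _ _ G.maxDegree fun v _ => ?_).trans (by simp)
  rw [hL.length_eq_degree]
  exact G.degree_le_maxDegree v

/-- A ball of radius `i + 1` consists of the centre and of neighbours of the ball of radius `i`, so
`b' ≤ 1 + Δ b` for their sizes. The summand `1` in the claim closes the induction: `b' + 1 ≤ Δ b + 2
≤ Δ (b + 1)` for `Δ ≥ 2`. -/
theorem card_ball_add_one_le (hG : G.Connected) (hΔ : 2 ≤ G.maxDegree) (s : Fin n) (i : ℕ) :
    (Finset.univ.filter fun v => G.dist s v ≤ i).card + 1 ≤ G.maxDegree ^ (i + 1) := by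
  induction i with
  | zero =>
    have : (Finset.univ.filter fun v => G.dist s v ≤ 0) = {s} := by
      ext v
      simp [hG.dist_eq_zero_iff, eq_comm]
    rw [this]
    simpa using hΔ
  | succ i ih =>
    have hsub : (Finset.univ.filter fun v => G.dist s v ≤ i + 1) ⊆
        {s} ∪ (Finset.univ.filter fun v => G.dist s v ≤ i).biUnion fun v => G.neighborFinset v := by
      intro v hv
      simp only [Finset.mem_filter, Finset.mem_univ, true_and] at hv
      rw [Finset.mem_union, Finset.mem_singleton, Finset.mem_biUnion]
      by_cases hvs : v = s
      · exact .inl hvs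
      · obtain ⟨p, hp⟩ := hG.exists_walk_length_eq_dist v s
        right
        cases p with
        | nil => exact absurd rfl hvs
        | @cons _ u _ h p =>
          refine ⟨u, ?_, by simpa using h.symm⟩
          have := SimpleGraph.dist_le p
          rw [SimpleGraph.dist_comm] at hv this
          simp only [SimpleGraph.Walk.length_cons] at hp
          simp only [Finset.mem_filter, Finset.mem_univ, true_and]
          omega
    have h1 := (Finset.card_le_card hsub).trans (Finset.card_union_le _ _)
    have h2 : ((Finset.univ.filter fun v => G.dist s v ≤ i).biUnion fun v => G.neighborFinset v).card ≤
        (Finset.univ.filter fun v => G.dist s v ≤ i).card * G.maxDegree :=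
      Finset.card_biUnion_le_card_mul _ _ _ fun v _ => by
        rw [G.card_neighborFinset_eq_degree]; exact G.degree_le_maxDegree v
    rw [Finset.card_singleton] at h1
    rw [pow_succ]
    nlinarith

/-- For `Δ ≥ 2` the ball of radius `d` is the whole graph. For `Δ ≤ 1` connectedness gives `n ≤ m +
1`, and `2m ≤ n`, so `n ≤ 2`; this is where the factor `2` is needed. -/
theorem card_le_two_mul_pow (hG : G.Connected) : n ≤ 2 * max 1 G.maxDegree ^ (G.diam + 1) := by
  by_cases hΔ : 2 ≤ G.maxDegree
  · obtain ⟨s⟩ := hG.nonempty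
    have h := card_ball_add_one_le hG hΔ s G.diam
    rw [Finset.filter_true_of_mem fun v _ => Imp.dist_le_diam_of_connected hG s v,
      Finset.card_univ, Fintype.card_fin] at h
    rw [max_eq_right (by omega)]
    omega
  · have h1 := hG.card_vert_le_card_edgeSet_add_one
    have h2 := G.sum_degrees_eq_twice_card_edges
    have h3 : ∑ v, G.degree v ≤ n * 1 := by
      refine (Finset.sum_le_card_nsmul _ _ 1 fun v _ => ?_).trans (by simp)
      exact (G.degree_le_maxDegree v).trans (by omega)
    rw [Nat.card_eq_fintype_card, Nat.card_eq_fintype_card, Fintype.card_fin,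
      ← SimpleGraph.edgeFinset_card] at h1
    have : 1 ≤ max 1 G.maxDegree ^ (G.diam + 1) := Nat.one_le_pow _ _ (by omega)
    omega

/-- The closed neighbourhoods of a smallest dominating set cover all vertices, and each has at most
`1 + Δ` elements. -/
theorem card_le_dominationNumber_mul : n ≤ dominationNumber G * (1 + G.maxDegree) := by
  obtain ⟨D, hD, hc⟩ : dominationNumber G ∈
      {k | ∃ D : Finset (Fin n), (∀ v, v ∈ D ∨ ∃ u ∈ D, G.Adj u v) ∧ D.card = k} :=
    Nat.sInf_mem ⟨_, Finset.univ, fun v => .inl (Finset.mem_univ v), rfl⟩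
  have hsub : (Finset.univ : Finset (Fin n)) ⊆ D.biUnion fun u => insert u (G.neighborFinset u) := by
    intro v _
    rw [Finset.mem_biUnion]
    rcases hD v with h | ⟨u, hu, huv⟩
    · exact ⟨v, h, by simp⟩
    · exact ⟨u, hu, by simp [huv]⟩
  have := (Finset.card_le_card hsub).trans (Finset.card_biUnion_le_card_mul _ _ (1 + G.maxDegree)
    fun u _ => (Finset.card_insert_le _ _).trans (by
      rw [G.card_neighborFinset_eq_degree]
      have := G.degree_le_maxDegree u
      omega))
  rwa [hc, Finset.card_univ, Fintype.card_fin] at this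

end Bounds

open WordRAM

/-- The degrees sum to `a n`, and `n (n + a n) ≤ 2 max(1, a) n^2`. -/
theorem exists_program_averageDegree : ∃ (p : Program) (k : ℕ) (C : ℝ),
    ∀ (n : ℕ) (G : SimpleGraph (Fin n)) [DecidableRel G.Adj] (L : Fin n → List (Fin n)),
      G.Connected → IsAdjLists G L → OutputsWithin p k (encodeGraph L) G.diam
        (C * (max 1 (averageDegree G) * (n : ℝ) ^ 2)) := by
  obtain ⟨p, k, κ, h⟩ := Imp.exists_program_allEcc
  refine ⟨p, k, κ * 2, fun n G _ L hG hL => h n G L hG hL _ ?_⟩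
  have hn : (n : ℝ) ≠ 0 := by
    obtain ⟨v⟩ := hG.nonempty
    exact_mod_cast v.pos.ne'
  have ha : (listOffset L n : ℝ) = averageDegree G * n := by
    rw [averageDegree, Fintype.card_fin, div_mul_cancel₀ _ hn, Imp.listOffset_eq_sum]
    push_cast
    exact Finset.sum_congr rfl fun v _ => by rw [hL.length_eq_degree]
  rw [ha, mul_assoc (κ : ℝ)]
  refine mul_le_mul_of_nonneg_left ?_ (Nat.cast_nonneg _)
  nlinarith [le_max_left 1 (averageDegree G), le_max_right 1 (averageDegree G),
    sq_nonneg (n : ℝ)]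

theorem mul_add_listOffset_le {n : ℕ} {G : SimpleGraph (Fin n)} [DecidableRel G.Adj]
    {L : Fin n → List (Fin n)} (hL : IsAdjLists G L) :
    n * (n + listOffset L n) ≤ n ^ 2 * (1 + G.maxDegree) := by
  have := Nat.mul_le_mul_left n hL.listOffset_le
  linarith [this, show n * (n * G.maxDegree) = n ^ 2 * G.maxDegree by ring,
    show n ^ 2 * (1 + G.maxDegree) = n * n + n ^ 2 * G.maxDegree by ring,
    show n * (n + listOffset L n) = n * n + n * listOffset L n by ring]

theorem exists_program_maxDegree_diam : ∃ (p : Program) (k : ℕ) (C : ℝ),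
    ∀ (n : ℕ) (G : SimpleGraph (Fin n)) [DecidableRel G.Adj] (L : Fin n → List (Fin n)),
      G.Connected → IsAdjLists G L → OutputsWithin p k (encodeGraph L) G.diam
        (C * max 1 (G.maxDegree : ℝ) ^ (2 * G.diam + 3)) := by
  obtain ⟨p, k, κ, h⟩ := Imp.exists_program_allEcc
  refine ⟨p, k, κ * 8, fun n G _ L hG hL => h n G L hG hL _ ?_⟩
  have key : n * (n + listOffset L n) ≤ 8 * max 1 G.maxDegree ^ (2 * G.diam + 3) := by
    refine (mul_add_listOffset_le hL).trans ?_
    -- With `M = max(1, Δ)` the product is `(2 M^(d+1))^2 * 2 M`, whence the constant `8` and the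
    -- exponent `2 d + 3`.
    calc n ^ 2 * (1 + G.maxDegree)
        ≤ (2 * max 1 G.maxDegree ^ (G.diam + 1)) ^ 2 * (2 * max 1 G.maxDegree) := by
          gcongr
          · exact card_le_two_mul_pow hG
          · omega
      _ = _ := by ring
  rw [mul_assoc (κ : ℝ)]
  refine mul_le_mul_of_nonneg_left ?_ (Nat.cast_nonneg _)
  exact_mod_cast key

theorem exists_program_dominationNumber : ∃ (p : Program) (k : ℕ) (C : ℝ),
    ∀ (n : ℕ) (G : SimpleGraph (Fin n)) [DecidableRel G.Adj] (L : Fin n → List (Fin n)),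
      G.Connected → IsAdjLists G L → OutputsWithin p k (encodeGraph L) G.diam
        (C * ((dominationNumber G : ℝ) ^ 2 * max 1 (G.maxDegree : ℝ) ^ 3)) := by
  obtain ⟨p, k, κ, h⟩ := Imp.exists_program_allEcc
  refine ⟨p, k, κ * 8, fun n G _ L hG hL => h n G L hG hL _ ?_⟩
  have key : n * (n + listOffset L n) ≤
      8 * (dominationNumber G ^ 2 * max 1 G.maxDegree ^ 3) := by
    refine (mul_add_listOffset_le hL).trans ?_
    calc n ^ 2 * (1 + G.maxDegree)
        ≤ (dominationNumber G * (2 * max 1 G.maxDegree)) ^ 2 * (2 * max 1 G.maxDegree) := by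
          gcongr
          · exact card_le_dominationNumber_mul.trans (Nat.mul_le_mul_left _ (by omega))
          · omega
      _ = _ := by ring
  rw [mul_assoc (κ : ℝ)]
  refine mul_le_mul_of_nonneg_left ?_ (Nat.cast_nonneg _)
  exact_mod_cast key

theorem IsAdjLists.countP_eq {n : ℕ} {G : SimpleGraph (Fin n)} {L : Fin n → List (Fin n)}
    (hL : IsAdjLists G L) (v : Fin n) (P : Fin n → Prop) [DecidablePred P] [DecidableRel G.Adj] :
    (L v).countP (fun w => decide (P w)) = (Finset.univ.filter fun w => G.Adj v w ∧ P w).card := by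
  rw [List.countP_eq_length_filter, ← List.toFinset_card_of_nodup ((hL v).1.filter _)]
  congr 1
  ext w
  simp [(hL v).2 w]

/-! ### Distance to clique: deleting nonadjacent pairs -/

namespace Imp

open Imp.Expr WordRAM

theorem WP.countNbr {n : ℕ} {L : Fin n → List (Fin n)} {i w u c : ℕ} {b : Cond}
    (P : Fin n → Prop) [DecidablePred P] {σ : St} (hin : Input L σ) (x : Fin n) (hx : σ.v u = x)
    (hvars : i ≠ w ∧ i ≠ u ∧ w ≠ u ∧ i ≠ vN ∧ w ≠ vN ∧ i ≠ c ∧ u ≠ c ∧ vN ≠ c ∧ w ≠ c)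
    (hb : ∀ (σ' : St) (y : Fin n), (∀ z, z ≠ i → z ≠ w → z ≠ c → σ'.v z = σ.v z) →
      (∀ a, σ'.a a = σ.a a) → σ'.v w = y → (b.Holds σ' ↔ P y)) :
    WP (.set c (const 0) ;; .forNbr i w u (.when b (.inc c))) σ fun t σ' =>
      t ≤ 6 * (L x).length + 3 ∧ σ'.v c = (L x).countP fun y => decide (P y) := by
  obtain ⟨h1, h2, h3, h4, h5, h6, h7, h8, h9⟩ := hvars
  refine .seq (.set ?_)
  refine (WP.forNbr (fun k σ' => σ'.v c = ((L x).take k).countP fun y => decide (P y)) 3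
    (hin.of_eq (by simp [h8]) (by simp)) x (by simp [h7, hx]) ?_ ?_ ?_).mono ?_
  · simp [Cmd.vars, Cmd.arrs, h1, h2, h3, h4, h5, h6, h7, h8]
  · intro m; simp [h6.symm, Expr.eval]
  · intro k hk σ' hF hI
    have htake : ((L x).take (k + 1)).countP (fun y => decide (P y)) =
        ((L x).take k).countP (fun y => decide (P y)) + if P (L x)[k] then 1 else 0 := by
      rw [List.take_succ_eq_append_getElem hk, List.countP_append, List.countP_singleton]
      simp
    have hb' := hb (σ'.setV w ((L x)[k] : ℕ)) (L x)[k] (fun z z1 z2 z3 => by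
      rw [St.setV_v, if_neg z2, hF.v z (by simp [Cmd.forNbr, Cmd.for, Cmd.vars, z1, z2, z3])]
      simp [z3]) (fun a => by
      rw [St.setV_a, hF.a a (by simp [Cmd.forNbr, Cmd.for, Cmd.arrs])]; rfl) (by simp)
    refine .ite (fun hc => .set ⟨by omega, fun m => ?_⟩) fun hc => .skip ⟨by omega, fun m => ?_⟩
    · rw [htake, if_pos (hb'.1 hc)]
      simp [h6.symm, h9.symm, Expr.eval, hI]
    · rw [htake, if_neg fun h => hc (hb'.2 h)]
      simp [h6.symm, h9.symm, hI]
  · rintro t σ' - ⟨ht, hI⟩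
    refine ⟨by omega, ?_⟩
    rwa [List.take_length] at hI

notation "vR" => (9 : ℕ)
notation "vCnt" => (10 : ℕ)
notation "vX" => (11 : ℕ)
notation "aMark" => (8 : ℕ)

/-- Find a vertex `vX` with `flag[vX] = 0` that is not adjacent to `vS`. -/
def findNonNbr : Cmd :=
  .for vV (const 0) (var vN) (.store aMark (var vV) (const 0)) ;;
  .store aMark (var vS) (const 1) ;;
  .forNbr vI vW vS (.store aMark (var vW) (const 1)) ;;
  .set vX (var vS) ;;
  .for vV (const 0) (var vN) (.when (.eq (arr aFlag (var vV)) (const 0))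
    (.when (.eq (arr aMark (var vV)) (const 0)) (.set vX (var vV))))

/-- The vertex `s` is marked together with its neighbours, so an unmarked vertex outside `K` is what
is sought. The linear cost is acceptable because a search is made only when two vertices are about
to be deleted. -/
theorem WP.findNonNbr {n : ℕ} {G : SimpleGraph (Fin n)} {L : Fin n → List (Fin n)}
    (hL : IsAdjLists G L) {K : Finset (Fin n)} {σ : St} (hin : Input L σ) (hK : IsFlag aFlag K σ)
    {s : Fin n} (hs : σ.v vS = s) (hex : ∃ u, u ∉ K ∧ u ≠ s ∧ ¬ G.Adj s u) :
    WP findNonNbr σ fun t σ' => t ≤ 10 * n + 4 * (L s).length + 10 ∧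
      ∃ u, σ'.v vX = u.val ∧ u ∉ K ∧ u ≠ s ∧ ¬ G.Adj s u := by
  refine .seq' (WP.for (fun k σ' => ∀ v : Fin n, (v : ℕ) < k → σ'.a aMark v = 0)
    (fun _ => 1) 0 n rfl (Nat.zero_le n) (by decide) ?_ ?_ ?_) ?_
  · exact fun σ' hF => (hF.v vN (by decide)).trans hin.size
  · intro v hv; omega
  · intro k σ' _ hk hF hv hI
    refine .store ⟨le_rfl, fun v hvk => ?_⟩
    simp only [Expr.eval, hv, St.setV_a, St.setA_a, if_true, Function.update_apply]
    split_ifs with h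
    · rfl
    · exact hI v (by omega)
  rintro t1 σ1 hF1 ⟨ht1, h1⟩
  have hs1 : σ1.v vS = s := (hF1.v _ (by decide)).trans hs
  have hin1 : Input L σ1 := hin.of_eq (hF1.v _ (by decide)) (hF1.a _ (by decide))
  refine .seq (.store ?_)
  simp only [Expr.eval, hs1]
  refine .seq' (WP.forNbr (σ := σ1.setA aMark s 1) (i := vI) (w := vW)
    (c := .store aMark (var vW) (const 1)) (fun k σ' => ∀ v : Fin n, σ'.a aMark v = 0 ↔
    v ≠ s ∧ v ∉ (L s).take k) 1 (hin1.of_eq rfl (by simp)) s (by exact hs1) (by decide) ?_ ?_) ?_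
  · intro m v
    by_cases hvs : v = s
    · simp [hvs]
    · simp [hvs, Function.update_of_ne (fun h => hvs (Fin.ext h)), h1 v v.2]
  · intro k hk σ' hF hI
    refine .store ⟨le_rfl, fun m v => ?_⟩
    rw [List.take_succ_eq_append_getElem hk, List.mem_append, List.mem_singleton]
    simp only [Expr.eval, St.setV_v, St.setV_a, St.setA_a, if_true, Function.update_apply]
    by_cases hv : v = (L s)[k]
    · simp [hv]
    · rw [if_neg (fun h => hv (Fin.ext h)), hI v]
      simp [hv]
  rintro t2 σ2 hF2 ⟨ht2, h2⟩
  rw [List.take_length] at h2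
  simp only [(hL s).2] at h2
  have hs2 : σ2.v vS = s := (hF2.v _ (by decide)).trans hs1
  have hn2 : σ2.v vN = n := (hF2.v _ (by decide)).trans hin1.size
  have hK2 : IsFlag aFlag K σ2 := hK.of_eq ((hF2.a _ (by decide)).trans
    (show (σ1.setA _ _ _).a aFlag = _ by simpa using hF1.a _ (by decide)))
  refine .seq (.set ?_)
  refine (WP.for (fun k σ' => (∃ u, σ'.v vX = u.val ∧ u ∉ K ∧ u ≠ s ∧ ¬ G.Adj s u) ∨
    ∀ u : Fin n, (u : ℕ) < k → ¬ (u ∉ K ∧ u ≠ s ∧ ¬ G.Adj s u)) (fun _ => 3) 0 n rfl (Nat.zero_le n)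
    (by decide) ?_ ?_ ?_).mono ?_
  · exact fun σ' hF => (hF.v vN (by decide)).trans (by simpa using hn2)
  · right; intro u hu; omega
  · intro k σ' _ hk hF hv hI
    have hfl : σ'.a aFlag k = 0 ↔ (⟨k, hk⟩ : Fin n) ∉ K := by
      rw [hF.a _ (by decide)]
      have := hK2 ⟨k, hk⟩
      simp only at this
      simp [this]
    have hmk : σ'.a aMark k = 0 ↔ (⟨k, hk⟩ : Fin n) ≠ s ∧ ¬ G.Adj s ⟨k, hk⟩ := by
      rw [hF.a _ (by decide)]
      exact h2 ⟨k, hk⟩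
    have hskip : ¬ ((⟨k, hk⟩ : Fin n) ∉ K ∧ (⟨k, hk⟩ : Fin n) ≠ s ∧ ¬ G.Adj s ⟨k, hk⟩) →
        (∃ u, (σ'.setV vV (k + 1)).v vX = u.val ∧ u ∉ K ∧ u ≠ s ∧ ¬ G.Adj s u) ∨
        ∀ u : Fin n, (u : ℕ) < k + 1 → ¬ (u ∉ K ∧ u ≠ s ∧ ¬ G.Adj s u) := by
      intro hno
      rcases hI with h | h
      · exact .inl (by simpa using h)
      · right
        intro u hu
        by_cases huk : (u : ℕ) = k
        · rwa [show u = ⟨k, hk⟩ from Fin.ext huk]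
        · exact h u (by omega)
    refine .ite (fun hb => .ite (fun hb' => .set ⟨le_rfl, .inl ⟨⟨k, hk⟩, ?_⟩⟩)
      fun hb' => .skip ⟨le_rfl, hskip ?_⟩) fun hb => .skip ⟨by omega, hskip ?_⟩
    all_goals simp only [Cond.Holds, Expr.eval, hv, hfl, hmk] at *
    · exact ⟨by simp, hb, hb'⟩
    · tauto
    · tauto
  · rintro t3 σ3 - ⟨ht3, h3⟩
    refine ⟨?_, h3.resolve_right fun h => ?_⟩
    · simp at ht1 ht2 ht3
      omega
    · obtain ⟨u, hu⟩ := hex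
      exact h u u.2 hu

/-- Greedily delete pairs of nonadjacent vertices. -/
def cliqueDel : Cmd :=
  .set vR (var vN) ;;
  .for vS (const 0) (var vN) (.when (.eq (arr aFlag (var vS)) (const 0))
    ((.set vCnt (const 0) ;;
      .forNbr vI vW vS (.when (.eq (arr aFlag (var vW)) (const 0)) (.inc vCnt))) ;;
    .when (.lt (add (var vCnt) (const 1)) (var vR))
      (findNonNbr ;; .store aFlag (var vS) (const 1) ;; .store aFlag (var vX) (const 1) ;;
        .set vR (sub (var vR) (const 2)))))

theorem adj_of_isCliqueDeletionSet {V : Type*} {G : SimpleGraph V} {K : Finset V}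
    (h : IsCliqueDeletionSet G K) {u v : V} (hu : u ∉ K) (hv : v ∉ K) (huv : u ≠ v) : G.Adj u v := by
  have : (G.induce {v | v ∉ K}).Adj ⟨u, hu⟩ ⟨v, hv⟩ := by
    rw [h]
    simpa using huv
  simpa using this

theorem IsFlag.insert {n : ℕ} {a : ℕ} {K : Finset (Fin n)} {σ : St} (h : IsFlag a K σ)
    (s : Fin n) : IsFlag a (insert s K) (σ.setA a s 1) := fun v => by
  by_cases hv : v = s
  · simp [hv]
  · simp [hv, Function.update_of_ne (fun h => hv (Fin.ext h)), h v]

/-- Of two nonadjacent vertices at least one belongs to `X`, and it is new in `K`. Thus at least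
half of the deleted vertices always lie in `X`, whatever clique deletion set `X` is. -/
theorem card_add_two_le {n : ℕ} {G : SimpleGraph (Fin n)} {K X : Finset (Fin n)}
    (hX : IsCliqueDeletionSet G X) {s u : Fin n} (hs : s ∉ K) (hu : u ∉ K) (hus : u ≠ s)
    (hadj : ¬ G.Adj s u) (h : K.card ≤ 2 * (K ∩ X).card) :
    K.card + 2 ≤ 2 * (insert u (insert s K) ∩ X).card := by
  have key : ∃ x ∈ X, x ∉ K ∧ x ∈ insert u (insert s K) := by
    by_contra hno
    push Not at hno
    refine hadj (adj_of_isCliqueDeletionSet hX (fun h => ?_) (fun h => ?_) hus.symm)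
    · exact hno s h hs (by simp)
    · exact hno u h hu (by simp)
  obtain ⟨x, hxX, hxK, hx⟩ := key
  have : insert x (K ∩ X) ⊆ insert u (insert s K) ∩ X := by
    intro y hy
    rcases Finset.mem_insert.1 hy with rfl | hy
    · exact Finset.mem_inter.2 ⟨hx, hxX⟩
    · rw [Finset.mem_inter] at hy ⊢
      exact ⟨by simp [hy.1], hy.2⟩
  have := Finset.card_le_card this
  rw [Finset.card_insert_of_notMem (fun h => hxK (Finset.mem_inter.1 h).1)] at this
  omega

/-- With `r` vertices left, `s` has at most `r - 1` remaining neighbours, with equality exactly if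
it is adjacent to all others that remain. Later deletions do not destroy this property, so one pass
suffices. Counting neighbours is charged to the degrees, and finding a nonneighbour to the two
deleted vertices. -/
theorem WP.cliqueDel {n : ℕ} {G : SimpleGraph (Fin n)} {L : Fin n → List (Fin n)}
    (hL : IsAdjLists G L) {σ : St} (hin : Input L σ) (hK : IsFlag aFlag (∅ : Finset (Fin n)) σ) :
    WP cliqueDel σ fun t σ' => ∃ K : Finset (Fin n),
      t ≤ 20 * n + 20 * listOffset L n + K.card * (10 * n + 20) + 3 ∧ IsFlag aFlag K σ' ∧
      (∀ X, IsCliqueDeletionSet G X → K.card ≤ 2 * (K ∩ X).card) ∧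
      ∀ u v, u ∉ K → v ∉ K → u ≠ v → G.Adj u v := by
  classical
  refine .seq (.set ?_)
  refine (WP.forT (fun k t σ' => ∃ K : Finset (Fin n),
    t ≤ 20 * k + 20 * listOffset L k + K.card * (10 * n + 20) ∧ IsFlag aFlag K σ' ∧
    σ'.v vR + K.card = n ∧
    (∀ X, IsCliqueDeletionSet G X → K.card ≤ 2 * (K ∩ X).card) ∧
    ∀ u v : Fin n, (u : ℕ) < k → u ∉ K → v ∉ K → u ≠ v → G.Adj u v) 0 n rfl (Nat.zero_le n)
    (by decide) ?_ ?_ ?_).mono ?_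
  · exact fun σ' hF => (hF.v vN (by decide)).trans (by simpa using hin.size)
  · exact ⟨∅, by simp, hK.of_eq (by simp), by simp [Expr.eval, hin.size], by simp,
      fun u v hu => by omega⟩
  · rintro k t σ' - hk hF hv ⟨K, ht, hfl, hr, hX, hadj⟩
    set s : Fin n := ⟨k, hk⟩ with hs
    have hoff : listOffset L (k + 1) = listOffset L k + (L s).length := listOffset_succ L s
    have hin' : Input L σ' := hin.of_eq ((hF.v _ (by decide)).trans (by simp))
      ((hF.a _ (by decide)).trans (by simp))
    have hfs := hfl s
    have hcast : (s : ℕ) = k := rfl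
    rw [hcast] at hfs
    refine .ite (fun hb => ?_) fun hb => .skip ⟨K, by rw [hoff]; omega, hfl.of_eq (by simp),
      by simpa using hr, hX, fun u v hu hu' => ?_⟩
    · simp only [Cond.Holds, Expr.eval, hv, hfs] at hb
      have hsK : s ∉ K := by intro h; simp [h] at hb
      refine .seq' (WP.countNbr (fun w => w ∉ K) hin' s hv (by decide) ?_) ?_
      · intro σ1 y h1 h2 h3
        simp only [Cond.Holds, Expr.eval, h3, h2, hfl y]
        simp
      rintro t1 σ1 hF1 ⟨ht1, hcnt⟩
      rw [hL.countP_eq] at hcnt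
      have hv1 : σ1.v vS = s := (hF1.v _ (by decide)).trans hv
      have hr1 : σ1.v vR = σ'.v vR := hF1.v _ (by decide)
      have hfl1 : IsFlag aFlag K σ1 := hfl.of_eq (hF1.a _ (by decide))
      have hin1 : Input L σ1 := hin'.of_eq (hF1.v _ (by decide)) (hF1.a _ (by decide))
      have hsub : (Finset.univ.filter fun w => G.Adj s w ∧ w ∉ K) ⊆ Kᶜ.erase s := by
        intro w hw
        simp only [Finset.mem_filter, Finset.mem_univ, true_and] at hw
        simp [hw.2, hw.1.ne']
      have hcard : (Kᶜ.erase s).card + 1 = σ'.v vR := by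
        rw [Finset.card_erase_add_one (by simpa using hsK), Finset.card_compl, Fintype.card_fin]
        omega
      refine .ite (fun hb => ?_) fun hb => .skip ⟨K, by rw [hoff]; omega, hfl1.of_eq (by simp),
        by simpa [hr1] using hr, hX, fun u v hu hu' hv' huv => ?_⟩
      · simp only [Cond.Holds, Expr.eval, hcnt, hr1] at hb
        have hex : ∃ u, u ∉ K ∧ u ≠ s ∧ ¬ G.Adj s u := by
          by_contra hno
          push Not at hno
          have : Kᶜ.erase s ⊆ Finset.univ.filter fun w => G.Adj s w ∧ w ∉ K := by
            intro w hw
            simp only [Finset.mem_erase, Finset.mem_compl] at hw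
            simp [hw.2, hno w hw.2 hw.1]
          have := Finset.card_le_card this
          omega
        refine .seq' (WP.findNonNbr hL hin1 hfl1 hv1 hex) ?_
        rintro t2 σ2 hF2 ⟨ht2, u, hu, huK, hus, hsu⟩
        have hv2 : σ2.v vS = s := (hF2.v _ (by decide)).trans hv1
        have hr2 : σ2.v vR = σ'.v vR := (hF2.v _ (by decide)).trans hr1
        have hfl2 : IsFlag aFlag K σ2 := hfl1.of_eq (hF2.a _ (by decide))
        have hsK' : u ∉ insert s K := by simp [hus, huK]
        have hc : (insert u (insert s K)).card = K.card + 2 := by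
          rw [Finset.card_insert_of_notMem hsK', Finset.card_insert_of_notMem hsK]
        refine .seq (.store (.seq (.store (.set ⟨insert u (insert s K), ?_, ?_, ?_, ?_, ?_⟩))))
        · rw [hoff, hc, add_mul]
          omega
        · have := ((hfl2.insert s).insert u)
          refine this.of_eq ?_
          simp [Expr.eval, hv2, hu]
        · have : (insert u (insert s K)).card ≤ n := by
            simpa using Finset.card_le_univ (insert u (insert s K))
          simp [Expr.eval, hr2]
          omega
        · intro X hX'
          rw [hc]
          exact card_add_two_le hX' hsK huK hus hsu (hX X hX')
        · intro a b ha haK hbK hab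
          have haK' : a ∉ K := fun h => haK (by simp [h])
          have has : a ≠ s := fun h => haK (by simp [h])
          have : (a : ℕ) ≠ k := fun h => has (Fin.ext h)
          exact hadj a b (by omega) haK' (fun h => hbK (by simp [h])) hab
      · simp only [Cond.Holds, Expr.eval, hcnt, hr1] at hb
        by_cases huk : (u : ℕ) = k
        · obtain rfl : u = s := Fin.ext huk
          have := Finset.eq_of_subset_of_card_le hsub (by omega)
          have hmem : v ∈ Kᶜ.erase s := by simp [hv', huv.symm]
          rw [← this] at hmem
          exact (Finset.mem_filter.1 hmem).2.1
        · exact hadj u v (by omega) hu' hv' huv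
    · simp only [Cond.Holds, Expr.eval, hv, hfs] at hb
      have hsK : s ∈ K := by by_contra h; simp [h] at hb
      have : (u : ℕ) ≠ k := fun h => hu' (by rwa [show u = s from Fin.ext h])
      exact hadj u v (by omega) hu'
  · rintro t σ' - ⟨r, rfl, K, ht, hfl, -, hX, hadj⟩
    exact ⟨K, by omega, hfl, hX, fun u v => hadj u v u.2⟩

/-- The diameter, via a deletion set to cliques. -/
def cliqueProg : Cmd :=
  readSize ;; cliqueDel ;; .when (.lt (const 1) (var vN)) (.set vAns (const 1)) ;; eccLoop

/-- Searches from `K` settle all pairs that meet `K`. The others are equal or adjacent, and their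
contribution is entered in advance: the answer starts with `1` if `n > 1`, which a connected graph
permits. -/
theorem WP.cliqueProg {n : ℕ} {G : SimpleGraph (Fin n)} {L : Fin n → List (Fin n)}
    (hG : G.Connected) (hL : IsAdjLists G L) :
    WP cliqueProg (St.init (encodeGraph L)) fun t σ' =>
      t ≤ 25 * n + 20 * listOffset L n + 8 +
        2 * distToClique G * (50 * n + 60 + 7 * listOffset L n) ∧ σ'.v vAns = G.diam := by
  have hin := input_init L []
  have h0 := encodeGraph_getD_zero L []
  rw [List.append_nil] at hin h0
  refine .seq (.set ?_)
  rw [show (arr aIn (const 0)).eval (St.init (encodeGraph L)) = n from h0]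
  set σ := (St.init (encodeGraph L)).setV vN n with hσ
  have hz : ∀ a, a ≠ aIn → IsFlag a (∅ : Finset (Fin n)) σ := by
    intro a ha v
    simp [hσ, St.init, ha]
  refine .seq' (WP.cliqueDel hL hin (hz _ (by decide))) ?_
  rintro t1 σ1 hF1 ⟨K, ht1, hK1, hX, hadj⟩
  have hn1 : σ1.v vN = n := (hF1.v _ (by decide)).trans hin.size
  have ha1 : σ1.v vAns = 0 := (hF1.v _ (by decide)).trans (by simp [hσ, St.init])
  have hKc : K.card ≤ 2 * distToClique G := by
    obtain ⟨X, hX1, hX2⟩ : distToClique G ∈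
        {k | ∃ X : Finset (Fin n), IsCliqueDeletionSet G X ∧ X.card = k} :=
      Nat.sInf_mem ⟨_, Finset.univ, by ext ⟨v, hv⟩; simp at hv, rfl⟩
    rw [← hX2]
    exact (hX X hX1).trans (Nat.mul_le_mul_left _ (Finset.card_le_card Finset.inter_subset_right))
  have hwhen : WP (.when (.lt (const 1) (var vN)) (.set vAns (const 1))) σ1 fun t σ' =>
      t ≤ 2 ∧ σ'.v vAns = if 1 < n then 1 else 0 := by
    refine .ite (fun hb => .set ⟨le_rfl, ?_⟩) fun hb => .skip ⟨le_rfl, ?_⟩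
    · simp only [Cond.Holds, Expr.eval, hn1] at hb
      simp [hb, Expr.eval]
    · simp only [Cond.Holds, Expr.eval, hn1] at hb
      simp [hb, ha1]
  refine .seq' hwhen ?_
  rintro t2 σ2 hF2 ⟨ht2, ha2⟩
  have hz2 : ∀ a, a ≠ aIn → a ∉ Imp.cliqueDel.arrs → IsFlag a (∅ : Finset (Fin n)) σ2 :=
    fun a ha ha' => (hz a ha).of_eq ((hF2.a a (by simp [Cmd.arrs])).trans (hF1.a a ha'))
  refine (WP.eccLoop (F := K) hG hL
    ((hin.of_eq (hF1.v _ (by decide)) (hF1.a _ (by decide))).of_eq (hF2.v _ (by decide))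
      (hF2.a _ (by decide))) (hK1.of_eq (hF2.a _ (by decide)))
    (hz2 aSrc (by decide) (by decide)) (hz2 aZero (by decide) (by decide)) ?_).mono ?_
  · rw [ha2]
    split_ifs with h
    · exact (hG.pos_dist_of_ne (u := ⟨0, by omega⟩) (v := ⟨1, h⟩) (by simp [Fin.ext_iff])).trans_le
        (dist_le_diam_of_connected hG _ _)
    · exact Nat.zero_le _
  · rintro t3 σ3 - ⟨ht3, h1, h2, -, h3⟩
    refine ⟨?_, le_antisymm h2 (diam_le_of_forall hG fun u v => ?_)⟩
    · have e1 := Nat.mul_le_mul_right (10 * n + 20) hKc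
      have e2 := Nat.mul_le_mul_right (40 * n + 40 + 7 * listOffset L n) hKc
      have e3 : 2 * distToClique G * (50 * n + 60 + 7 * listOffset L n) =
        2 * distToClique G * (10 * n + 20) +
        2 * distToClique G * (40 * n + 40 + 7 * listOffset L n) := by ring
      omega
    · by_cases hu : u ∈ K
      · exact (h3 u hu v).1
      · by_cases hv : v ∈ K
        · rw [SimpleGraph.dist_comm]
          exact (h3 v hv u).1
        · by_cases huv : u = v
          · simp [huv]
          · have hn : 1 < n := by
              have := u.2
              have := v.2
              have : (u : ℕ) ≠ v := fun h => huv (Fin.ext h)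
              omega
            rw [if_pos hn] at ha2
            rw [SimpleGraph.dist_eq_one_iff_adj.2 (hadj u v hu hv huv)]
            omega

end Imp

open WordRAM

theorem exists_program_distToClique : ∃ (p : Program) (k : ℕ) (C : ℝ),
    ∀ (n : ℕ) (G : SimpleGraph (Fin n)) [DecidableRel G.Adj] (L : Fin n → List (Fin n)),
      G.Connected → IsAdjLists G L → OutputsWithin p k (encodeGraph L) G.diam
        (C * (max 1 (distToClique G : ℝ) * ((n : ℝ) + (G.edgeFinset.card : ℝ)))) := by
  obtain ⟨p, k, κ, h⟩ := Imp.outputsWithin_of_big Imp.cliqueProg (by decide) 1000 2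
  refine ⟨p, k, κ * 1000, fun n G _ L hG hL => ?_⟩
  obtain ⟨t, σ, hbig, ht, hans⟩ := Imp.WP.cliqueProg hG hL
  have hlen := Imp.length_encodeGraph L
  have hn : 1 ≤ n := by
    obtain ⟨v⟩ := hG.nonempty
    exact v.pos
  -- The transfer to the word RAM asks for a running time polynomial in the input length, hence for
  -- a bound on the parameter itself.
  have hc : distToClique G ≤ n :=
    Nat.sInf_le ⟨Finset.univ, by ext ⟨v, hv⟩; simp at hv, by simp⟩
  rw [hL.listOffset_eq] at hlen ht
  rw [← hans]
  refine h _ t σ (by omega) (Imp.getD_le_of_forall fun m => Imp.le_of_mem_encodeGraph L)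
    (by rw [Imp.cells_encodeGraph]; omega) (by rw [Imp.cells_encodeGraph]) hbig ?_ _ ?_
  · rw [hlen]
    nlinarith [Nat.mul_le_mul_right (50 * n + 60 + 7 * (2 * G.edgeFinset.card)) hc]
  · rw [hlen]
    have : t + (n + 2 + 2 * G.edgeFinset.card) ≤
        1000 * (max 1 (distToClique G) * (n + G.edgeFinset.card)) := by
      have h1 : distToClique G * (n + G.edgeFinset.card) ≤
        max 1 (distToClique G) * (n + G.edgeFinset.card) := Nat.mul_le_mul_right _ (le_max_right _ _)
      have h2 : 1 * (n + G.edgeFinset.card) ≤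
        max 1 (distToClique G) * (n + G.edgeFinset.card) := Nat.mul_le_mul_right _ (le_max_left _ _)
      nlinarith [Nat.mul_le_mul_left (distToClique G) hn]
    calc (κ * (t + (n + 2 + 2 * G.edgeFinset.card) : ℕ) : ℝ)
        ≤ κ * (1000 * (max 1 (distToClique G) * (n + G.edgeFinset.card)) : ℕ) := by gcongr
      _ = _ := by push_cast; ring

/-! ### Distances in interval graphs -/

/-- On the set `C`, a union of components, the graph `H` is the intersection graph of the
intervals `[l v, r v]`. -/
structure IntervalOn {V : Type*} (H : SimpleGraph V) (C : Set V) (l r : V → ℝ) : Prop where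
  le : ∀ v ∈ C, l v ≤ r v
  adj : ∀ u ∈ C, ∀ v ∈ C, u ≠ v → (H.Adj u v ↔ l u ≤ r v ∧ l v ≤ r u)

namespace IntervalOn

variable {V : Type*} {H : SimpleGraph V} {C : Set V} {l r : V → ℝ}

/-- Reflection of the real line, so that only one of two symmetric positions of `x` and `y` has to
be treated. -/
theorem neg (h : IntervalOn H C l r) : IntervalOn H C (-r) (-l) where
  le v hv := neg_le_neg (h.le v hv)
  adj u hu v hv huv := by
    rw [h.adj u hu v hv huv, Pi.neg_apply, Pi.neg_apply, Pi.neg_apply, Pi.neg_apply, neg_le_neg_iff,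
      neg_le_neg_iff, and_comm]

theorem of_adj (h : IntervalOn H C l r) {u v : V} (hu : u ∈ C) (hv : v ∈ C) (huv : H.Adj u v) :
    l u ≤ r v ∧ l v ≤ r u := (h.adj u hu v hv huv.ne).1 huv

theorem lt_or_lt (h : IntervalOn H C l r) {u v : V} (hu : u ∈ C) (hv : v ∈ C) (hne : u ≠ v)
    (huv : ¬ H.Adj u v) : r u < l v ∨ r v < l u := by
  rw [h.adj u hu v hv hne] at huv
  by_contra hno
  push Not at hno
  exact huv ⟨hno.2, hno.1⟩

end IntervalOn

section FarVertex

variable {V : Type*} {H : SimpleGraph V} {C : Set V} {l r : V → ℝ} {x y : V} {D₁ D₂ : V → ℕ}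

/-- Beyond a vertex `y` farthest from `x` there are only vertices within distance `2` of `y`. -/
theorem level_le_of_beyond (hI : IntervalOn H C l r) (h₁ : IsLevel H {x} D₁)
    (hC₁ : ∀ v, v ∈ C ↔ D₁ v ≠ 0) (h₂ : IsLevel H {y} D₂)
    (hy : y ∈ C) (hmax : ∀ v, D₁ v ≤ D₁ y) (hxy : r x < l y) {v : V} (hv : v ∈ C)
    (hyv : r y < l v) : D₂ v ≤ 3 := by
  -- Predecessors lead from `v` back to `x`, which lies to the left of `y`. Consecutive intervals
  -- meet, so one vertex `p` on the way is `y` or has an interval that meets the one of `y`.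
  have key : ∀ (j : ℕ) (v : V), D₁ v = j → v ∈ C → l y ≤ r v →
      ∃ (p : V) (q : H.Walk p v), D₁ p + q.length ≤ D₁ v ∧ (p = y ∨ H.Adj y p) := by
    intro j
    induction j with
    | zero => intro v hj hv; exact absurd hj ((hC₁ v).1 hv)
    | succ j ih =>
      intro v hj hv hyv
      by_cases hvy : l v ≤ r y
      · refine ⟨v, .nil, by simp, ?_⟩
        by_cases hne : v = y
        · exact .inl hne
        · exact .inr ((hI.adj y hy v hv (Ne.symm hne)).2 ⟨hyv, hvy⟩)
      · have hvx : v ≠ x := by rintro rfl; linarith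
        have h1 : D₁ v ≠ 1 := fun h => hvx ((h₁.src v).1 h)
        obtain ⟨u, huv, hu⟩ := h₁.pred v (by have := (hC₁ v).1 hv; omega)
        have huC : u ∈ C := (hC₁ u).2 (h₁.closed _ _ huv.symm ((hC₁ v).1 hv)).1
        have := (hI.of_adj huC hv huv).2
        have hyy := hI.le y hy
        obtain ⟨p, q, hq, hp⟩ := ih u (by omega) huC (by linarith)
        exact ⟨p, q.concat huv, by simp only [SimpleGraph.Walk.length_concat]; omega, hp⟩
  have hyy := hI.le y hy
  have hvv := hI.le v hv
  obtain ⟨p, q, hq, hp⟩ := key _ v rfl hv (by linarith)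
  have hy1 : D₂ y = 1 := (h₂.src y).2 rfl
  -- If `p` is adjacent to `y`, then `D₁ p + 1 ≥ D₁ y ≥ D₁ v`, so the walk from `p` to `v` has
  -- length at most `1`. Together with the edge from `y` to `p` this is distance at most `2`, that
  -- is, level at most `3`.
  rcases hp with rfl | hp
  · have := (h₂.le_of_walk q (by omega)).2
    have := hmax v
    omega
  · have h3 := (h₂.le_of_walk (.cons hp q) (by omega)).2
    have hpC : p ∈ C := (hC₁ p).2 (h₁.closed _ _ hp ((hC₁ y).1 hy)).1
    have h4 := (h₁.closed _ _ hp.symm ((hC₁ p).1 hpC)).2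
    have := hmax v
    simp only [SimpleGraph.Walk.length_cons] at h3
    omega

/-- The last level of a search from an end is an end segment. -/
theorem right_lt_of_level_lt (hI : IntervalOn H C l r) (h₂ : IsLevel H {y} D₂)
    (hC₂ : ∀ v, v ∈ C ↔ D₂ v ≠ 0) {q : V} (hq : q ∈ C) (hqy : r q < l y) {v : V} (hv : v ∈ C)
    (hvq : D₂ v < D₂ q) : r q < r v := by
  have key : ∀ (j : ℕ) (v : V), D₂ v = j → v ∈ C → D₂ v < D₂ q → r q < r v := by
    intro j
    induction j with
    | zero => intro v hj hv; exact absurd hj ((hC₂ v).1 hv)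
    | succ j ih =>
      intro v hj hv hvq
      by_cases h1 : D₂ v = 1
      · obtain rfl : v = y := (h₂.src v).1 h1
        exact hqy.trans_le (hI.le v hv)
      · obtain ⟨p, hpv, hp⟩ := h₂.pred v (by have := (hC₂ v).1 hv; omega)
        have hpC : p ∈ C := (hC₂ p).2 (h₂.closed _ _ hpv.symm ((hC₂ v).1 hv)).1
        -- The predecessor `p` of `v` is at least two levels before `q`, so the two are not
        -- adjacent, and by induction `q` lies entirely to the left of `p`. As `v` meets `p`, it
        -- ends to the right of `q`.
        have hrp := ih p (by omega) hpC (by omega)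
        have hnadj : ¬ H.Adj p q := fun h => by
          have := (h₂.closed _ _ h ((hC₂ p).1 hpC)).2
          omega
        have hne : p ≠ q := by rintro rfl; omega
        rcases hI.lt_or_lt hpC hq hne hnadj with h | h
        · have := hI.le q hq
          linarith
        · exact h.trans_le (hI.of_adj hpC hv hpv).1
  exact key _ v rfl hv hvq

/-- `Q` is an end segment of an interval graph. -/
structure IsEnd (H : SimpleGraph V) (C Q : Set V) (l r : V → ℝ) : Prop where
  interval : IntervalOn H C l r
  lt : ∀ q ∈ Q, ∀ v ∈ C, v ∉ Q → r q < r v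
  common : ∃ z ∈ C, z ∉ Q ∧ ∀ q ∈ Q, H.Adj z q

/-- Level `k ≥ 4` means distance at least `3` from `y`. By `level_le_of_beyond` such vertices do not
lie to the right of `y`, so they lie to its left, and `right_lt_of_level_lt` makes the last level an
end segment. -/
theorem isEnd_of_lt [Finite V] (hI : IntervalOn H C l r) (h₁ : IsLevel H {x} D₁)
    (hC₁ : ∀ v, v ∈ C ↔ D₁ v ≠ 0) (h₂ : IsLevel H {y} D₂) (hC₂ : ∀ v, v ∈ C ↔ D₂ v ≠ 0)
    (hy : y ∈ C) (hmax : ∀ v, D₁ v ≤ D₁ y) (hxy : r x < l y) {k : ℕ} (hk : 4 ≤ k)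
    (hk2 : ∀ v, D₂ v ≤ k) (hex : ∃ v, D₂ v = k) : IsEnd H C {v | D₂ v = k} l r := by
  have hQC : ∀ {q}, D₂ q = k → q ∈ C := fun hq => (hC₂ _).2 (by omega)
  have hlt : ∀ q, D₂ q = k → r q < l y := by
    intro q hq
    have hne : y ≠ q := by
      rintro rfl
      have := (h₂.src y).2 rfl
      omega
    have hnadj : ¬ H.Adj y q := fun h => by
      have h0 := (h₂.src y).2 rfl
      have := (h₂.closed _ _ h (by omega)).2
      omega
    rcases hI.lt_or_lt hy (hQC hq) hne hnadj with h | h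
    · have := level_le_of_beyond hI h₁ hC₁ h₂ hy hmax hxy (hQC hq) h
      omega
    · exact h
  have hQ1 : ∀ q, D₂ q = k → ∀ v ∈ C, D₂ v ≠ k → r q < r v := fun q hq v hv hvk =>
    right_lt_of_level_lt hI h₂ hC₂ (hQC hq) (hlt q hq) hv (by have := hk2 v; omega)
  refine ⟨hI, hQ1, ?_⟩
  obtain ⟨q₀, hq₀⟩ := hex
  obtain ⟨p₀, -, hp₀⟩ := h₂.pred q₀ (by omega)
  -- The vertex of the last but one level that reaches farthest to the left is a common neighbour: a
  -- predecessor of `q` starts no further left than `z` and still meets `q`, and `z` ends to the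
  -- right of `q`.
  obtain ⟨z, hz, hzmin⟩ := Set.exists_min_image {v | D₂ v + 1 = k} l (Set.toFinite _)
    ⟨p₀, by simp only [Set.mem_ofPred_eq]; omega⟩
  simp only [Set.mem_ofPred_eq] at hz hzmin
  have hzC : z ∈ C := (hC₂ z).2 (by omega)
  refine ⟨z, hzC, fun h => by simp only [Set.mem_ofPred_eq] at h; omega, fun q hq => ?_⟩
  simp only [Set.mem_ofPred_eq] at hq
  obtain ⟨p, hpq, hp⟩ := h₂.pred q (by omega)
  have hpC : p ∈ C := (hC₂ p).2 (by omega)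
  have hne : z ≠ q := by rintro rfl; omega
  rw [hI.adj z hzC q (hQC hq) hne]
  have := (hI.of_adj hpC (hQC hq) hpq).1
  have := hzmin p (by omega)
  have := hQ1 q hq z hzC (by omega)
  have := hI.le q (hQC hq)
  constructor <;> linarith

/-- If all vertices were within distance `1` of `x`, the eccentricity of `y` would be at most `2`.
So `x` and `y` are nonadjacent, their intervals are disjoint, and up to reflection `x` is on the
left. -/
theorem exists_isEnd [Finite V] (hI : IntervalOn H C l r) (h₁ : IsLevel H {x} D₁)
    (hC₁ : ∀ v, v ∈ C ↔ D₁ v ≠ 0) (h₂ : IsLevel H {y} D₂) (hC₂ : ∀ v, v ∈ C ↔ D₂ v ≠ 0)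
    (hmax : ∀ v, D₁ v ≤ D₁ y) {k : ℕ} (hk : 4 ≤ k)
    (hk2 : ∀ v, D₂ v ≤ k) (hex : ∃ v, D₂ v = k) :
    ∃ l' r' : V → ℝ, IsEnd H C {v | D₂ v = k} l' r' := by
  have hx1 : D₁ x = 1 := (h₁.src x).2 rfl
  have hy1 : D₂ y = 1 := (h₂.src y).2 rfl
  have hx : x ∈ C := (hC₁ x).2 (by omega)
  have hy : y ∈ C := (hC₂ y).2 (by omega)
  have h3 : 3 ≤ D₁ y := by
    by_contra hlt
    obtain ⟨v, hv⟩ := hex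
    have hvC : v ∈ C := (hC₂ v).2 (by omega)
    have hle : ∀ w ∈ C, H.dist x w ≤ 1 := fun w hw => by
      have := h₁.eq_dist (h₁.ne_zero_iff.1 ((hC₁ w).1 hw))
      have := hmax w
      omega
    have hr : H.Reachable y v := h₂.ne_zero_iff.1 ((hC₂ v).1 hvC)
    have hrx : H.Reachable x y := h₁.ne_zero_iff.1 ((hC₁ y).1 hy)
    have h4 := h₂.eq_dist hr
    have h5 := hrx.symm.dist_triangle_left v
    have h6 := hle y hy
    have h7 := hle v hvC
    rw [SimpleGraph.dist_comm] at h6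
    omega
  have hne : x ≠ y := by rintro rfl; omega
  have hnadj : ¬ H.Adj x y := fun h => by
    have := (h₁.closed _ _ h (by omega)).2
    omega
  rcases hI.lt_or_lt hx hy hne hnadj with h | h
  · exact ⟨l, r, isEnd_of_lt hI h₁ hC₁ h₂ hC₂ hy hmax h hk hk2 hex⟩
  · exact ⟨-r, -l, isEnd_of_lt hI.neg h₁ hC₁ h₂ hC₂ hy hmax (by simpa using h) hk hk2 hex⟩

/-- Here `x` and `y` have distance `2`, and all vertices are within distance `2` of each of them.
Among the common neighbours of `x` and `y`, the one whose interval starts farthest to the left is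
adjacent to everything. -/
theorem exists_universal_of_lt [Finite V] (hI : IntervalOn H C l r) (h₁ : IsLevel H {x} D₁)
    (hC₁ : ∀ v, v ∈ C ↔ D₁ v ≠ 0) (h₂ : IsLevel H {y} D₂) (hC₂ : ∀ v, v ∈ C ↔ D₂ v ≠ 0)
    (hmax : ∀ v, D₁ v ≤ D₁ y)
    (hmin : ∀ v, D₁ v = D₁ y →
      ¬ {w | H.Adj v w ∧ D₁ w + 1 = D₁ y} ⊂ {w | H.Adj y w ∧ D₁ w + 1 = D₁ y})
    (hD₂ : ∀ v, D₂ v ≤ 3) (hxy : r x < l y) : ∃ a ∈ C, ∀ v ∈ C, v ≠ a → H.Adj a v := by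
  have hx1 : D₁ x = 1 := (h₁.src x).2 rfl
  have hy1 : D₂ y = 1 := (h₂.src y).2 rfl
  have hx : x ∈ C := (hC₁ x).2 (by omega)
  have hy : y ∈ C := (hC₂ y).2 (by omega)
  have hxx := hI.le x hx
  have hyy := hI.le y hy
  have hxy' : ¬ H.Adj x y := fun h => by
    have := (hI.of_adj hx hy h).2
    linarith
  have hne : x ≠ y := by rintro rfl; linarith
  have h3 : D₁ y = 3 := by
    have hr : H.Reachable x y := h₁.ne_zero_iff.1 ((hC₁ y).1 hy)
    have e1 := h₁.eq_dist hr
    have e2 := h₂.eq_dist hr.symm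
    rw [SimpleGraph.dist_comm] at e2
    have := hD₂ x
    have := hr.one_lt_dist_of_ne_of_not_adj hne hxy'
    omega
  have hadjx : ∀ w, D₁ w = 2 → H.Adj x w := fun w hw => by
    obtain ⟨u, huw, hu⟩ := h₁.pred w (by omega)
    obtain rfl : u = x := (h₁.src u).1 (by omega)
    exact huw
  rw [h3] at hmin
  obtain ⟨a₀, ha₀, ha₀'⟩ := h₁.pred y (by omega)
  obtain ⟨a, ⟨hay, ha2⟩, hamin⟩ := Set.exists_min_image {w | H.Adj y w ∧ D₁ w = 2} l (Set.toFinite _)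
    ⟨a₀, ha₀.symm, by omega⟩
  have haC : a ∈ C := (hC₁ a).2 (by omega)
  have hax := hI.of_adj hx haC (hadjx a ha2)
  have hay' := hI.of_adj hy haC hay
  refine ⟨a, haC, fun v hv hva => ?_⟩
  by_contra hnadj
  have hvv := hI.le v hv
  rcases hI.lt_or_lt haC hv (Ne.symm hva) hnadj with h | h
  -- A vertex `v` to the right of `a` is also at distance `2` from `x`. Each common neighbour of `x`
  -- and `v` spans the gap and meets `y`, while `a` meets `y` but not `v`. This contradicts the
  -- minimality of `y`.
  · have hvx : v ≠ x := by rintro rfl; linarith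
    have hvx' : ¬ H.Adj x v := fun h' => by
      have := (hI.of_adj hx hv h').2
      linarith
    have hv3 : D₁ v = 3 := by
      have hr : H.Reachable x v := h₁.ne_zero_iff.1 ((hC₁ v).1 hv)
      have e1 := h₁.eq_dist hr
      have := hr.one_lt_dist_of_ne_of_not_adj hvx.symm hvx'
      have := hmax v
      omega
    refine hmin v (by omega) ⟨fun w hw => ?_, fun hsub => ?_⟩
    · obtain ⟨hvw, hw2⟩ := hw
      have hwC : w ∈ C := (hC₁ w).2 (by omega)
      have e1 := hI.of_adj hx hwC (hadjx w (by omega))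
      have e2 := hI.of_adj hv hwC hvw
      refine ⟨?_, hw2⟩
      rw [hI.adj y hy w hwC (by rintro rfl; omega)]
      constructor <;> linarith
    · exact hnadj (hsub ⟨hay, by omega⟩).1.symm
  -- A vertex `v` to the left of `a` is not adjacent to `y`, so they have a common neighbour `b`. It
  -- is adjacent to `x` as well and starts to the left of `a`, contrary to the choice of `a`.
  · have hvy : y ≠ v := by rintro rfl; linarith
    have hvy' : ¬ H.Adj y v := fun h' => by
      have := (hI.of_adj hy hv h').1
      linarith
    have h1v : D₂ v ≠ 1 := fun h' => hvy ((h₂.src v).1 h').symm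
    obtain ⟨b, hbv, hb⟩ := h₂.pred v (by have := (hC₂ v).1 hv; omega)
    have hbC : b ∈ C := (hC₂ b).2 (h₂.closed _ _ hbv.symm ((hC₂ v).1 hv)).1
    have hb2 : D₂ b = 2 := by
      have : D₂ b ≠ 1 := fun h' => by
        obtain rfl : b = y := (h₂.src b).1 h'
        exact hvy' hbv
      have := hD₂ v
      have := (hC₂ b).1 hbC
      omega
    have hby : H.Adj y b := by
      obtain ⟨u, hub, hu⟩ := h₂.pred b (by omega)
      obtain rfl : u = y := (h₂.src u).1 (by omega)
      exact hub
    have e1 := hI.of_adj hbC hv hbv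
    have e2 := hI.of_adj hy hbC hby
    have hxb : H.Adj x b := by
      rw [hI.adj x hx b hbC (by rintro rfl; exact hxy' hby.symm)]
      constructor <;> linarith
    have hb1 : D₁ b = 2 := by
      have := (h₁.closed _ _ hxb (by omega)).2
      have : D₁ b ≠ 1 := fun h' => hxb.ne ((h₁.src b).1 h').symm
      have := (hC₁ b).1 hbC
      omega
    have := hamin b ⟨hby, hb1⟩
    linarith

/-- If the vertex `y`, farthest from `x`, has eccentricity at most `2`, then all distances are at
most `2`. -/
theorem exists_common_neighbor [Finite V] (hI : IntervalOn H C l r) (h₁ : IsLevel H {x} D₁)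
    (hC₁ : ∀ v, v ∈ C ↔ D₁ v ≠ 0) (h₂ : IsLevel H {y} D₂) (hC₂ : ∀ v, v ∈ C ↔ D₂ v ≠ 0)
    (hmax : ∀ v, D₁ v ≤ D₁ y)
    (hmin : ∀ v, D₁ v = D₁ y →
      ¬ {w | H.Adj v w ∧ D₁ w + 1 = D₁ y} ⊂ {w | H.Adj y w ∧ D₁ w + 1 = D₁ y})
    (hD₂ : ∀ v, D₂ v ≤ 3) {u v : V} (hu : u ∈ C) (hv : v ∈ C) (huv : u ≠ v) (hadj : ¬ H.Adj u v) :
    ∃ a, H.Adj u a ∧ H.Adj a v := by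
  have key : ∃ a ∈ C, ∀ v ∈ C, v ≠ a → H.Adj a v := by
    have hx1 : D₁ x = 1 := (h₁.src x).2 rfl
    have hy1 : D₂ y = 1 := (h₂.src y).2 rfl
    have hx : x ∈ C := (hC₁ x).2 (by omega)
    have hy : y ∈ C := (hC₂ y).2 (by omega)
    by_cases h3 : 3 ≤ D₁ y
    · have hne : x ≠ y := by rintro rfl; omega
      have hnadj : ¬ H.Adj x y := fun h => by
        have := (h₁.closed _ _ h (by omega)).2
        omega
      rcases hI.lt_or_lt hx hy hne hnadj with h | h
      · exact exists_universal_of_lt hI h₁ hC₁ h₂ hC₂ hmax hmin hD₂ h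
      · exact exists_universal_of_lt hI.neg h₁ hC₁ h₂ hC₂ hmax hmin hD₂ (by simpa using h)
    -- Now every vertex has level at most `2` in the search from `x`, so `x` itself is adjacent to
    -- all others.
    · refine ⟨x, hx, fun v hv hvx => ?_⟩
      have h1 : D₁ v ≠ 1 := fun h => hvx ((h₁.src v).1 h)
      have h2 := hmax v
      obtain ⟨u, huv, hu⟩ := h₁.pred v (by have := (hC₁ v).1 hv; omega)
      obtain rfl : u = x := (h₁.src u).1 (by
        have := (hC₁ u).2 (h₁.closed _ _ huv.symm ((hC₁ v).1 hv)).1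
        have := (hC₁ u).1 this
        omega)
      exact huv
  obtain ⟨a, ha, hall⟩ := key
  have hua : u ≠ a := by rintro rfl; exact hadj (hall v hv huv.symm)
  have hva : v ≠ a := by rintro rfl; exact hadj (hall u hu huv).symm
  exact ⟨a, (hall u hu hua).symm, hall v hv hva⟩

end FarVertex

/-! ### Levels above an end segment -/

/-- The combinatorial properties of the levels of an interval graph above an end segment. -/
structure IsLadder {V : Type*} (H : SimpleGraph V) (D : V → ℕ) : Prop where
  pred : ∀ v, 2 ≤ D v → ∃ u, H.Adj u v ∧ D v = D u + 1
  closed : ∀ u w, H.Adj u w → D u ≠ 0 → D w ≠ 0 ∧ D w ≤ D u + 1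
  chain : ∀ u u', D u ≠ 0 → D u = D u' → (∀ w, D w = D u + 1 → H.Adj u w → H.Adj u' w) ∨
    ∀ w, D w = D u + 1 → H.Adj u' w → H.Adj u w
  top : ∀ u, D u ≠ 0 → ∃ z, D z = D u ∧ (∀ w, D w = D u + 1 → H.Adj z w) ∧
    ∀ u' w, 2 ≤ D u → D u' = D u → H.Adj u' w → D w = D u + 1 → u' = z ∨ H.Adj u' z
  clique : ∀ v w, D v = 2 → D w = 2 → v ≠ w → H.Adj v w
  common : ∃ z, D z = 2 ∧ ∀ v, D v = 1 → H.Adj z v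

/-- Vertices that are at least two levels apart lie strictly in order on the line (`K2`), and a
lower vertex never lies entirely to the right of a higher one (`K1`). Adjacency of `u` to `w` in the
next level therefore reduces to `l w ≤ r u`. Upper neighbourhoods are thus ordered by right ends,
and the top vertex of a level is one with the largest right end. Level `2` is a clique because each
of its intervals starts before the end of some source, and all of them end after every source. -/
theorem IsEnd.isLadder {V : Type*} [Finite V] {H : SimpleGraph V} {C Q : Set V} {l r : V → ℝ}
    {D : V → ℕ} (hE : IsEnd H C Q l r) (h : IsLevel H Q D) (hC : ∀ v, v ∈ C ↔ D v ≠ 0) :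
    IsLadder H D := by
  obtain ⟨hI, hlt, z₀, hz₀, hz₀Q, hz₀a⟩ := hE
  have hmemC : ∀ {v : V}, D v ≠ 0 → v ∈ C := fun hv => (hC _).2 hv
  have not_adj : ∀ {u v : V}, D u ≠ 0 → D u + 2 ≤ D v → ¬ H.Adj u v := fun hu huv hadj => by
    have := (h.closed _ _ hadj hu).2
    omega
  -- a vertex of lower level does not lie to the right of a vertex of higher level
  have K : ∀ (j : ℕ) (u v : V), D u = j + 1 → D u < D v → l u ≤ r v := by
    intro j
    induction j with
    | zero =>
      intro u v hu huv
      have huQ := (h.src u).1 hu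
      have hvQ : v ∉ Q := fun hv => by
        have := (h.src v).2 hv
        omega
      have := hlt u huQ v (hmemC (by omega)) hvQ
      have := hI.le u (hmemC (by omega))
      linarith
    | succ j ih =>
      intro u v hu huv
      obtain ⟨p, hpu, hp⟩ := h.pred u (by omega)
      have h1 := (hI.of_adj (hmemC (by omega)) (hmemC (by omega)) hpu).2
      have h2 := ih p v (by omega) (by omega)
      have hne : p ≠ v := by rintro rfl; omega
      rcases hI.lt_or_lt (hmemC (by omega)) (hmemC (by omega)) hne
        (not_adj (u := p) (v := v) (by omega) (by omega)) with h3 | h3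
      · have := hI.le v (hmemC (by omega))
        linarith
      · linarith
  have K1 : ∀ u v : V, D u ≠ 0 → D u < D v → l u ≤ r v := fun u v hu huv =>
    K (D u - 1) u v (by omega) huv
  have K2 : ∀ u v : V, D u ≠ 0 → D u + 2 ≤ D v → r u < l v := fun u v hu huv => by
    have hne : u ≠ v := by rintro rfl; omega
    rcases hI.lt_or_lt (hmemC hu) (hmemC (by omega)) hne (not_adj hu huv) with h3 | h3
    · exact h3
    · have := K1 u v hu (by omega)
      linarith
  have adj_up : ∀ u w : V, D u ≠ 0 → D w = D u + 1 → (H.Adj u w ↔ l w ≤ r u) := fun u w hu hw => by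
    rw [hI.adj u (hmemC hu) w (hmemC (by omega)) (by rintro rfl; omega)]
    exact and_iff_right (K1 u w hu (by omega))
  have hz₀2 : D z₀ = 2 := by
    have h0 := (hC z₀).1 hz₀
    have h1 : D z₀ ≠ 1 := fun h' => hz₀Q ((h.src _).1 h')
    by_contra hne
    have : ∃ q ∈ Q, True := by
      obtain ⟨q, hq, -⟩ := h.exists_walk (v := z₀) (j := D z₀ - 1) (by omega)
      exact ⟨q, hq, trivial⟩
    obtain ⟨q, hq, -⟩ := this
    have e1 := (h.src q).2 hq
    have := (h.closed _ _ (hz₀a q hq).symm (by omega)).2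
    omega
  refine ⟨h.pred, h.closed, ?_, ?_, ?_, z₀, hz₀2, fun v hv => hz₀a v ((h.src v).1 hv)⟩
  · intro u u' hu huu'
    rcases le_total (r u) (r u') with hle | hle
    · left
      intro w hw huw
      rw [adj_up u w hu hw] at huw
      rw [adj_up u' w (by omega) (by omega)]
      exact huw.trans hle
    · right
      intro w hw huw
      rw [adj_up u' w (by omega) (by omega)] at huw
      rw [adj_up u w hu hw]
      exact huw.trans hle
  · intro u hu
    obtain ⟨z, hz, hzmax⟩ := Set.exists_max_image {v | D v = D u} r (Set.toFinite _) ⟨u, rfl⟩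
    simp only [Set.mem_ofPred_eq] at hz hzmax
    refine ⟨z, hz, fun w hw => ?_, fun u' w hu2 hu' huw hw => ?_⟩
    · obtain ⟨p, hpw, hp⟩ := h.pred w (by omega)
      rw [adj_up p w (by omega) hp] at hpw
      rw [adj_up z w (by omega) (by omega)]
      exact hpw.trans (hzmax p (by omega))
    · rw [adj_up u' w (by omega) (by omega)] at huw
      rw [or_iff_not_imp_left]
      intro hne
      rw [hI.adj u' (hmemC (by omega)) z (hmemC (by omega)) hne]
      -- A predecessor of `v` is two levels before `w` and so ends before `w` starts. Hence all
      -- intervals of the level of `u` start before `w`, and two of them that reach `w` intersect.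
      have hback : ∀ v, D v = D u → l v < l w := fun v hv => by
        obtain ⟨p, hpv, hp⟩ := h.pred v (by omega)
        have e1 := (hI.of_adj (hmemC (by omega)) (hmemC (by omega)) hpv).2
        exact e1.trans_lt (K2 p w (by omega) (by omega))
      have e1 := hback u' hu'
      have e2 := hback z hz
      have e3 := hzmax u' hu'
      constructor <;> linarith
  · intro v w hv hw hvw
    rw [hI.adj v (hmemC (by omega)) w (hmemC (by omega)) hvw]
    have key : ∀ v w, D v = 2 → D w = 2 → l v ≤ r w := fun v w hv hw => by
      obtain ⟨p, hpv, hp⟩ := h.pred v (by omega)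
      have e1 := (hI.of_adj (hmemC (by omega)) (hmemC (by omega)) hpv).2
      have hwQ : w ∉ Q := fun hw' => by
        have := (h.src w).2 hw'
        omega
      have := hlt p ((h.src p).1 (by omega)) w (hmemC (by omega)) hwQ
      linarith
    exact ⟨key v w hv hw, key w v hw hv⟩

namespace IsLadder

variable {V : Type*} {H : SimpleGraph V} {D : V → ℕ}

/-- There is a walk of length `j` from `u` to `v` with increasing levels. -/
def Climb (H : SimpleGraph V) (D : V → ℕ) : ℕ → V → V → Prop
  | 0, u, v => u = v
  | j + 1, u, v => ∃ w, H.Adj u w ∧ D w = D u + 1 ∧ Climb H D j w v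

/-- All upper neighbours of `u` are neighbours of `u'`. -/
def UpLE (H : SimpleGraph V) (D : V → ℕ) (u u' : V) : Prop :=
  ∀ w, D w = D u + 1 → H.Adj u w → H.Adj u' w

theorem Climb.exists_walk {j : ℕ} : ∀ {u v : V}, Climb H D j u v → ∃ p : H.Walk u v, p.length = j := by
  induction j with
  | zero => rintro u v rfl; exact ⟨.nil, rfl⟩
  | succ j ih =>
    rintro u v ⟨w, huw, -, h⟩
    obtain ⟨p, hp⟩ := ih h
    exact ⟨.cons huw p, by simp [hp]⟩

theorem Climb.mono {j : ℕ} {u u' v : V} (h : Climb H D (j + 1) u v) (hle : UpLE H D u u')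
    (hD : D u = D u') : Climb H D (j + 1) u' v := by
  obtain ⟨w, huw, hw, h⟩ := h
  exact ⟨w, hle w hw huw, by omega, h⟩

theorem Climb.snoc {j : ℕ} : ∀ {u v w : V}, Climb H D j u v → H.Adj v w → D w = D v + 1 →
    Climb H D (j + 1) u w := by
  induction j with
  | zero => rintro u v w rfl hvw hw; exact ⟨w, hvw, hw, rfl⟩
  | succ j ih =>
    rintro u v w ⟨x, hux, hx, h⟩ hvw hw
    exact ⟨x, hux, hx, ih h hvw hw⟩

theorem exists_climb (h : IsLadder H D) {i : ℕ} (hi : i ≠ 0) : ∀ {j : ℕ} {v : V}, D v = i + j →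
    ∃ u, D u = i ∧ Climb H D j u v := by
  intro j
  induction j with
  | zero => exact fun {v} hv => ⟨v, hv, rfl⟩
  | succ j ih =>
    intro v hv
    obtain ⟨p, hpv, hp⟩ := h.pred v (by omega)
    obtain ⟨u, hu, hc⟩ := ih (v := p) (by omega)
    exact ⟨u, hu, hc.snoc hpv hp⟩

/-- Iterated choice of best upper neighbours decides whether `v` can be reached by climbing. -/
theorem climb_iff {n : ℕ} {H : SimpleGraph (Fin n)} {D : Fin n → ℕ} {f : ℕ → ℕ} (hn : f n = n)
    (hf : ∀ u : Fin n, D u ≠ 0 → (f u = n ∧ ∀ w, H.Adj u w → D w ≠ D u + 1) ∨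
      ∃ w : Fin n, f u = w ∧ H.Adj u w ∧ D w = D u + 1 ∧
        ∀ w', H.Adj u w' → D w' = D u + 1 → UpLE H D w' w) :
    ∀ {j : ℕ} {u v : Fin n}, D u ≠ 0 → (Climb H D (j + 1) u v ↔
      ∃ p : Fin n, f^[j] u = p ∧ H.Adj p v ∧ D v = D p + 1) := by
  intro j
  induction j with
  | zero =>
    intro u v hu
    simp only [Climb, Function.iterate_zero, id_eq]
    constructor
    · rintro ⟨w, h1, h2, rfl⟩
      exact ⟨u, rfl, h1, h2⟩
    · rintro ⟨p, hp, h1, h2⟩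
      obtain rfl := Fin.ext hp
      exact ⟨v, h1, h2, rfl⟩
  | succ j ih =>
    intro u v hu
    rw [Function.iterate_succ_apply]
    -- The value `n` stands for a missing upper neighbour; it is fixed by `f` and never a vertex
    -- again. Otherwise an exchange argument applies: the first step of any climb may be replaced by
    -- the best upper neighbour.
    rcases hf u hu with ⟨hfu, hno⟩ | ⟨w, hfu, huw, hw, hbest⟩
    · rw [hfu, Function.iterate_fixed hn]
      constructor
      · rintro ⟨w, h1, h2, -⟩
        exact absurd h2 (hno w h1)
      · rintro ⟨p, h, -⟩
        have := p.2
        omega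
    · rw [hfu, ← ih (u := w) (by omega)]
      constructor
      · rintro ⟨w', h1, h2, h3⟩
        exact h3.mono (hbest w' h1 h2) (by omega)
      · exact fun h3 => ⟨w, huw, hw, h3⟩

/-- Vertices with more upper neighbours are better. -/
theorem upLE_of_card_le [Fintype V] [DecidableRel H.Adj] (h : IsLadder H D) {u u' : V}
    (hu : D u ≠ 0) (huu' : D u = D u')
    (hc : (Finset.univ.filter fun w => H.Adj u w ∧ D w = D u + 1).card ≤
      (Finset.univ.filter fun w => H.Adj u' w ∧ D w = D u' + 1).card) : UpLE H D u u' := by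
  rcases h.chain u u' hu huu' with h1 | h1
  · exact h1
  · have hsub : (Finset.univ.filter fun w => H.Adj u' w ∧ D w = D u' + 1) ⊆
        Finset.univ.filter fun w => H.Adj u w ∧ D w = D u + 1 := fun w hw => by
      simp only [Finset.mem_filter, Finset.mem_univ, true_and] at hw ⊢
      exact ⟨h1 w (by omega) hw.1, by omega⟩
    have := Finset.eq_of_subset_of_card_le hsub hc
    intro w hw huw
    have hmem : w ∈ Finset.univ.filter fun w => H.Adj u w ∧ D w = D u + 1 := by simp [huw, hw]
    rw [← this] at hmem
    exact (Finset.mem_filter.1 hmem).2.1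

variable {u g v : V} {j : ℕ}

/-- The best neighbour in the same level can climb to everything if there is an upper neighbour. -/
theorem climb_of_up (h : IsLadder H D) (hu : 2 ≤ D u)
    (hg3 : ∀ w, w = u ∨ H.Adj u w → D w = D u → UpLE H D w g) (hg1 : D g = D u)
    {w : V} (huw : H.Adj u w) (hw : D w = D u + 1) (hv : D v = D u + (j + 1)) :
    Climb H D (j + 1) g v := by
  -- A vertex of level at least `2` with an upper neighbour equals or is adjacent to the top vertex
  -- `z` of its level. From `z` one can climb to every vertex above, and `g` is at least as good as
  -- `z`.
  obtain ⟨z, hz, hzall, hzu⟩ := h.top u (by omega)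
  obtain ⟨p, hp, hc⟩ := h.exists_climb (i := D u) (by omega) hv
  have hpz : UpLE H D p z := fun w' hw' _ => hzall w' (by omega)
  have hz' : z = u ∨ H.Adj u z := (hzu u w hu rfl huw hw).imp_left Eq.symm
  exact (hc.mono hpz (by omega)).mono (hg3 z hz' hz) (by omega)

/-- Levels change by at most one per edge. A first step within the level loses one edge, and a climb
from its end would be one from `g u` too; a first step downwards loses two edges. A first step
upwards from level at least `2` is possible only if `g u` climbs to `v`, which the strongest of the
three bounds excludes. The three bounds need each other in the induction. -/
theorem length_ge (h : IsLadder H D) {g : V → V}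
    (hg1 : ∀ u, D u ≠ 0 → D (g u) = D u)
    (hg3 : ∀ u w, D u ≠ 0 → w = u ∨ H.Adj u w → D w = D u → UpLE H D w (g u))
    {u v : V} (p : H.Walk u v) : ∀ j, D u ≠ 0 → D v = D u + (j + 1) →
      (¬ Climb H D (j + 1) u v → j + 2 ≤ p.length) ∧
      (¬ Climb H D (j + 1) u v → 2 ≤ D u → ¬ Climb H D (j + 1) (g u) v → j + 3 ≤ p.length) ∧
      j + 1 ≤ p.length := by
  induction p with
  | nil => intro j _ hv; omega
  | @cons u w v huw p ih =>
    intro j hu hv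
    simp only [SimpleGraph.Walk.length_cons]
    obtain ⟨hw0, hwle⟩ := h.closed _ _ huw hu
    have hule := (h.closed _ _ huw.symm hw0).2
    by_cases hwv : D w < D v
    · obtain ⟨i, hi⟩ : ∃ i, D v = D w + (i + 1) := ⟨D v - D w - 1, by omega⟩
      obtain ⟨h1, h2, h3⟩ := ih i hw0 hi
      by_cases hup : D w = D u + 1
      · obtain rfl : j = i + 1 := by omega
        refine ⟨fun hc => ?_, fun hc hu2 hcg => ?_, by omega⟩
        · have := h1 fun hcw => hc ⟨w, huw, hup, hcw⟩
          omega
        · exact absurd (h.climb_of_up hu2 (hg3 u · hu) (hg1 u hu) huw hup hv) hcg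
      · by_cases heq : D w = D u
        · obtain rfl : i = j := by omega
          refine ⟨fun _ => by omega, fun hc hu2 hcg => ?_, by omega⟩
          have := h1 fun hcw => hcg (hcw.mono (hg3 u w hu (.inr huw) heq) (by rw [hg1 u hu, heq]))
          omega
        · obtain rfl : i = j + 1 := by omega
          exact ⟨fun _ => by omega, fun _ _ _ => by omega, by omega⟩
    · obtain rfl : j = 0 := by omega
      have hup : D w = D u + 1 := by omega
      have hlen : ¬ Climb H D (0 + 1) u v → 1 ≤ p.length := fun hc => by
        by_contra hlt
        have hwv : w = v := SimpleGraph.Walk.eq_of_length_eq_zero (p := p) (by omega)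
        exact hc ⟨w, huw, hup, hwv⟩
      exact ⟨fun hc => by have := hlen hc; omega,
        fun _ hu2 hcg => absurd (h.climb_of_up hu2 (hg3 u · hu) (hg1 u hu) huw hup hv) hcg,
        by omega⟩

/-- Distances between different levels. -/
theorem dist_eq (h : IsLadder H D) {g : V → V}
    (hg1 : ∀ u, D u ≠ 0 → D (g u) = D u) (hg2 : ∀ u, D u ≠ 0 → g u = u ∨ H.Adj u (g u))
    (hg3 : ∀ u w, D u ≠ 0 → w = u ∨ H.Adj u w → D w = D u → UpLE H D w (g u))
    {u v : V} {j : ℕ} (hu : D u ≠ 0) (hv : D v = D u + (j + 1)) :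
    H.Reachable u v ∧ (Climb H D (j + 1) u v → H.dist u v = j + 1) ∧
      (¬ Climb H D (j + 1) u v → D u = 1 ∨ Climb H D (j + 1) (g u) v → H.dist u v = j + 2) ∧
      (¬ Climb H D (j + 1) u v → ¬ (D u = 1 ∨ Climb H D (j + 1) (g u) v) → H.dist u v = j + 3) := by
  have upper : ∃ p : H.Walk u v, (Climb H D (j + 1) u v → p.length ≤ j + 1) ∧
      (D u = 1 ∨ Climb H D (j + 1) (g u) v → p.length ≤ j + 2) ∧ p.length ≤ j + 3 := by
    by_cases h1 : Climb H D (j + 1) u v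
    · obtain ⟨p, hp⟩ := h1.exists_walk
      exact ⟨p, fun _ => hp.le, fun _ => by omega, by omega⟩
    · by_cases h2 : D u = 1
      -- From level `1`, at most two edges lead through the common neighbour `z` to any vertex of
      -- level `2`, as that level is a clique. A climb of length `j` follows.
      · obtain ⟨z, hz, hzu⟩ := h.common
        obtain ⟨w, hw, hc⟩ := h.exists_climb (i := 2) (by omega) (j := j) (v := v) (by omega)
        obtain ⟨p, hp⟩ := hc.exists_walk
        by_cases hzw : z = w
        · subst hzw
          exact ⟨.cons (hzu u h2).symm p, fun h => absurd h h1, fun _ => by simp [hp],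
            by simp [hp]⟩
        · exact ⟨.cons (hzu u h2).symm (.cons (h.clique z w hz hw hzw) p), fun h => absurd h h1,
            fun _ => by simp [hp], by simp [hp]⟩
      · by_cases h3 : Climb H D (j + 1) (g u) v
        · have hne : g u ≠ u := fun he => h1 (he ▸ h3)
          obtain ⟨p, hp⟩ := h3.exists_walk
          exact ⟨.cons ((hg2 u hu).resolve_left hne) p, fun h => absurd h h1, fun _ => by simp [hp],
            by simp [hp]⟩
        -- The top vertex of the level below is adjacent to the whole level of `u`. Going down and
        -- up again leads in two edges to a vertex from which `v` can be climbed.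
        · obtain ⟨p, hpu, hp⟩ := h.pred u (by omega)
          obtain ⟨z, hz, hzall, -⟩ := h.top p (by omega)
          obtain ⟨w, hw, hc⟩ := h.exists_climb (i := D u) hu hv
          obtain ⟨q, hq⟩ := hc.exists_walk
          exact ⟨.cons (hzall u (by omega)).symm (.cons (hzall w (by omega)) q),
            fun h => absurd h h1, fun h => absurd h (by tauto), by simp [hq]⟩
  obtain ⟨p, hp1, hp2, hp3⟩ := upper
  have hr : H.Reachable u v := p.reachable
  obtain ⟨q, hq⟩ := hr.exists_walk_length_eq_dist
  obtain ⟨l1, l2, l3⟩ := h.length_ge hg1 hg3 q j hu hv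
  have hd := SimpleGraph.dist_le p
  refine ⟨hr, fun hc => ?_, fun hc hc' => ?_, fun hc hc' => ?_⟩
  · have := hp1 hc
    omega
  · have := hp2 hc'
    have := l1 hc
    omega
  · rw [not_or] at hc'
    have := l2 hc (by omega) hc'.2
    omega

/-- In level `1` the common neighbour of the sources serves, in higher levels the top vertex of the
level below. -/
theorem exists_common_neighbor (h : IsLadder H D) {u v : V} (hu : D u ≠ 0) (huv : D u = D v) :
    ∃ a, H.Adj u a ∧ H.Adj a v := by
  by_cases h1 : D u = 1
  · obtain ⟨z, -, hz⟩ := h.common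
    exact ⟨z, (hz u h1).symm, hz v (by omega)⟩
  · obtain ⟨p, -, hp⟩ := h.pred u (by omega)
    obtain ⟨z, -, hz, -⟩ := h.top p (by omega)
    exact ⟨z, (hz u (by omega)).symm, hz v (by omega)⟩

end IsLadder

namespace Imp

open Imp.Expr WordRAM

/-! ### Loops over all vertices -/

/-- A loop that computes the entries of an array one by one. -/
theorem WP.fillRel {n : ℕ} {L : Fin n → List (Fin n)} {x a : ℕ} {c : Cmd} {σ : St} (hin : Input L σ)
    (R : Fin n → ℕ → Prop) (cost : Fin n → ℕ) (hx : x ∉ c.vars ∧ vN ∉ c.vars ∧ x ≠ vN)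
    (hstep : ∀ (k : Fin n) σ', Frame (.for x (const 0) (var vN) c) σ σ' → σ'.v x = k →
      (∀ i : Fin n, k ≤ i → σ'.a a i = σ.a a i) →
      WP c σ' fun t σ'' => t ≤ cost k ∧ R k (σ''.a a k) ∧ ∀ i, i ≠ (k : ℕ) → σ''.a a i = σ'.a a i) :
    WP (.for x (const 0) (var vN) c) σ fun t σ' =>
      t ≤ ∑ k, (cost k + 2) + 2 ∧ (∀ v : Fin n, R v (σ'.a a v)) := by
  obtain ⟨hx1, hx2, hx3⟩ := hx
  refine (WP.for (fun k σ' => (∀ v : Fin n, (v : ℕ) < k → R v (σ'.a a v)) ∧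
    ∀ i : Fin n, k ≤ (i : ℕ) → σ'.a a i = σ.a a i)
    (fun k => if h : k < n then cost ⟨k, h⟩ else 0) 0 n rfl (Nat.zero_le n) hx1 ?_ ?_ ?_).mono ?_
  · exact fun σ' hF => (hF.v vN (by simp [Cmd.for, Cmd.vars, hx2, hx3.symm])).trans hin.size
  · exact ⟨fun v hv => by omega, fun i _ => rfl⟩
  · rintro k σ' - hk hF hv ⟨h1, h2⟩
    refine (hstep ⟨k, hk⟩ σ' hF hv fun i hi => h2 i hi).mono ?_
    rintro t σ'' - ⟨ht, h3, h4⟩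
    refine ⟨by simpa [hk] using ht, fun v hvk => ?_, fun i hi => ?_⟩
    · rw [St.setV_a]
      by_cases h : (v : ℕ) = k
      · rw [show v = ⟨k, hk⟩ from Fin.ext h]
        exact h3
      · rw [h4 v h]
        exact h1 v (by omega)
    · rw [St.setV_a, h4 i (by simp; omega)]
      exact h2 i (by omega)
  · rintro t σ' - ⟨ht, h1, -⟩
    refine ⟨ht.trans ?_, fun v => h1 v v.2⟩
    rw [← Finset.range_eq_Ico, Finset.sum_range]
    simp

theorem WP.fill {n : ℕ} {L : Fin n → List (Fin n)} {x a : ℕ} {c : Cmd} {σ : St} (hin : Input L σ)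
    (f cost : Fin n → ℕ) (hx : x ∉ c.vars ∧ vN ∉ c.vars ∧ x ≠ vN)
    (hstep : ∀ (k : Fin n) σ', Frame (.for x (const 0) (var vN) c) σ σ' → σ'.v x = k →
      (∀ i : Fin n, k ≤ i → σ'.a a i = σ.a a i) →
      WP c σ' fun t σ'' => t ≤ cost k ∧ σ''.a a k = f k ∧ ∀ i, i ≠ (k : ℕ) → σ''.a a i = σ'.a a i) :
    WP (.for x (const 0) (var vN) c) σ fun t σ' =>
      t ≤ ∑ k, (cost k + 2) + 2 ∧ (∀ v : Fin n, σ'.a a v = f v) :=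
  .fillRel hin (fun v m => m = f v) cost hx hstep

/-- `m := max_v a[v]`. -/
def maxArr (a m : ℕ) : Cmd :=
  .set m (const 0) ;; .for vV (const 0) (var vN) (.when (.lt (var m) (arr a (var vV)))
    (.set m (arr a (var vV))))

theorem WP.maxArr {n : ℕ} {L : Fin n → List (Fin n)} {a m : ℕ} {σ : St} (hin : Input L σ)
    (hm : m ≠ vN ∧ m ≠ vV) :
    WP (maxArr a m) σ fun t σ' => t ≤ 4 * n + 3 ∧ (∀ v : Fin n, σ.a a v ≤ σ'.v m) ∧
      (σ'.v m = 0 ∨ ∃ v : Fin n, σ.a a v = σ'.v m) := by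
  obtain ⟨hm1, hm2⟩ := hm
  refine .seq (.set ?_)
  refine (WP.for (fun k σ' => (∀ v : Fin n, (v : ℕ) < k → σ.a a v ≤ σ'.v m) ∧
    (σ'.v m = 0 ∨ ∃ v : Fin n, σ.a a v = σ'.v m)) (fun _ => 2) 0 n rfl (Nat.zero_le n)
    (by simpa [Cmd.vars] using hm2.symm) ?_ ?_ ?_).mono ?_
  · intro σ' hF
    refine (hF.v vN (by simp [Cmd.for, Cmd.vars, hm1.symm])).trans ?_
    simpa [hm1.symm] using hin.size
  · exact ⟨fun v hv => by omega, by simp [hm2]⟩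
  · rintro k σ' - hk hF hv ⟨h1, h2⟩
    have ha : σ'.a a k = σ.a a k := by
      rw [hF.a a (by simp [Cmd.for, Cmd.arrs])]; rfl
    refine .ite (fun hb => .set ⟨le_rfl, fun v hvk => ?_, .inr ⟨⟨k, hk⟩, ?_⟩⟩)
      fun hb => .skip ⟨le_rfl, fun v hvk => ?_, ?_⟩
    all_goals simp only [Cond.Holds, Expr.eval, hv, ha] at hb ⊢
    all_goals simp only [St.setV_v, if_neg hm2, if_true]
    · by_cases h : (v : ℕ) = k
      · rw [h]
      · exact (h1 v (by omega)).trans hb.le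
    · by_cases h : (v : ℕ) = k
      · rw [h]; omega
      · exact h1 v (by omega)
    · exact h2
  · rintro t σ' - ⟨ht, h1, h2⟩
    simp at ht
    exact ⟨by omega, fun v => h1 v v.2, h2⟩

/-- Find a neighbour `w` of `u` with property `b` that maximises `val[w]`. -/
def bestNbr (b : Cond) (i w u m y val : ℕ) : Cmd :=
  .forNbr i w u (.when b (.when (.lt (var m) (add (arr val (var w)) (const 1)))
    (.set m (add (arr val (var w)) (const 1)) ;; .set y (var w))))

/-- The maximum is stored plus one, so the initial value `0` means that nothing has been found.
Another initial value lets `u` itself compete. -/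
theorem WP.bestNbr {n : ℕ} {L : Fin n → List (Fin n)} {i w u m y val : ℕ} {b : Cond}
    (P : Fin n → Prop) {σ : St} (hin : Input L σ) (x : Fin n) (hx : σ.v u = x)
    (hvars : [i, w, u, m, y, vN].Nodup)
    (hb : ∀ (σ' : St) (z : Fin n), (∀ j, j ∉ [i, w, m, y] → σ'.v j = σ.v j) →
      (∀ a, σ'.a a = σ.a a) → σ'.v w = z → (b.Holds σ' ↔ P z)) :
    WP (bestNbr b i w u m y val) σ fun t σ' => t ≤ 7 * (L x).length + 2 ∧
      (∀ z ∈ L x, P z → σ.a val z + 1 ≤ σ'.v m) ∧ σ.v m ≤ σ'.v m ∧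
      (σ'.v m = σ.v m ∧ σ'.v y = σ.v y ∨
        ∃ z ∈ L x, P z ∧ σ'.v y = z ∧ σ'.v m = σ.a val z + 1) := by
  simp only [List.nodup_cons, List.mem_cons, List.not_mem_nil, or_false, not_or] at hvars
  obtain ⟨⟨h1, h2, h3, h4, h5⟩, ⟨h6, h7, h8, h9⟩, ⟨h10, h11, h12⟩, ⟨h13, h14⟩, h15, -⟩ := hvars
  refine (WP.forNbr (fun k σ' => (∀ z ∈ (L x).take k, P z → σ.a val z + 1 ≤ σ'.v m) ∧
      σ.v m ≤ σ'.v m ∧ (σ'.v m = σ.v m ∧ σ'.v y = σ.v y ∨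
        ∃ z ∈ L x, P z ∧ σ'.v y = z ∧ σ'.v m = σ.a val z + 1)) 4 hin x hx ?_ ?_ ?_).mono ?_
  · simp [Cmd.vars, Cmd.arrs, *, Ne.symm]
  · intro k
    simp [Ne.symm h3, Ne.symm h4]
  · rintro k hk σ' hF ⟨g1, g2, g3⟩
    have htake : ∀ z, z ∈ (L x).take (k + 1) ↔ z ∈ (L x).take k ∨ z = (L x)[k] := fun z => by
      rw [List.take_succ_eq_append_getElem hk, List.mem_append, List.mem_singleton]
    have ha : σ'.a = σ.a := by
      funext a
      exact hF.a a (by simp [Cmd.forNbr, Cmd.for, Cmd.arrs])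
    have hb' := hb (σ'.setV w ((L x)[k] : ℕ)) (L x)[k] (fun z hz => by
      simp only [List.mem_cons, List.not_mem_nil, or_false, not_or] at hz
      rw [St.setV_v, if_neg hz.2.1, hF.v z (by simp [Cmd.forNbr, Cmd.for, Cmd.vars, hz])])
      (fun a => by rw [St.setV_a, ha]) (by simp)
    refine .ite (fun hc => .ite (fun hd => .seq (.set (.set ⟨le_rfl, fun j => ⟨?_, ?_, .inr
      ⟨(L x)[k], List.getElem_mem hk, hb'.1 hc, ?_, ?_⟩⟩⟩)))
      fun hd => .skip ⟨by omega, fun j => ⟨?_, ?_, ?_⟩⟩) fun hc => .skip ⟨by omega, fun j => ⟨?_, ?_, ?_⟩⟩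
    all_goals
      try simp only [Cond.Holds, Expr.eval, St.setV_v, St.setV_a, ha, if_true, if_neg (Ne.symm h7)] at hd
      simp only [Expr.eval, St.setV_v, St.setV_a, ha, if_true, if_neg (Ne.symm h7),
        if_neg (Ne.symm h8), if_neg (Ne.symm h3), if_neg (Ne.symm h4), if_neg h13,
        if_neg h7, if_neg (Ne.symm h13)]
    · intro z hz hP
      rcases (htake z).1 hz with hz | rfl
      · exact (g1 z hz hP).trans hd.le
      · exact le_rfl
    · exact g2.trans hd.le
    · intro z hz hP
      rcases (htake z).1 hz with hz | rfl
      · exact g1 z hz hP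
      · exact not_lt.1 hd
    · exact g2
    · exact g3
    · intro z hz hP
      rcases (htake z).1 hz with hz | rfl
      · exact g1 z hz hP
      · exact absurd (hb'.2 hP) hc
    · exact g2
    · exact g3
  · rintro t σ' - ⟨ht, g1, g2, g3⟩
    rw [List.take_length] at g1
    exact ⟨by omega, g1, g2, g3⟩

end Imp

/-! ### Levels for one component of an interval graph -/

theorem IsLevel.ne_zero_iff_exists {V : Type*} {H : SimpleGraph V} {S : Set V} {D : V → ℕ}
    (h : IsLevel H S D) {v : V} : D v ≠ 0 ↔ ∃ s ∈ S, H.Reachable s v := by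
  constructor
  · intro hv
    obtain ⟨s, hs, p, -⟩ := h.exists_walk (show D v = (D v - 1) + 1 by omega)
    exact ⟨s, hs, p.reachable⟩
  · rintro ⟨s, hs, ⟨p⟩⟩
    exact (h.le_of_walk p (by rw [(h.src s).2 hs]; simp)).1

theorem IntervalOn.mono {V : Type*} {H : SimpleGraph V} {C C' : Set V} {l r : V → ℝ}
    (h : IntervalOn H C l r) (hC : C' ⊆ C) : IntervalOn H C' l r :=
  ⟨fun v hv => h.le v (hC hv), fun u hu v hv => h.adj u (hC hu) v (hC hv)⟩

theorem IsAdjLists.length_le {n : ℕ} {G : SimpleGraph (Fin n)} {L : Fin n → List (Fin n)}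
    (hL : IsAdjLists G L) (v : Fin n) : (L v).length ≤ n := by
  simpa using (hL v).1.length_le_card

namespace Imp

open Imp.Expr WordRAM

notation "vY" => (12 : ℕ)
notation "vK" => (13 : ℕ)
notation "vBest" => (14 : ℕ)
notation "vNx" => (15 : ℕ)
notation "vCur" => (16 : ℕ)
notation "vLen" => (17 : ℕ)
notation "vBase" => (18 : ℕ)
notation "vT" => (19 : ℕ)
notation "aFst" => (9 : ℕ)
notation "aLv" => (10 : ℕ)
notation "aCp" => (11 : ℕ)
notation "aSm" => (12 : ℕ)
notation "aUp" => (13 : ℕ)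
notation "aNx" => (14 : ℕ)
notation "aHor" => (15 : ℕ)
notation "aPA" => (16 : ℕ)
notation "aPB" => (17 : ℕ)
notation "aAdj" => (18 : ℕ)

theorem sum_length_le {n : ℕ} {G : SimpleGraph (Fin n)} {L : Fin n → List (Fin n)}
    (hL : IsAdjLists G L) (D : Fin n → ℕ) :
    ∑ v : Fin n with D v ≠ 0, (7 * (L v).length + 5) ≤
      (Finset.univ.filter fun v : Fin n => D v ≠ 0).card * (7 * n + 5) := by
  refine Finset.sum_le_card_nsmul _ _ _ fun v _ => ?_
  have := hL.length_le v
  omega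

/-- Among the vertices farthest from `vS`, find one with the fewest neighbours in the level
below. -/
def farVertex : Cmd :=
  bfsFrom aFlag vS ;;
  .for vV (const 0) (var vN) (.store aFst (var vV) (arr aD (var vV))) ;;
  maxArr aFst vK ;;
  .set vY (var vS) ;; .set vBest (add (var vN) (const 1)) ;;
  .for vT (const 0) (var vN) (.when (.eq (arr aFst (var vT)) (var vK))
    ((.set vCnt (const 0) ;; .forNbr vI vW vT
      (.when (.eq (add (arr aFst (var vW)) (const 1)) (var vK)) (.inc vCnt))) ;;
    .when (.lt (var vCnt) (var vBest)) (.set vBest (var vCnt) ;; .set vY (var vT))))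

/-- Having the fewest neighbours in the previous level implies that no farthest vertex has a
properly smaller neighbourhood there, as required by `exists_common_neighbor`. Counting is done in
`G`, which makes no difference on reached vertices. -/
theorem WP.farVertex {n : ℕ} {G : SimpleGraph (Fin n)} {L : Fin n → List (Fin n)}
    (hL : IsAdjLists G L) {K : Finset (Fin n)} {σ : St} (hin : Input L σ)
    (hK : IsFlag aFlag K σ) (hS : IsFlag aSrc (∅ : Finset (Fin n)) σ) {x : Fin n} (hx : σ.v vS = x)
    (hxK : x ∉ K) :
    WP farVertex σ fun t σ' => ∃ (D : Fin n → ℕ) (y : Fin n),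
      t ≤ 31 * n + 40 + (Finset.univ.filter fun v : Fin n => D v ≠ 0).card * (13 * n + 20) ∧
      IsLevel (delGraph G K) {x} D ∧ σ'.v vY = y ∧ (∀ v, D v ≤ D y) ∧
      (∀ v, D v = D y → ¬ {w | (delGraph G K).Adj v w ∧ D w + 1 = D y} ⊂
        {w | (delGraph G K).Adj y w ∧ D w + 1 = D y}) ∧ IsFlag aSrc (∅ : Finset (Fin n)) σ' := by
  classical
  refine .seq' (WP.bfsFrom hL hin hK hS hx hxK (by decide) (by decide)) ?_
  rintro t1 σ1 hF1 ⟨D, ht1, hlev, hD, hs1⟩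
  have hin1 : Input L σ1 := hin.of_eq (hF1.v _ (by decide)) (hF1.a _ (by decide))
  refine .seq' (WP.fill (a := aFst) hin1 D (fun _ => 1) (by decide) ?_) ?_
  · intro k σ' hF hv _
    refine .store ⟨le_rfl, ?_, fun i hi => ?_⟩
    · simp only [Expr.eval, hv, hF.a aD (by decide), hD, St.setA_a, if_true, Function.update_self]
    · simp [hv, Function.update_of_ne hi]
  rintro t2 σ2 hF2 ⟨ht2, hD2⟩
  have hin2 : Input L σ2 := hin1.of_eq (hF2.v _ (by decide)) (hF2.a _ (by decide))
  refine .seq' (WP.maxArr hin2 (by decide)) ?_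
  rintro t3 σ3 hF3 ⟨ht3, hmax, hex⟩
  have hin3 : Input L σ3 := hin2.of_eq (hF3.v _ (by decide)) (hF3.a _ (by decide))
  have hD3 : ∀ v : Fin n, σ3.a aFst v = D v := fun v => by rw [hF3.a _ (by decide), hD2]
  simp only [hD2] at hmax hex
  set m := σ3.v vK with hm
  have hDx : D x = 1 := (hlev.src x).2 rfl
  obtain ⟨v₀, hv₀⟩ : ∃ v, D v = m := hex.resolve_left fun h => by have := hmax x; omega
  refine .seq (.set (.seq (.set ?_)))
  set cnt : Fin n → ℕ := fun v => (Finset.univ.filter fun w => G.Adj v w ∧ D w + 1 = m).card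
    with hcnt
  set σ4 := (σ3.setV vY ((var vS).eval σ3)).setV vBest
    ((add (var vN) (const 1)).eval (σ3.setV vY ((var vS).eval σ3))) with hσ4
  have hin4 : Input L σ4 := hin3.of_eq (by simp [hσ4]) (by simp [hσ4])
  refine (WP.for (fun k σ' => (∀ v : Fin n, (v : ℕ) < k → D v = m → σ'.v vBest ≤ cnt v) ∧
    (σ'.v vBest = n + 1 ∨ ∃ y : Fin n, σ'.v vY = y ∧ D y = m ∧ σ'.v vBest = cnt y))
    (fun k => 2 + if h : k < n then if D ⟨k, h⟩ ≠ 0 then 6 * n + 6 else 0 else 0) 0 n rfl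
    (Nat.zero_le n) (by decide) ?_ ?_ ?_).mono ?_
  · exact fun σ' hF => (hF.v vN (by decide)).trans hin4.size
  · refine ⟨fun v hv => by omega, .inl ?_⟩
    simp [hσ4, Expr.eval, hin3.size]
  · rintro k σ' - hk hF hv ⟨h1, h2⟩
    have hin' : Input L σ' := hin4.of_eq (hF.v _ (by decide)) (hF.a _ (by decide))
    have hm' : σ'.v vK = m := (hF.v _ (by decide)).trans (by simp [hσ4, hm])
    have hD' : ∀ v : Fin n, σ'.a aFst v = D v := fun v => by
      rw [hF.a _ (by decide)]; exact hD3 v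
    have hDk : σ'.a aFst k = D ⟨k, hk⟩ := hD' ⟨k, hk⟩
    refine .ite (fun hb => ?_) fun hb => .skip ⟨by omega, fun v hvk hDv => ?_, ?_⟩
    all_goals simp only [Cond.Holds, Expr.eval, hv, hm', hDk] at hb
    · have hk0 : D ⟨k, hk⟩ ≠ 0 := by have := hmax x; omega
      refine .seq' (WP.countNbr (fun w => D w + 1 = m) hin' ⟨k, hk⟩ hv (by decide) ?_) ?_
      · intro σ'' y h1 h2 h3
        simp only [Cond.Holds, Expr.eval, h3, h2, hD', h1 vK (by decide) (by decide) (by decide),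
          hm']
      rintro t5 σ5 hF5 ⟨ht5, hc5⟩
      rw [hL.countP_eq] at hc5
      have hlen := hL.length_le ⟨k, hk⟩
      have hb5 : σ5.v vBest = σ'.v vBest := hF5.v _ (by decide)
      have hy5 : σ5.v vY = σ'.v vY := hF5.v _ (by decide)
      have hv5 : σ5.v vT = k := (hF5.v _ (by decide)).trans hv
      refine .ite (fun hb' => .seq (.set (.set ⟨?_, fun v hvk hDv => ?_, .inr ⟨⟨k, hk⟩, ?_⟩⟩)))
        fun hb' => .skip ⟨?_, fun v hvk hDv => ?_, ?_⟩
      all_goals simp only [Cond.Holds, Expr.eval, hb5, hc5] at hb'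
      · simp only [hk, hk0, dif_pos, ne_eq, not_false_eq_true, if_true]; omega
      · simp only [St.setV_v, Expr.eval, hc5, if_true]
        simp only [show vBest ≠ vT by decide, show vBest ≠ vY by decide, if_false]
        by_cases h : (v : ℕ) = k
        · rw [show v = ⟨k, hk⟩ from Fin.ext h]
        · exact hb'.le.trans (h1 v (by omega) hDv)
      · simp [Expr.eval, hc5, hv5, hb, hcnt]
      · simp only [hk, hk0, dif_pos, ne_eq, not_false_eq_true, if_true]; omega
      · simp only [St.setV_v, show vBest ≠ vT by decide, if_false, hb5]
        by_cases h : (v : ℕ) = k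
        · rw [show v = ⟨k, hk⟩ from Fin.ext h]
          exact not_lt.1 hb'
        · exact h1 v (by omega) hDv
      · simpa [hb5, hy5] using h2
    · simp only [St.setV_v, show vBest ≠ vT by decide, if_false]
      refine h1 v ?_ hDv
      have : (v : ℕ) ≠ k := by
        rintro rfl
        exact hb hDv
      omega
    · simpa using h2
  · rintro t5 σ5 hF5 ⟨ht5, h1, h2⟩
    have hle := h1 v₀ v₀.2 hv₀
    have hcn : cnt v₀ ≤ n := (Finset.card_le_univ _).trans (by simp)
    obtain ⟨y, hy, hDy, hby⟩ := h2.resolve_left (by omega)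
    refine ⟨D, y, ?_, hlev, hy, fun v => hDy ▸ hmax v, fun v hv hss => ?_, ?_⟩
    · have hsum := sum_length_le hL D
      have : ∑ k ∈ Finset.Ico 0 n, (if h : k < n then if D ⟨k, h⟩ ≠ 0 then 6 * n + 6 else 0 else 0)
          = (Finset.univ.filter fun v : Fin n => D v ≠ 0).card * (6 * n + 6) := by
        rw [← Finset.range_eq_Ico, Finset.sum_range]
        simp [Finset.sum_ite]
      rw [Finset.sum_add_distrib, Finset.sum_add_distrib, this] at ht5
      simp only [Finset.sum_const, Nat.card_Ico, smul_eq_mul, Finset.card_univ, Fintype.card_fin]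
        at ht2 ht5
      have e : (Finset.univ.filter fun v : Fin n => D v ≠ 0).card * (13 * n + 20) =
        (Finset.univ.filter fun v : Fin n => D v ≠ 0).card * (6 * n + 6) +
        (Finset.univ.filter fun v : Fin n => D v ≠ 0).card * (7 * n + 5) +
        (Finset.univ.filter fun v : Fin n => D v ≠ 0).card * 9 := by ring
      omega
    · rw [hDy] at hss hv
      by_cases hm1 : m = 1
      · have e1 : v = x := (hlev.src v).1 (by omega)
        have e2 : y = x := (hlev.src y).1 (by omega)
        rw [e1, e2] at hss
        exact hss.2 hss.1
      · have hdel : ∀ v w, D v = m → D w + 1 = m → ((delGraph G K).Adj v w ↔ G.Adj v w) := by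
          have hnK : ∀ w, D w ≠ 0 → w ∉ K := fun w hw => by
            by_cases h1 : D w = 1
            · rw [show w = x from (hlev.src w).1 h1]
              exact hxK
            · obtain ⟨u, huw, -⟩ := hlev.pred w (by omega)
              exact huw.2.2
          intro v w hv hw
          have := hmax x
          exact ⟨fun h => h.1, fun h => ⟨h, hnK v (by omega), hnK w (by omega)⟩⟩
        have hlt : cnt v < cnt y := by
          refine Finset.card_lt_card ?_
          rw [← Finset.coe_ssubset]
          convert hss using 1
          all_goals
            ext w
            simp only [Finset.coe_filter, Finset.mem_univ, true_and, Set.mem_ofPred_eq]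
          · exact and_congr_left fun hw => (hdel v w hv hw).symm
          · exact and_congr_left fun hw => (hdel y w hDy hw).symm
        have := h1 v v.2 hv
        omega
    · refine hs1.of_eq ?_
      rw [hF5.a _ (by decide)]
      exact (hF3.a _ (by decide)).trans (hF2.a _ (by decide))

end Imp

namespace Imp

open Imp.Expr WordRAM

/-- The levels above the last level of the search from `vY`. -/
def endLevels : Cmd :=
  bfsFrom aFlag vY ;; maxArr aD vK ;;
  .for vV (const 0) (var vN) (.when (.eq (arr aD (var vV)) (var vK))
    (.store aSrc (var vV) (const 1))) ;;
  bfs aFlag ;;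
  .for vV (const 0) (var vN) (.store aSrc (var vV) (const 0))

/-- The last level of the first search lies outside `K`, as is required of the sources of the second
search. -/
theorem WP.endLevels {n : ℕ} {G : SimpleGraph (Fin n)} {L : Fin n → List (Fin n)}
    (hL : IsAdjLists G L) {K : Finset (Fin n)} {σ : St} (hin : Input L σ)
    (hK : IsFlag aFlag K σ) (hS : IsFlag aSrc (∅ : Finset (Fin n)) σ) {y : Fin n} (hy : σ.v vY = y)
    (hyK : y ∉ K) :
    WP endLevels σ fun t σ' => ∃ (D D' : Fin n → ℕ) (k : ℕ),
      t ≤ 60 * n + 60 + ((Finset.univ.filter fun v : Fin n => D v ≠ 0).card +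
        (Finset.univ.filter fun v : Fin n => D' v ≠ 0).card) * (7 * n + 5) ∧
      IsLevel (delGraph G K) {y} D ∧ (∀ v, D v ≤ k) ∧ (∃ v, D v = k) ∧ σ'.v vK = k ∧
      IsLevel (delGraph G K) {v | D v = k} D' ∧ (∀ v : Fin n, σ'.a aD v = D' v) ∧
      IsFlag aSrc (∅ : Finset (Fin n)) σ' := by
  refine .seq' (WP.bfsFrom hL hin hK hS hy hyK (by decide) (by decide)) ?_
  rintro t1 σ1 hF1 ⟨D, ht1, hlev, hD, hs1⟩
  have hin1 : Input L σ1 := hin.of_eq (hF1.v _ (by decide)) (hF1.a _ (by decide))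
  have hK1 : IsFlag aFlag K σ1 := hK.of_eq (hF1.a _ (by decide))
  refine .seq' (WP.maxArr hin1 (by decide)) ?_
  rintro t2 σ2 hF2 ⟨ht2, hmax, hex⟩
  have hin2 : Input L σ2 := hin1.of_eq (hF2.v _ (by decide)) (hF2.a _ (by decide))
  have hK2 : IsFlag aFlag K σ2 := hK1.of_eq (hF2.a _ (by decide))
  simp only [hD] at hmax hex
  set k := σ2.v vK with hk
  have hDy : D y = 1 := (hlev.src y).2 rfl
  have hk0 : k ≠ 0 := fun h => by have := hmax y; omega
  have hex' : ∃ v, D v = k := hex.resolve_left hk0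
  refine .seq' (WP.fill (a := aSrc) hin2 (fun v => if D v = k then 1 else 0) (fun _ => 2)
    (by decide) ?_) ?_
  · intro v σ' hF hv hsame
    have hDv : σ'.a aD v = D v := by rw [hF.a _ (by decide), hF2.a _ (by decide), hD]
    have hk' : σ'.v vK = k := hF.v _ (by decide)
    refine .ite (fun hb => .store ⟨le_rfl, ?_, fun i hi => ?_⟩) fun hb => .skip ⟨le_rfl, ?_, fun i hi => rfl⟩
    all_goals simp only [Cond.Holds, Expr.eval, hv, hDv, hk'] at hb ⊢
    · simp [hb]
    · simp [Function.update_of_ne hi]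
    · rw [if_neg hb, hsame v le_rfl, hF2.a _ (by decide)]
      simpa using hs1 v
  rintro t3 σ3 hF3 ⟨ht3, hS3⟩
  have hin3 : Input L σ3 := hin2.of_eq (hF3.v _ (by decide)) (hF3.a _ (by decide))
  have hK3 : IsFlag aFlag K σ3 := hK2.of_eq (hF3.a _ (by decide))
  have hflag : IsFlag aSrc (Finset.univ.filter fun v : Fin n => D v = k) σ3 := fun v => by
    simpa using hS3 v
  refine .seq' (WP.bfs hL hin3 hK3 hflag ?_ (by decide)) ?_
  · rw [Finset.disjoint_left]
    intro v hv
    have hDv : D v = k := by simpa using hv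
    by_cases h1 : D v = 1
    · rw [show v = y from (hlev.src v).1 h1]
      exact hyK
    · obtain ⟨u, huv, -⟩ := hlev.pred v (by omega)
      exact huv.2.2
  rintro t4 σ4 hF4 ⟨D', ht4, hlev', hD'⟩
  have hin4 : Input L σ4 := hin3.of_eq (hF4.v _ (by decide)) (hF4.a _ (by decide))
  refine (WP.fill (a := aSrc) hin4 (fun _ => 0) (fun _ => 1) (by decide) ?_).mono ?_
  · intro v σ' hF hv _
    refine .store ⟨le_rfl, ?_, fun i hi => ?_⟩
    · simp [hv]
    · simp [hv, Function.update_of_ne hi]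
  rintro t5 σ5 hF5 ⟨ht5, hS5⟩
  refine ⟨D, D', k, ?_, hlev, hmax, hex', ?_, by simpa using hlev', ?_, fun v => by simpa using hS5 v⟩
  · have e1 := sum_length_le hL D
    have e2 := sum_length_le hL D'
    simp only [Finset.sum_const, smul_eq_mul, Finset.card_univ, Fintype.card_fin] at ht3 ht5
    rw [add_mul]
    omega
  · rw [hF5.v _ (by decide), hF4.v _ (by decide), hF3.v _ (by decide)]
  · intro v
    rw [hF5.a _ (by decide), hD']

/-- Assign a value to `a[v]` for all `v` with `D[v] ≠ 0`. -/
def fillReached (a : ℕ) (e : Expr) : Cmd :=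
  .for vV (const 0) (var vN) (.when (.lt (const 0) (arr aD (var vV))) (.store a (var vV) e))

theorem WP.fillReached {n : ℕ} {L : Fin n → List (Fin n)} {a : ℕ} {e : Expr} {σ : St}
    (hin : Input L σ) (ha : a ≠ aD) (g D : Fin n → ℕ) (hD : ∀ v : Fin n, σ.a aD v = D v)
    (he : ∀ (v : Fin n) (σ' : St), (∀ x, x ≠ vV → σ'.v x = σ.v x) → (∀ b, b ≠ a → σ'.a b = σ.a b) →
      σ'.v vV = v → e.eval σ' = g v) :
    WP (fillReached a e) σ fun t σ' => t ≤ 4 * n + 2 ∧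
      ∀ v : Fin n, σ'.a a v = if D v ≠ 0 then g v else σ.a a v := by
  refine (WP.fill (a := a) hin (fun v => if D v ≠ 0 then g v else σ.a a v) (fun _ => 2)
    (by simp [Cmd.vars]) ?_).mono ?_
  · intro v σ' hF hv hsame
    have hF' : ∀ b, b ≠ a → σ'.a b = σ.a b := fun b hb =>
      hF.a b (by simpa [Cmd.for, Cmd.arrs] using hb)
    have hDv : σ'.a aD v = D v := by rw [hF' _ ha.symm, hD]
    have hev := he v σ' (fun x hx => hF.v x (by simpa [Cmd.for, Cmd.vars] using hx)) hF' hv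
    refine .ite (fun hb => .store ⟨le_rfl, ?_, fun i hi => ?_⟩) fun hb => .skip ⟨le_rfl, ?_, fun i hi => rfl⟩
    all_goals simp only [Cond.Holds, Expr.eval, hv, hDv] at hb ⊢
    · rw [if_pos (by omega)]
      simp [hev]
    · simp [Function.update_of_ne hi]
    · rw [if_neg (by omega), hsame v le_rfl]
  · rintro t σ' - ⟨ht, h⟩
    simp only [Finset.sum_const, smul_eq_mul, Finset.card_univ, Fintype.card_fin] at ht
    exact ⟨by omega, h⟩

/-- Compute suitable levels for the component of `vS`. -/
def compLevels : Cmd :=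
  farVertex ;; endLevels ;; fillReached aLv (arr aD (var vV)) ;;
  fillReached aCp (add (var vS) (const 1)) ;; fillReached aSm (sub (const 4) (var vK))

/-- The level `k` is the eccentricity of `y` plus one, so the stored value `4 - k` is nonzero
exactly if the eccentricity is at most `2`. All three searches visit precisely the component of `x`,
and their cost is charged to its vertices. -/
theorem WP.compLevels {n : ℕ} {G : SimpleGraph (Fin n)} {L : Fin n → List (Fin n)}
    (hL : IsAdjLists G L) {K : Finset (Fin n)} {σ : St} (hin : Input L σ)
    (hK : IsFlag aFlag K σ) (hS : IsFlag aSrc (∅ : Finset (Fin n)) σ) {x : Fin n} (hx : σ.v vS = x)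
    (hxK : x ∉ K) {l r : Fin n → ℝ} (hI : IntervalOn (delGraph G K) {v | v ∉ K} l r) :
    WP compLevels σ fun t σ' => ∃ (D : Fin n → ℕ) (k : ℕ),
      t ≤ 120 * n + 120 + (Finset.univ.filter fun v : Fin n => D v ≠ 0).card * (30 * n + 30) ∧
      (∀ v, D v ≠ 0 ↔ (delGraph G K).Reachable x v) ∧
      (k < 4 → ∀ u v, D u ≠ 0 → D v ≠ 0 → u ≠ v → ¬ (delGraph G K).Adj u v →
        ∃ a, (delGraph G K).Adj u a ∧ (delGraph G K).Adj a v) ∧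
      (4 ≤ k → IsLadder (delGraph G K) D) ∧
      (∀ v : Fin n, σ'.a aLv v = if D v ≠ 0 then D v else σ.a aLv v) ∧
      (∀ v : Fin n, σ'.a aCp v = if D v ≠ 0 then (x : ℕ) + 1 else σ.a aCp v) ∧
      (∀ v : Fin n, σ'.a aSm v = if D v ≠ 0 then 4 - k else σ.a aSm v) ∧
      IsFlag aSrc (∅ : Finset (Fin n)) σ' := by
  set H := delGraph G K with hH
  refine .seq' (WP.farVertex hL hin hK hS hx hxK) ?_
  rintro t1 σ1 hF1 ⟨D₁, y, ht1, h₁, hy, hmax, hmin, hs1⟩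
  have hin1 : Input L σ1 := hin.of_eq (hF1.v _ (by decide)) (hF1.a _ (by decide))
  have hK1 : IsFlag aFlag K σ1 := hK.of_eq (hF1.a _ (by decide))
  have hxy : H.Reachable x y := by
    refine h₁.ne_zero_iff.1 fun h => ?_
    have := hmax x
    have := (h₁.src x).2 rfl
    omega
  have hreach : ∀ {v}, H.Reachable x v → v ∉ K := by
    rintro v hv
    have hv0 := h₁.ne_zero_iff.2 hv
    by_cases h1 : D₁ v = 1
    · rw [show v = x from (h₁.src v).1 h1]
      exact hxK
    · obtain ⟨u, huv, -⟩ := h₁.pred v (by omega)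
      exact huv.2.2
  refine .seq' (WP.endLevels hL hin1 hK1 hs1 hy (hreach hxy)) ?_
  rintro t2 σ2 hF2 ⟨D₂, D, k, ht2, h₂, hle, hex, hk, h₃, hD, hs2⟩
  have hin2 : Input L σ2 := hin1.of_eq (hF2.v _ (by decide)) (hF2.a _ (by decide))
  have hx2 : σ2.v vS = x := (hF2.v _ (by decide)).trans ((hF1.v _ (by decide)).trans hx)
  refine .seq' (WP.fillReached hin2 (by decide) D D hD ?_) ?_
  · intro v σ' _ h2 h3
    simp only [Expr.eval, h3, h2 aD (by decide), hD]
  rintro t3 σ3 hF3 ⟨ht3, hLv⟩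
  have hin3 : Input L σ3 := hin2.of_eq (hF3.v _ (by decide)) (hF3.a _ (by decide))
  have hD3 : ∀ v : Fin n, σ3.a aD v = D v := fun v => by rw [hF3.a _ (by decide), hD]
  refine .seq' (WP.fillReached hin3 (by decide) (fun _ => (x : ℕ) + 1) D hD3 ?_) ?_
  · intro v σ' h1 _ _
    simp only [Expr.eval, h1 vS (by decide), hF3.v vS (by decide), hx2]
  rintro t4 σ4 hF4 ⟨ht4, hCp⟩
  have hin4 : Input L σ4 := hin3.of_eq (hF4.v _ (by decide)) (hF4.a _ (by decide))
  have hD4 : ∀ v : Fin n, σ4.a aD v = D v := fun v => by rw [hF4.a _ (by decide), hD3]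
  refine (WP.fillReached hin4 (by decide) (fun _ => 4 - k) D hD4 ?_).mono ?_
  · intro v σ' h1 _ _
    simp only [Expr.eval, h1 vK (by decide), hF4.v vK (by decide), hF3.v vK (by decide), hk]
  rintro t5 σ5 hF5 ⟨ht5, hSm⟩
  -- all searches visit the component of `x`
  set C : Set (Fin n) := {v | H.Reachable x v} with hC
  have hC₁ : ∀ v, v ∈ C ↔ D₁ v ≠ 0 := fun v => h₁.ne_zero_iff.symm
  have hC₂ : ∀ v, v ∈ C ↔ D₂ v ≠ 0 := fun v =>
    ⟨fun h => h₂.ne_zero_iff.2 (hxy.symm.trans h), fun h => hxy.trans (h₂.ne_zero_iff.1 h)⟩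
  have hC₃ : ∀ v, v ∈ C ↔ D v ≠ 0 := fun v => by
    have hk0 : k ≠ 0 := fun h => by
      have := hle y
      have := (h₂.src y).2 rfl
      omega
    have hQ : ∀ q, D₂ q = k → H.Reachable x q := fun q hq => (hC₂ q).2 (by omega)
    rw [h₃.ne_zero_iff_exists]
    constructor
    · intro h
      obtain ⟨q, hq⟩ := hex
      exact ⟨q, hq, (hQ q hq).symm.trans h⟩
    · rintro ⟨q, hq, h⟩
      exact (hQ q hq).trans h
  have hIC : IntervalOn H C l r := hI.mono fun v hv => hreach hv
  refine ⟨D, k, ?_, fun v => (hC₃ v).symm, fun hk4 u v hu hv huv hadj => ?_, fun hk4 => ?_,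
    fun v => ?_, fun v => ?_, fun v => ?_, ?_⟩
  · have e1 : (Finset.univ.filter fun v : Fin n => D₁ v ≠ 0) =
        Finset.univ.filter fun v : Fin n => D v ≠ 0 := by
      ext v; simp only [Finset.mem_filter, Finset.mem_univ, true_and, ← hC₁, ← hC₃]
    have e2 : (Finset.univ.filter fun v : Fin n => D₂ v ≠ 0) =
        Finset.univ.filter fun v : Fin n => D v ≠ 0 := by
      ext v; simp only [Finset.mem_filter, Finset.mem_univ, true_and, ← hC₂, ← hC₃]
    rw [e1] at ht1
    rw [e2] at ht2
    set c := (Finset.univ.filter fun v : Fin n => D v ≠ 0).card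
    have e3 : c * (30 * n + 30) = c * (13 * n + 20) + (c + c) * (7 * n + 5) + 3 * (c * n) := by ring
    omega
  · exact exists_common_neighbor hIC h₁ hC₁ h₂ hC₂ hmax hmin (fun v => by have := hle v; omega)
      ((hC₃ u).2 hu) ((hC₃ v).2 hv) huv hadj
  · obtain ⟨l', r', hE⟩ := exists_isEnd hIC h₁ hC₁ h₂ hC₂ hmax hk4 hle hex
    exact hE.isLadder h₃ hC₃
  · rw [hF5.a _ (by decide), hF4.a _ (by decide), hLv, hF2.a _ (by decide), hF1.a _ (by decide)]
  · rw [hF5.a _ (by decide), hCp, hF3.a _ (by decide), hF2.a _ (by decide), hF1.a _ (by decide)]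
  · rw [hSm, hF4.a _ (by decide), hF3.a _ (by decide), hF2.a _ (by decide), hF1.a _ (by decide)]
  · refine hs2.of_eq ?_
    rw [hF5.a _ (by decide), hF4.a _ (by decide), hF3.a _ (by decide)]

end Imp

/-! ### Levels for all components -/

/-- Levels `Lv` for those components of `H` on which the component number `Cp` is not zero. For a
vertex `v` with `Sm v ≠ 0` the component of `v` has diameter at most `2`. -/
structure IsCompLevels {V : Type*} (H : SimpleGraph V) (Lv Cp Sm : V → ℕ) : Prop where
  ne_zero : ∀ v, Lv v ≠ 0 ↔ Cp v ≠ 0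
  comp : ∀ u v, Cp u ≠ 0 → (H.Reachable u v ↔ Cp u = Cp v)
  small : ∀ u v, Cp u ≠ 0 → Sm u ≠ 0 → H.Reachable u v → u ≠ v → ¬ H.Adj u v →
    ∃ a, H.Adj u a ∧ H.Adj a v
  ladder : ∀ u, Cp u ≠ 0 → Sm u = 0 → ∃ D, IsLadder H D ∧ (∀ v, D v ≠ 0 ↔ H.Reachable u v) ∧
    ∀ v, H.Reachable u v → Lv v = D v

/-- The new component is disjoint from those treated before since `x` is unlabelled, and its label
`c` is fresh. -/
theorem IsCompLevels.extend {V : Type*} {H : SimpleGraph V} {Lv Cp Sm Lv' Cp' Sm' D : V → ℕ}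
    (h : IsCompLevels H Lv Cp Sm) {x : V} (hx : Cp x = 0) {c k : ℕ} (hc : c ≠ 0)
    (hcn : ∀ v, Cp v ≠ c) (hD : ∀ v, D v ≠ 0 ↔ H.Reachable x v)
    (hsm : k < 4 → ∀ u v, D u ≠ 0 → D v ≠ 0 → u ≠ v → ¬ H.Adj u v → ∃ a, H.Adj u a ∧ H.Adj a v)
    (hla : 4 ≤ k → IsLadder H D) (hLv : ∀ v, Lv' v = if D v ≠ 0 then D v else Lv v)
    (hCp : ∀ v, Cp' v = if D v ≠ 0 then c else Cp v)
    (hSm : ∀ v, Sm' v = if D v ≠ 0 then 4 - k else Sm v) : IsCompLevels H Lv' Cp' Sm' := by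
  have hCD : ∀ v, D v ≠ 0 → Cp v = 0 := fun v hv => by
    by_contra h0
    have := (h.comp v x h0).1 ((hD v).1 hv).symm
    omega
  have hsame : ∀ {u v}, H.Reachable u v → (D u ≠ 0 ↔ D v ≠ 0) := fun huv => by
    rw [hD, hD]
    exact ⟨fun h => h.trans huv, fun h => h.trans huv.symm⟩
  refine ⟨fun v => ?_, fun u v hu => ?_, fun u v hu hs huv hne hadj => ?_, fun u hu hs => ?_⟩
  · rw [hLv, hCp]
    split_ifs with hv
    · exact ⟨fun _ => hc, fun _ => hv⟩
    · exact h.ne_zero v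
  · rw [hCp] at hu ⊢
    by_cases hDu : D u ≠ 0
    · rw [if_pos hDu, hCp]
      constructor
      · intro huv
        rw [if_pos ((hsame huv).1 hDu)]
      · intro heq
        by_cases hDv : D v ≠ 0
        · exact ((hD u).1 hDu).symm.trans ((hD v).1 hDv)
        · rw [if_neg hDv] at heq
          exact absurd heq.symm (hcn v)
    · rw [if_neg hDu] at hu ⊢
      rw [hCp]
      by_cases hDv : D v ≠ 0
      · rw [if_pos hDv]
        exact ⟨fun huv => absurd ((hsame huv).2 hDv) hDu, fun heq => absurd heq (hcn u)⟩
      · rw [if_neg hDv]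
        exact h.comp u v hu
  · rw [hCp] at hu
    rw [hSm] at hs
    by_cases hDu : D u ≠ 0
    · rw [if_pos hDu] at hs
      exact hsm (by omega) u v hDu ((hsame huv).1 hDu) hne hadj
    · rw [if_neg hDu] at hu hs
      exact h.small u v hu hs huv hne hadj
  · rw [hCp] at hu
    rw [hSm] at hs
    by_cases hDu : D u ≠ 0
    · rw [if_pos hDu] at hs
      refine ⟨D, hla (by omega), fun v => ?_, fun v huv => ?_⟩
      · rw [hD]
        have hxu := (hD u).1 hDu
        exact ⟨fun h => hxu.symm.trans h, fun h => hxu.trans h⟩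
      · rw [hLv, if_pos ((hsame huv).1 hDu)]
    · rw [if_neg hDu] at hu hs
      obtain ⟨D', h1, h2, h3⟩ := h.ladder u hu hs
      exact ⟨D', h1, h2, fun v huv => by
        rw [hLv, if_neg fun h => hDu ((hsame huv).2 h), h3 v huv]⟩

namespace Imp

open Imp.Expr WordRAM

/-- Compute levels for all components. -/
def allLevels : Cmd :=
  .for vS (const 0) (var vN) (.when (.eq (arr aFlag (var vS)) (const 0))
    (.when (.eq (arr aCp (var vS)) (const 0)) compLevels))

/-- The component found at `s` gets the label `s + 1`, larger than all earlier ones. -/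
theorem WP.allLevels {n : ℕ} {G : SimpleGraph (Fin n)} {L : Fin n → List (Fin n)}
    (hL : IsAdjLists G L) {K : Finset (Fin n)} {σ : St} (hin : Input L σ)
    (hK : IsFlag aFlag K σ) (hS : IsFlag aSrc (∅ : Finset (Fin n)) σ)
    (hLv : IsFlag aLv (∅ : Finset (Fin n)) σ) (hCp : IsFlag aCp (∅ : Finset (Fin n)) σ)
    {l r : Fin n → ℝ} (hI : IntervalOn (delGraph G K) {v | v ∉ K} l r) :
    WP allLevels σ fun t σ' => t ≤ 160 * n ^ 2 + 160 * n + 2 ∧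
      IsCompLevels (delGraph G K) (fun v : Fin n => σ'.a aLv v) (fun v : Fin n => σ'.a aCp v)
        (fun v : Fin n => σ'.a aSm v) ∧ ∀ v : Fin n, σ'.a aCp v ≠ 0 ↔ v ∉ K := by
  set H := delGraph G K with hH
  refine (WP.forT (fun k t σ' =>
    t ≤ 5 * k + (Finset.univ.filter fun v : Fin n => σ'.a aCp v ≠ 0).card * (150 * n + 150) ∧
    IsCompLevels (delGraph G K) (fun v : Fin n => σ'.a aLv v) (fun v : Fin n => σ'.a aCp v)
      (fun v : Fin n => σ'.a aSm v) ∧ (∀ v : Fin n, σ'.a aCp v ≤ k) ∧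
    (∀ v : Fin n, σ'.a aCp v ≠ 0 → v ∉ K) ∧
    (∀ v : Fin n, (v : ℕ) < k → v ∉ K → σ'.a aCp v ≠ 0) ∧
    IsFlag aSrc (∅ : Finset (Fin n)) σ') 0 n rfl (Nat.zero_le n) (by decide) ?_ ?_ ?_).mono ?_
  · exact fun σ' hF => (hF.v vN (by decide)).trans hin.size
  · have h0 : ∀ v : Fin n, σ.a aCp v = 0 := fun v => by simpa using hCp v
    have h1 : ∀ v : Fin n, σ.a aLv v = 0 := fun v => by simpa using hLv v
    refine ⟨by simp, ⟨fun v => ?_, fun u v hu => absurd (h0 u) hu, fun u v hu => absurd (h0 u) hu,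
      fun u hu => absurd (h0 u) hu⟩, fun v => (h0 v).le, fun v hv => absurd (h0 v) hv,
      fun v hv => absurd hv (Nat.not_lt_zero _), hS.of_eq (by simp)⟩
    simp [h0, h1]
  · rintro k t σ' - hk hF hv ⟨ht, h, hle, hnK, hdone, hs⟩
    have hin' : Input L σ' := hin.of_eq (hF.v _ (by decide)) (hF.a _ (by decide))
    have hK' : IsFlag aFlag K σ' := hK.of_eq (hF.a _ (by decide))
    have hKk := hK' ⟨k, hk⟩
    have hskip : ((⟨k, hk⟩ : Fin n) ∉ K → σ'.a aCp k ≠ 0) → ∀ v : Fin n, (v : ℕ) < k + 1 →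
        v ∉ K → σ'.a aCp v ≠ 0 := fun h v hvk hvK => by
      by_cases hvk' : (v : ℕ) = k
      · obtain rfl : v = ⟨k, hk⟩ := Fin.ext hvk'
        exact h hvK
      · exact hdone v (by omega) hvK
    refine .ite (fun hb => .ite (fun hb' => ?_) fun hb' => .skip ⟨?_, h, fun v => (hle v).trans
      (Nat.le_succ k), hnK, hskip ?_, hs⟩) fun hb => .skip ⟨?_, h, fun v => (hle v).trans
      (Nat.le_succ k), hnK, hskip ?_, hs⟩
    all_goals try simp only [Cond.Holds, Expr.eval, hv] at hb'
    all_goals simp only [Cond.Holds, Expr.eval, hv] at hb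
    · have hkK : (⟨k, hk⟩ : Fin n) ∉ K := fun h => by
        rw [if_pos h] at hKk
        exact absurd (hKk.symm.trans hb) one_ne_zero
      refine (WP.compLevels hL hin' hK' hs (x := ⟨k, hk⟩) hv hkK hI).mono ?_
      rintro t1 σ1 hF1 ⟨D, j, ht1, hD, hsm, hla, hLv1, hCp1, hSm1, hs1⟩
      refine ⟨?_, h.extend hb' k.succ_ne_zero (fun v => ?_) hD hsm hla hLv1 hCp1 hSm1, fun v => ?_,
        fun v => ?_, fun v => ?_, hs1⟩
      -- A component costs `O(n)` per vertex, including the linear overhead since it is not empty.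
      -- Components are disjoint, so the costs add up to `O(n^2)`.
      · have hdis : Disjoint (Finset.univ.filter fun v : Fin n => σ'.a aCp v ≠ 0)
            (Finset.univ.filter fun v : Fin n => D v ≠ 0) := by
          rw [Finset.disjoint_left]
          intro v h1 h2
          simp only [Finset.mem_filter, Finset.mem_univ, true_and] at h1 h2
          have := (h.comp v ⟨k, hk⟩ h1).1 ((hD v).1 h2).symm
          simp only at this hb'
          omega
        have hun : (Finset.univ.filter fun v : Fin n => (σ1.setV vS (k + 1)).a aCp v ≠ 0) =
            (Finset.univ.filter fun v : Fin n => σ'.a aCp v ≠ 0) ∪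
            (Finset.univ.filter fun v : Fin n => D v ≠ 0) := by
          ext v
          simp only [St.setV_a, Finset.mem_filter, Finset.mem_univ, true_and, Finset.mem_union,
            hCp1]
          by_cases h2 : D v = 0 <;> simp [h2]
        rw [hun, Finset.card_union_of_disjoint hdis, add_mul]
        have hpos : 1 ≤ (Finset.univ.filter fun v : Fin n => D v ≠ 0).card :=
          Finset.card_pos.2 ⟨⟨k, hk⟩, by simpa using (hD ⟨k, hk⟩).2 .rfl⟩
        have := Nat.mul_le_mul_right (120 * n + 120) hpos
        have e : (Finset.univ.filter fun v : Fin n => D v ≠ 0).card * (150 * n + 150) =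
          (Finset.univ.filter fun v : Fin n => D v ≠ 0).card * (120 * n + 120) +
          (Finset.univ.filter fun v : Fin n => D v ≠ 0).card * (30 * n + 30) := by ring
        omega
      · have := hle v
        omega
      · rw [St.setV_a, hCp1]
        have := hle v
        split_ifs
        · exact le_rfl
        · omega
      · rw [St.setV_a, hCp1]
        split_ifs with h1
        · intro _ hvK
          obtain ⟨p⟩ := (hD v).1 h1
          cases p using SimpleGraph.Walk.concatRec with
          | Hnil => exact hkK hvK
          | Hconcat p h => exact h.2.2 hvK
        · exact hnK v
      · intro hvk hvK
        rw [St.setV_a, hCp1]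
        split_ifs with h1
        · exact k.succ_ne_zero
        · refine hdone v ?_ hvK
          have : (v : ℕ) ≠ k := fun h => h1 (by
            rw [show v = ⟨k, hk⟩ from Fin.ext h, hD])
          omega
    · change _ ≤ 5 * (k + 1) + (Finset.univ.filter fun v : Fin n => σ'.a aCp v ≠ 0).card * _
      omega
    · exact fun _ => hb'
    · change _ ≤ 5 * (k + 1) + (Finset.univ.filter fun v : Fin n => σ'.a aCp v ≠ 0).card * _
      omega
    · intro hkK
      rw [if_neg hkK] at hKk
      exact absurd hKk hb
  · rintro t σ' - ⟨s, rfl, ht, h, -, hnK, hdone, -⟩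
    refine ⟨?_, h, fun v => ⟨hnK v, hdone v v.2⟩⟩
    have hc : (Finset.univ.filter fun v : Fin n => σ'.a aCp v ≠ 0).card ≤ n :=
      (Finset.card_le_univ _).trans (by simp)
    have := Nat.mul_le_mul_right (150 * n + 150) hc
    nlinarith

end Imp

/-! ### Best neighbours within and above a level -/

namespace Imp

open Imp.Expr WordRAM

/-- Choose best neighbours in the level above and in the same level. -/
def chooseNbrs : Cmd :=
  .for vS (const 0) (var vN) ((.set vCnt (const 0) ;;
    .forNbr vI vW vS (.when (.eq (arr aLv (var vW)) (add (arr aLv (var vS)) (const 1)))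
      (.inc vCnt))) ;; .store aUp (var vS) (var vCnt)) ;;
  .for vS (const 0) (var vN) (.set vBest (const 0) ;; .set vNx (var vN) ;;
    bestNbr (.eq (arr aLv (var vW)) (add (arr aLv (var vS)) (const 1))) vI vW vS vBest vNx aUp ;;
    .store aNx (var vS) (var vNx)) ;;
  .store aNx (var vN) (var vN) ;;
  .for vS (const 0) (var vN) (.set vBest (add (arr aUp (var vS)) (const 1)) ;;
    .set vNx (var vS) ;;
    bestNbr (.eq (arr aLv (var vW)) (arr aLv (var vS))) vI vW vS vBest vNx aUp ;;
    .store aHor (var vS) (var vNx))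

/-- Comparing numbers of upper neighbours is enough, because in a ladder the upper neighbourhoods of
a level are nested. The entry `n` of `aNx` encodes a missing upper neighbour. In the horizontal
search the vertex itself is a candidate, so a result always exists. -/
theorem WP.chooseNbrs {n : ℕ} {G : SimpleGraph (Fin n)} [DecidableRel G.Adj]
    {L : Fin n → List (Fin n)} (hL : IsAdjLists G L) {σ : St} (hin : Input L σ)
    (Lv up : Fin n → ℕ) (hLv : ∀ v : Fin n, σ.a aLv v = Lv v)
    (hup : ∀ v, up v = (Finset.univ.filter fun w => G.Adj v w ∧ Lv w = Lv v + 1).card) :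
    WP chooseNbrs σ fun t σ' => t ≤ 20 * n ^ 2 + 30 * n + 10 ∧
      (∀ u : Fin n, (σ'.a aNx u = n ∧ ∀ w, G.Adj u w → Lv w ≠ Lv u + 1) ∨
        ∃ w : Fin n, σ'.a aNx u = w ∧ G.Adj u w ∧ Lv w = Lv u + 1 ∧
          ∀ w', G.Adj u w' → Lv w' = Lv u + 1 → up w' ≤ up w) ∧ σ'.a aNx n = n ∧
      ∀ u : Fin n, ∃ w : Fin n, σ'.a aHor u = w ∧ (w = u ∨ G.Adj u w) ∧ Lv w = Lv u ∧
        ∀ w', w' = u ∨ G.Adj u w' → Lv w' = Lv u → up w' ≤ up w := by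
  refine .seq' (WP.fill (a := aUp) hin up (fun _ => 6 * n + 4) (by decide) ?_) ?_
  · intro v σ' hF hv _
    have hin' : Input L σ' := hin.of_eq (hF.v _ (by decide)) (hF.a _ (by decide))
    have hLv' : ∀ v : Fin n, σ'.a aLv v = Lv v := fun v => by rw [hF.a _ (by decide), hLv]
    refine .seq' (WP.countNbr (fun w => Lv w = Lv v + 1) hin' v hv (by decide) ?_) ?_
    · intro σ'' y h1 h2 h3
      simp only [Cond.Holds, Expr.eval, h3, h2, hLv', h1 vS (by decide) (by decide) (by decide), hv]
    rintro t1 σ1 hF1 ⟨ht1, hc1⟩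
    rw [hL.countP_eq, ← hup] at hc1
    have hv1 : σ1.v vS = v := (hF1.v _ (by decide)).trans hv
    have := hL.length_le v
    refine .store ⟨by omega, ?_, fun i hi => ?_⟩
    · simp [Expr.eval, hv1, hc1]
    · simp [Expr.eval, hv1, Function.update_of_ne hi, hF1.a aUp (by decide)]
  rintro t1 σ1 hF1 ⟨ht1, hup1⟩
  have hin1 : Input L σ1 := hin.of_eq (hF1.v _ (by decide)) (hF1.a _ (by decide))
  have hLv1 : ∀ v : Fin n, σ1.a aLv v = Lv v := fun v => by rw [hF1.a _ (by decide), hLv]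
  refine .seq' (WP.fillRel (a := aNx) hin1 (fun u m => (m = n ∧ ∀ w, G.Adj u w → Lv w ≠ Lv u + 1) ∨
    ∃ w : Fin n, m = w ∧ G.Adj u w ∧ Lv w = Lv u + 1 ∧
      ∀ w', G.Adj u w' → Lv w' = Lv u + 1 → up w' ≤ up w) (fun _ => 7 * n + 5) (by decide) ?_) ?_
  · intro u σ' hF hv _
    have hin' : Input L σ' := hin1.of_eq (hF.v _ (by decide)) (hF.a _ (by decide))
    have hLv' : ∀ v : Fin n, σ'.a aLv v = Lv v := fun v => by rw [hF.a _ (by decide), hLv1]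
    have hup' : ∀ v : Fin n, σ'.a aUp v = up v := fun v => by rw [hF.a _ (by decide), hup1]
    refine .seq (.set (.seq (.set ?_)))
    refine .seq' (WP.bestNbr (fun w => Lv w = Lv u + 1) (hin'.of_eq (by simp) (by simp)) u
      (by simpa using hv) (by decide) ?_) ?_
    · intro σ'' y h1 h2 h3
      simp [Cond.Holds, Expr.eval, h3, h2, hLv', h1 vS (by decide), hv]
    rintro t2 σ2 hF2 ⟨ht2, g1, g2, g3⟩
    have hv2 : σ2.v vS = u := (hF2.v _ (by decide)).trans (by simpa using hv)
    have := hL.length_le u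
    refine .store ⟨by omega, ?_, fun i hi => ?_⟩
    · simp only [Expr.eval, hv2, St.setA_a, if_true, Function.update_self]
      rcases g3 with ⟨g3, g4⟩ | ⟨w, hw, hwP, hwy, hwm⟩
      · refine .inl ⟨by simpa [hin'.size, Expr.eval] using g4, fun w huw hw => ?_⟩
        have e1 := g1 w (((hL u).2 w).2 huw) hw
        rw [g3] at e1
        simp [Expr.eval] at e1
      · refine .inr ⟨w, hwy, ((hL u).2 w).1 hw, hwP, fun w' h1 h2 => ?_⟩
        have e1 := g1 w' (((hL u).2 w').2 h1) h2
        rw [hwm] at e1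
        simpa [hup'] using e1
    · simp [Expr.eval, hv2, Function.update_of_ne hi, hF2.a aNx (by decide)]
  rintro t2 σ2 hF2 ⟨ht2, hnx2⟩
  have hin2 : Input L σ2 := hin1.of_eq (hF2.v _ (by decide)) (hF2.a _ (by decide))
  refine .seq (.store ?_)
  set σ3 := σ2.setA aNx ((var vN).eval σ2) ((var vN).eval σ2) with hσ3
  have hin3 : Input L σ3 := hin2.of_eq (by simp [hσ3]) (by simp [hσ3])
  have hLv3 : ∀ v : Fin n, σ3.a aLv v = Lv v := fun v => by
    simp [hσ3, hF2.a aLv (by decide), hLv1]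
  have hup3 : ∀ v : Fin n, σ3.a aUp v = up v := fun v => by
    simp [hσ3, hF2.a aUp (by decide), hup1]
  refine (WP.fillRel (a := aHor) hin3 (fun u m => ∃ w : Fin n, m = w ∧ (w = u ∨ G.Adj u w) ∧
    Lv w = Lv u ∧ ∀ w', w' = u ∨ G.Adj u w' → Lv w' = Lv u → up w' ≤ up w)
    (fun _ => 7 * n + 5) (by decide) ?_).mono ?_
  · intro u σ' hF hv _
    have hin' : Input L σ' := hin3.of_eq (hF.v _ (by decide)) (hF.a _ (by decide))
    have hLv' : ∀ v : Fin n, σ'.a aLv v = Lv v := fun v => by rw [hF.a _ (by decide), hLv3]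
    have hup' : ∀ v : Fin n, σ'.a aUp v = up v := fun v => by rw [hF.a _ (by decide), hup3]
    refine .seq (.set (.seq (.set ?_)))
    refine .seq' (WP.bestNbr (fun w => Lv w = Lv u) (hin'.of_eq (by simp) (by simp)) u
      (by simpa using hv) (by decide) ?_) ?_
    · intro σ'' y h1 h2 h3
      simp [Cond.Holds, Expr.eval, h3, h2, hLv', h1 vS (by decide), hv]
    rintro t2 σ2 hF2 ⟨ht2, g1, g2, g3⟩
    have hv2 : σ2.v vS = u := (hF2.v _ (by decide)).trans (by simpa using hv)
    have := hL.length_le u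
    refine .store ⟨by omega, ?_, fun i hi => ?_⟩
    · simp only [Expr.eval, hv2, St.setA_a, if_true, Function.update_self]
      simp only [St.setV_v, St.setV_a, Expr.eval, hv, hup', show vBest ≠ vNx by decide,
        show vS ≠ vBest by decide, if_true, if_false] at g1 g2 g3
      rcases g3 with ⟨g3, g4⟩ | ⟨w, hw, hwP, hwy, hwm⟩
      · refine ⟨u, g4, .inl rfl, rfl, fun w' h1 h2 => ?_⟩
        rcases h1 with rfl | h1
        · exact le_rfl
        · have e1 := g1 w' (((hL u).2 w').2 h1) h2
          omega
      · refine ⟨w, hwy, .inr (((hL u).2 w).1 hw), hwP, fun w' h1 h2 => ?_⟩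
        rcases h1 with rfl | h1
        · omega
        · have e1 := g1 w' (((hL u).2 w').2 h1) h2
          omega
    · simp [Expr.eval, hv2, Function.update_of_ne hi, hF2.a aHor (by decide)]
  · rintro t4 σ4 hF4 ⟨ht4, hhor⟩
    have hnx4 : σ4.a aNx = Function.update (σ2.a aNx) n n := by
      rw [hF4.a _ (by decide)]
      simp [hσ3, hin2.size]
    refine ⟨?_, fun u => ?_, by simp [hnx4], hhor⟩
    · simp only [Finset.sum_const, smul_eq_mul, Finset.card_univ, Fintype.card_fin] at ht1 ht2 ht4
      nlinarith
    · rw [hnx4, Function.update_of_ne u.2.ne]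
      exact hnx2 u

end Imp

/-! ### Distances in `G` and in `G - K` -/

theorem delGraph_le {n : ℕ} (G : SimpleGraph (Fin n)) (K : Finset (Fin n)) :
    Imp.delGraph G K ≤ G := fun _ _ h => h.1

/-- Hence `n` can represent an infinite distance, and tables of `n + 1` iterates are long enough. -/
theorem dist_lt_card_of_reachable {n : ℕ} {G : SimpleGraph (Fin n)} {u v : Fin n}
    (h : G.Reachable u v) : G.dist u v < n := by
  obtain ⟨p, hp, hl⟩ := h.exists_path_of_dist
  have := hp.length_lt
  rw [Fintype.card_fin] at this
  omega

/-- A shortest walk either meets `K` or is a walk in `G - K`. -/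
theorem exists_dist_add_dist_le_or {n : ℕ} {G : SimpleGraph (Fin n)} (hG : G.Connected)
    (K : Finset (Fin n)) (u v : Fin n) :
    (∃ x ∈ K, G.dist x u + G.dist x v ≤ G.dist u v) ∨
      (Imp.delGraph G K).Reachable u v ∧ (Imp.delGraph G K).dist u v ≤ G.dist u v := by
  obtain ⟨p, hp⟩ := hG.exists_walk_length_eq_dist u v
  by_cases h : ∃ x ∈ K, x ∈ p.support
  · left
    obtain ⟨x, hxK, hx⟩ := h
    refine ⟨x, hxK, ?_⟩
    have h1 := SimpleGraph.dist_le (p.takeUntil x hx)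
    have h2 := SimpleGraph.dist_le (p.dropUntil x hx)
    have h3 := congrArg SimpleGraph.Walk.length (p.take_spec hx)
    rw [SimpleGraph.Walk.length_append] at h3
    rw [SimpleGraph.dist_comm] at h1
    omega
  · right
    push Not at h
    have hK : ∀ x ∈ p.support, x ∉ K := fun x hx hxK => h x hxK hx
    have he : ∀ e ∈ p.edges, e ∈ (Imp.delGraph G K).edgeSet := by
      intro e
      induction e with
      | _ a b =>
        intro he
        exact ⟨p.adj_of_mem_edges he, hK a (p.fst_mem_support_of_mem_edges he),
          hK b (p.snd_mem_support_of_mem_edges he)⟩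
    refine ⟨(p.transfer _ he).reachable, (SimpleGraph.dist_le (p.transfer _ he)).trans ?_⟩
    rw [SimpleGraph.Walk.length_transfer, hp]

theorem dist_le_dist_delGraph {n : ℕ} {G : SimpleGraph (Fin n)} {K : Finset (Fin n)} {u v : Fin n}
    (h : (Imp.delGraph G K).Reachable u v) : G.dist u v ≤ (Imp.delGraph G K).dist u v := by
  obtain ⟨p, hp⟩ := h.exists_walk_length_eq_dist
  rw [← hp, ← SimpleGraph.Walk.length_map (.ofLE (delGraph_le G K)) p]
  exact SimpleGraph.dist_le _

theorem dist_eq_two {V : Type*} {G : SimpleGraph V} {u v a : V} (hne : u ≠ v) (hadj : ¬ G.Adj u v)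
    (h1 : G.Adj u a) (h2 : G.Adj a v) : G.dist u v = 2 := by
  have hle := SimpleGraph.dist_le (.cons h1 (.cons h2 .nil))
  have h0 : G.dist u v ≠ 1 := fun h => hadj (SimpleGraph.dist_eq_one_iff_adj.1 h)
  have h3 := (h1.reachable.trans h2.reachable).pos_dist_of_ne hne
  simp only [SimpleGraph.Walk.length_cons, SimpleGraph.Walk.length_nil] at hle
  omega

namespace IsCompLevels

variable {n : ℕ} {G : SimpleGraph (Fin n)} {K : Finset (Fin n)} {Lv Cp Sm up : Fin n → ℕ}

/-- The choice of best neighbours, see `Imp.chooseNbrs`. -/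
structure IsChoice (G : SimpleGraph (Fin n)) (Lv up : Fin n → ℕ) (nx hor : ℕ → ℕ) : Prop where
  up_eq : ∀ [DecidableRel G.Adj] v,
    up v = (Finset.univ.filter fun w => G.Adj v w ∧ Lv w = Lv v + 1).card
  nx_spec : ∀ u : Fin n, (nx u = n ∧ ∀ w, G.Adj u w → Lv w ≠ Lv u + 1) ∨
    ∃ w : Fin n, nx u = w ∧ G.Adj u w ∧ Lv w = Lv u + 1 ∧
      ∀ w', G.Adj u w' → Lv w' = Lv u + 1 → up w' ≤ up w
  nx_last : nx n = n
  hor_spec : ∀ u : Fin n, ∃ w : Fin n, hor u = w ∧ (w = u ∨ G.Adj u w) ∧ Lv w = Lv u ∧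
    ∀ w', w' = u ∨ G.Adj u w' → Lv w' = Lv u → up w' ≤ up w

/-- This turns `IsLadder.dist_eq` into tests on the computed tables, which refer to `G` and to the
levels of all components. The two views agree because a vertex of nonzero level is outside `K`, so
an edge of `G` between such vertices stays in its component of `G - K`. -/
theorem dist_eq (h : IsCompLevels (Imp.delGraph G K) Lv Cp Sm) (hK : ∀ v, Cp v ≠ 0 ↔ v ∉ K)
    {nx hor : ℕ → ℕ} (hc : IsChoice G Lv up nx hor) {u v : Fin n} (hu : u ∉ K) (hs : Sm u = 0)
    (huv : Cp u = Cp v) {j : ℕ} (hv : Lv v = Lv u + (j + 1)) :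
    j < n ∧ ((∃ p : Fin n, nx^[j] u = p ∧ G.Adj p v) → (Imp.delGraph G K).dist u v = j + 1) ∧
      ((¬ ∃ p : Fin n, nx^[j] u = p ∧ G.Adj p v) →
        (Lv u = 1 ∨ ∃ p : Fin n, nx^[j] (hor u) = p ∧ G.Adj p v) →
          (Imp.delGraph G K).dist u v = j + 2) ∧
      ((¬ ∃ p : Fin n, nx^[j] u = p ∧ G.Adj p v) →
        ¬ (Lv u = 1 ∨ ∃ p : Fin n, nx^[j] (hor u) = p ∧ G.Adj p v) →
          (Imp.delGraph G K).dist u v = j + 3) := by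
  classical
  set H := Imp.delGraph G K with hH
  have hCu : Cp u ≠ 0 := (hK u).2 hu
  have hr : H.Reachable u v := (h.comp u v hCu).2 huv
  obtain ⟨D, hlad, hD0, hDLv⟩ := h.ladder u hCu hs
  have hnK : ∀ {w}, Lv w ≠ 0 → w ∉ K := fun hw => (hK _).1 ((h.ne_zero _).1 hw)
  have hLvD : ∀ {w}, D w ≠ 0 → Lv w = D w := fun hw => hDLv _ ((hD0 _).1 hw)
  have hadj : ∀ {a b}, D a ≠ 0 → G.Adj a b → Lv b ≠ 0 → H.Adj a b ∧ D b = Lv b := by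
    intro a b ha hab hb
    have hab' : H.Adj a b := ⟨hab, hnK (by rw [hLvD ha]; exact ha), hnK hb⟩
    exact ⟨hab', (hDLv b (((hD0 a).1 ha).trans hab'.reachable)).symm⟩
  have hadj' : ∀ {a b}, D a ≠ 0 → H.Adj a b → Lv b = D b := fun ha hab =>
    hLvD (hlad.closed _ _ hab ha).1
  have hup : ∀ {w}, D w ≠ 0 → up w =
      (Finset.univ.filter fun x => H.Adj w x ∧ D x = D w + 1).card := by
    intro w hw
    rw [hc.up_eq]
    congr 1
    ext x
    simp only [Finset.mem_filter, Finset.mem_univ, true_and, hLvD hw]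
    constructor
    · rintro ⟨h1, h2⟩
      obtain ⟨h3, h4⟩ := hadj hw h1 (by omega)
      exact ⟨h3, by omega⟩
    · rintro ⟨h1, h2⟩
      exact ⟨h1.1, by rw [hadj' hw h1, h2]⟩
  have hbest : ∀ {a b}, D a ≠ 0 → D a = D b → up a ≤ up b → IsLadder.UpLE H D a b :=
    fun ha hab hle => hlad.upLE_of_card_le ha hab (by rwa [hup ha, hup (by omega)] at hle)
  have hnx : ∀ a : Fin n, D a ≠ 0 → (nx a = n ∧ ∀ w, H.Adj a w → D w ≠ D a + 1) ∨
      ∃ w : Fin n, nx a = w ∧ H.Adj a w ∧ D w = D a + 1 ∧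
        ∀ w', H.Adj a w' → D w' = D a + 1 → IsLadder.UpLE H D w' w := by
    intro a ha
    have hLa := hLvD ha
    rcases hc.nx_spec a with ⟨h1, h2⟩ | ⟨w, h1, h2, h3, h4⟩
    · refine .inl ⟨h1, fun w haw hw => h2 w haw.1 ?_⟩
      rw [hadj' ha haw, hw, hLa]
    · obtain ⟨h5, h6⟩ := hadj ha h2 (by omega)
      refine .inr ⟨w, h1, h5, by omega, fun w' h7 h8 => hbest (by omega) (by omega) ?_⟩
      exact h4 w' h7.1 (by rw [hadj' ha h7, h8, hLa])
  choose g hg1 hg2 hg3 hg4 using hc.hor_spec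
  have hgH : ∀ a, D a ≠ 0 → (g a = a ∨ H.Adj a (g a)) ∧ D (g a) = D a := by
    intro a ha
    have hLa := hLvD ha
    rcases hg2 a with h1 | h1
    · exact ⟨.inl h1, by rw [h1]⟩
    · have h2 := hg3 a
      obtain ⟨h3, h4⟩ := hadj ha h1 (by omega)
      exact ⟨.inr h3, by omega⟩
  have hgb : ∀ a w, D a ≠ 0 → w = a ∨ H.Adj a w → D w = D a → IsLadder.UpLE H D w (g a) := by
    intro a w ha haw hw
    refine hbest (by omega) (by rw [hw, (hgH a ha).2]) (hg4 a w (haw.imp_right fun h => h.1) ?_)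
    rw [hLvD ha, hLvD (by omega), hw]
  -- As long as the iterates are vertices, each is one level above the previous one. So the last
  -- vertex is just below `v`, and adjacency in `G` is all that remains to be tested.
  have hiter : ∀ (i : ℕ) (a p : Fin n), D a ≠ 0 → nx^[i] a = p → D p = D a + i := by
    intro i
    induction i with
    | zero =>
      intro a p _ hp
      rw [show a = p from Fin.ext hp]
      rfl
    | succ i ih =>
      intro a p ha hp
      rw [Function.iterate_succ_apply] at hp
      rcases hnx a ha with ⟨h1, -⟩ | ⟨w, h1, -, h2, -⟩
      · rw [h1, Function.iterate_fixed hc.nx_last] at hp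
        have := p.2
        omega
      · rw [h1] at hp
        have := ih w p (by omega) hp
        omega
  have hDu : D u ≠ 0 := (hD0 u).2 .rfl
  have hDv : D v ≠ 0 := (hD0 v).2 hr
  rw [hLvD hDu, hLvD hDv] at hv
  have hclimb : ∀ a : Fin n, D a = D u → (IsLadder.Climb H D (j + 1) a v ↔
      ∃ p : Fin n, nx^[j] a = p ∧ G.Adj p v) := by
    intro a ha
    rw [IsLadder.climb_iff hc.nx_last hnx (by omega)]
    constructor
    · rintro ⟨p, h1, h2, -⟩
      exact ⟨p, h1, h2.1⟩
    · rintro ⟨p, h1, h2⟩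
      have h3 := hiter j a p (by omega) h1
      exact ⟨p, h1, (hadj (by omega) h2 (by rw [hLvD hDv]; exact hDv)).1, by omega⟩
  obtain ⟨-, e1, e2, e3⟩ := hlad.dist_eq (fun a ha => (hgH a ha).2) (fun a ha => (hgH a ha).1) hgb
    hDu hv
  rw [hclimb u rfl, hclimb (g u) (hgH u hDu).2, ← hg1 u, ← hLvD hDu] at *
  refine ⟨?_, e1, e2, e3⟩
  have hlt := dist_lt_card_of_reachable hr
  by_cases hA : ∃ p : Fin n, nx^[j] u = p ∧ G.Adj p v
  · have := e1 hA
    omega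
  · by_cases hB : Lv u = 1 ∨ ∃ p : Fin n, nx^[j] (hor u) = p ∧ G.Adj p v
    · have := e2 hA hB
      omega
    · have := e3 hA hB
      omega

theorem dist_eq_two (h : IsCompLevels (Imp.delGraph G K) Lv Cp Sm) (hK : ∀ v, Cp v ≠ 0 ↔ v ∉ K)
    {u v : Fin n} (hu : u ∉ K) (huv : Cp u = Cp v) (hne : u ≠ v) (hadj : ¬ G.Adj u v)
    (hs : Sm u ≠ 0 ∨ Lv u = Lv v) : (Imp.delGraph G K).dist u v = 2 := by
  have hCu : Cp u ≠ 0 := (hK u).2 hu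
  have hr := (h.comp u v hCu).2 huv
  have hadj' : ¬ (Imp.delGraph G K).Adj u v := fun h => hadj h.1
  by_cases hs0 : Sm u = 0
  · obtain ⟨D, hlad, hD0, hDLv⟩ := h.ladder u hCu hs0
    obtain ⟨a, h1, h2⟩ := hlad.exists_common_neighbor ((hD0 u).2 .rfl)
      (show D u = D v by rw [← hDLv u .rfl, ← hDLv v hr, hs.resolve_left (not_not.2 hs0)])
    exact _root_.dist_eq_two hne hadj' h1 h2
  · obtain ⟨a, h1, h2⟩ := h.small u v hCu hs0 hr hne hadj'
    exact _root_.dist_eq_two hne hadj' h1 h2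

end IsCompLevels

/-! ### Distances in `G - K` in constant time per pair -/

namespace Imp

open Imp.Expr WordRAM

/-- The adjacency matrix. -/
def buildAdj : Cmd :=
  .for vS (const 0) (var vN) (.forNbr vI vW vS
    (.store aAdj (add (mul (var vS) (var vN)) (var vW)) (const 1)))

/-- The row index is an arbitrary number, since iterates of `aNx` may be `n`; such a row contains no
`1`, and the test fails as it should. -/
theorem WP.buildAdj {n : ℕ} {G : SimpleGraph (Fin n)} {L : Fin n → List (Fin n)}
    (hL : IsAdjLists G L) {σ : St} (hin : Input L σ) (h0 : ∀ i, σ.a aAdj i = 0) :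
    WP buildAdj σ fun t σ' => t ≤ 4 * n ^ 2 + 4 * n + 2 ∧ ∀ (m : ℕ) (v : Fin n),
      σ'.a aAdj (m * n + v) = 1 ↔ ∃ p : Fin n, m = p ∧ G.Adj p v := by
  refine (WP.for (fun k σ' => ∀ (m : ℕ) (v : Fin n),
      σ'.a aAdj (m * n + v) = 1 ↔ ∃ p : Fin n, m = p ∧ (p : ℕ) < k ∧ G.Adj p v)
    (fun _ => 4 * n + 2) 0 n rfl (Nat.zero_le n) (by decide) ?_ ?_ ?_).mono ?_
  · exact fun σ' hF => (hF.v vN (by decide)).trans hin.size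
  · intro m v
    simp [h0]
  · intro k σ' _ hk hF hv hI
    have hin' : Input L σ' := hin.of_eq (hF.v _ (by decide)) (hF.a _ (by decide))
    have hlen := hL.length_le ⟨k, hk⟩
    refine (WP.forNbr (fun j σ'' => ∀ (m : ℕ) (v : Fin n), σ''.a aAdj (m * n + v) = 1 ↔
      (∃ p : Fin n, m = p ∧ (p : ℕ) < k ∧ G.Adj p v) ∨ m = k ∧ v ∈ (L ⟨k, hk⟩).take j) 1
      hin' ⟨k, hk⟩ hv (by decide) ?_ ?_).mono ?_
    · intro m m' v
      simp [hI m' v]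
    · intro j hj σ2 hF2 hI2
      have hv2 : σ2.v vS = k := (hF2.v _ (by decide)).trans hv
      have hn2 : σ2.v vN = n := (hF2.v _ (by decide)).trans hin'.size
      refine .store ⟨le_rfl, fun _ m v => ?_⟩
      simp only [Expr.eval, St.setV_v, St.setV_a, St.setA_a, if_true, hv2, hn2,
        show vS ≠ vW by decide, show vN ≠ vW by decide, if_false]
      rw [List.take_succ_eq_append_getElem hj, List.mem_append, List.mem_singleton]
      by_cases heq : m = k ∧ v = (L ⟨k, hk⟩)[j]
      · simp [heq.1, heq.2]
      · rw [Function.update_of_ne, hI2 m v]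
        · refine or_congr_right (and_congr_right fun hm => ?_)
          rw [or_iff_left fun h => heq ⟨hm, h⟩]
        · intro h
          obtain ⟨h1, h2⟩ := pair_index v.2 (Fin.is_lt _) h
          exact heq ⟨h1, Fin.ext h2⟩
    · rintro t2 σ2 - ⟨ht2, hI2⟩
      refine ⟨by omega, fun m v => ?_⟩
      rw [St.setV_a, hI2 m v, List.take_length, (hL _).2]
      constructor
      · rintro (⟨p, h1, h2, h3⟩ | ⟨rfl, h⟩)
        · exact ⟨p, h1, by omega, h3⟩
        · exact ⟨⟨m, hk⟩, rfl, by simp, h⟩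
      · rintro ⟨p, h1, h2, h3⟩
        by_cases hp : (p : ℕ) = k
        · refine .inr ⟨by omega, ?_⟩
          rwa [← show p = ⟨k, hk⟩ from Fin.ext hp]
        · exact .inl ⟨p, h1, by omega, h3⟩
  · rintro t σ' - ⟨ht, hI⟩
    refine ⟨?_, fun m v => by simp [hI m v]⟩
    simp only [Finset.sum_const, smul_eq_mul, Nat.card_Ico, Nat.sub_zero] at ht
    nlinarith

/-- `a[j] := nxt^j(e)` for all `j ≤ n`. -/
def iterArr (a : ℕ) (e : Expr) : Cmd :=
  .store a (const 0) e ;; .for vV (const 0) (var vN)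
    (.store a (add (var vV) (const 1)) (arr aNx (arr a (var vV))))

theorem WP.iterArr {n : ℕ} {L : Fin n → List (Fin n)} {a : ℕ} {e : Expr} {σ : St}
    (hin : Input L σ) (ha : a ≠ aNx) :
    WP (iterArr a e) σ fun t σ' => t ≤ 3 * n + 3 ∧
      ∀ j ≤ n, σ'.a a j = (σ.a aNx)^[j] (e.eval σ) := by
  refine .seq (.store ?_)
  refine (WP.for (fun k σ' => ∀ j ≤ k, σ'.a a j = (σ.a aNx)^[j] (e.eval σ)) (fun _ => 1) 0 n rfl
    (Nat.zero_le n) (by simp [Cmd.vars]) ?_ ?_ ?_).mono ?_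
  · exact fun σ' hF => (hF.v vN (by simp [Cmd.for, Cmd.vars])).trans hin.size
  · intro j hj
    obtain rfl : j = 0 := by omega
    simp
  · intro k σ' _ hk hF hv hI
    have hnx : σ'.a aNx = σ.a aNx := by
      rw [hF.a _ (by simpa [Cmd.for, Cmd.arrs] using ha.symm)]
      simp [ha.symm]
    refine .store ⟨le_rfl, fun j hj => ?_⟩
    simp only [Expr.eval, hv, hnx, St.setV_a, St.setA_a, if_true, hI k le_rfl]
    by_cases h : j = k + 1
    · rw [h, Function.update_self, Function.iterate_succ_apply']
    · rw [Function.update_of_ne h, hI j (by omega)]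
  · rintro t σ' - ⟨ht, hI⟩
    simp only [Finset.sum_const, smul_eq_mul, Nat.card_Ico] at ht
    exact ⟨by omega, hI⟩

/-- The distance of `vS` and `vT` in `G - K`; `n` if they are in different components, and `0` if
`vT` has the smaller level. -/
def pairDist : Cmd :=
  .ite (.eq (arr aCp (var vS)) (arr aCp (var vT)))
    (.ite (.lt (arr aLv (var vT)) (arr aLv (var vS))) (.set vCur (const 0))
      (.ite (.eq (var vS) (var vT)) (.set vCur (const 0))
        (.ite (.eq (arr aAdj (add (mul (var vS) (var vN)) (var vT))) (const 1))
          (.set vCur (const 1))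
          (.ite (.lt (const 0) (arr aSm (var vS))) (.set vCur (const 2))
            (.ite (.eq (arr aLv (var vS)) (arr aLv (var vT))) (.set vCur (const 2))
              (.set vR (sub (arr aLv (var vT)) (arr aLv (var vS))) ;;
                .ite (.eq (arr aAdj (add (mul (arr aPA (sub (var vR) (const 1))) (var vN))
                    (var vT))) (const 1)) (.set vCur (var vR))
                  (.ite (.eq (arr aLv (var vS)) (const 1)) (.set vCur (add (var vR) (const 1)))
                    (.ite (.eq (arr aAdj (add (mul (arr aPB (sub (var vR) (const 1))) (var vN))
                        (var vT))) (const 1)) (.set vCur (add (var vR) (const 1)))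
                      (.set vCur (add (var vR) (const 2)))))))))))
    (.set vCur (var vN))

/-- The arrays that are used to compute distances in `G - K`. -/
structure IsDistData {n : ℕ} (G : SimpleGraph (Fin n)) (K : Finset (Fin n)) (σ : St) : Prop where
  size : σ.v vN = n
  levels : IsCompLevels (delGraph G K) (fun v : Fin n => σ.a aLv v) (fun v : Fin n => σ.a aCp v)
    (fun v : Fin n => σ.a aSm v)
  comp : ∀ v : Fin n, σ.a aCp v ≠ 0 ↔ v ∉ K
  choice : ∃ up, IsCompLevels.IsChoice G (fun v : Fin n => σ.a aLv v) up (σ.a aNx) (σ.a aHor)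
  adj : ∀ (m : ℕ) (v : Fin n), σ.a aAdj (m * n + v) = 1 ↔ ∃ p : Fin n, m = p ∧ G.Adj p v

theorem IsDistData.of_eq {n : ℕ} {G : SimpleGraph (Fin n)} {K : Finset (Fin n)} {σ σ' : St}
    (h : IsDistData G K σ) (hN : σ'.v vN = σ.v vN)
    (ha : ∀ a ∈ [aLv, aCp, aSm, aNx, aHor, aAdj], σ'.a a = σ.a a) : IsDistData G K σ' := by
  have h1 := ha aLv (by decide)
  have h2 := ha aCp (by decide)
  have h3 := ha aSm (by decide)
  have h4 := ha aNx (by decide)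
  have h5 := ha aHor (by decide)
  have h6 := ha aAdj (by decide)
  exact ⟨hN.trans h.size, by rw [h1, h2, h3]; exact h.levels, by rw [h2]; exact h.comp,
    by rw [h1, h4, h5]; exact h.choice, by rw [h6]; exact h.adj⟩

/-- The result of `pairDist`. -/
structure IsPairDist {n : ℕ} (H : SimpleGraph (Fin n)) (Lv : ℕ → ℕ) (u v : Fin n) (c : ℕ) :
    Prop where
  of_not_reachable : ¬ H.Reachable u v → c = n
  of_lt : H.Reachable u v → Lv v < Lv u → c = 0
  of_le : H.Reachable u v → Lv u ≤ Lv v → c = H.dist u v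

/-- A pair whose second vertex has the smaller level gets the harmless value `0`, because the same
pair is also treated in the other order. -/
theorem WP.pairDist {n : ℕ} {G : SimpleGraph (Fin n)} {K : Finset (Fin n)} {σ : St}
    (hd : IsDistData G K σ) {u v : Fin n} (hu : σ.v vS = u) (hv : σ.v vT = v) (huK : u ∉ K)
    (hvK : v ∉ K) (hA : ∀ j ≤ n, σ.a aPA j = (σ.a aNx)^[j] u)
    (hB : ∀ j ≤ n, σ.a aPB j = (σ.a aNx)^[j] (σ.a aHor u)) :
    WP pairDist σ fun t σ' => t ≤ 12 ∧ IsPairDist (delGraph G K) (σ.a aLv) u v (σ'.v vCur) := by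
  obtain ⟨up, hch⟩ := hd.choice
  have hcomp := hd.levels.comp u v ((hd.comp u).2 huK)
  have hN := hd.size
  refine .ite (fun h1 => .ite (fun h2 => .set ⟨by omega, ?_⟩) fun h2 => .ite
    (fun h3 => .set ⟨by omega, ?_⟩) fun h3 => .ite (fun h4 => .set ⟨by omega, ?_⟩) fun h4 => .ite
    (fun h5 => .set ⟨by omega, ?_⟩) fun h5 => .ite (fun h6 => .set ⟨by omega, ?_⟩) fun h6 =>
    .seq (.set ?_)) fun h1 => .set ⟨by omega, ?_⟩
  all_goals simp only [Cond.Holds, Expr.eval, hu, hv] at h1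
  all_goals try have hr := hcomp.2 h1
  all_goals try simp only [Cond.Holds, Expr.eval, hu, hv] at h2
  all_goals try simp only [Cond.Holds, Expr.eval, hu, hv] at h3
  all_goals try simp only [Cond.Holds, Expr.eval, hu, hv, hN, hd.adj] at h4
  all_goals try simp only [Cond.Holds, Expr.eval, hu] at h5
  all_goals try simp only [Cond.Holds, Expr.eval, hu, hv] at h6
  · exact ⟨fun h => absurd hr h, fun _ _ => by simp [Expr.eval], fun _ h => by omega⟩
  · obtain rfl : u = v := Fin.ext h3
    exact ⟨fun h => absurd hr h, fun _ _ => by simp [Expr.eval], fun _ h => by simp [Expr.eval]⟩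
  · obtain ⟨p, hp, hpv⟩ := h4
    obtain rfl : u = p := Fin.ext hp
    refine ⟨fun h => absurd hr h, fun _ h => absurd h h2, fun _ _ => ?_⟩
    have hadj : (delGraph G K).Adj u v := ⟨hpv, huK, hvK⟩
    rw [SimpleGraph.dist_eq_one_iff_adj.2 hadj]
    simp [Expr.eval]
  all_goals try replace h4 : ¬ G.Adj u v := fun h => h4 ⟨u, rfl, h⟩
  all_goals try have hne : u ≠ v := fun h => h3 (congrArg _ h)
  · refine ⟨fun h => absurd hr h, fun _ h => absurd h h2, fun _ _ => ?_⟩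
    rw [hd.levels.dist_eq_two hd.comp huK h1 hne h4 (.inl (by omega))]
    simp [Expr.eval]
  · refine ⟨fun h => absurd hr h, fun _ h => absurd h h2, fun _ _ => ?_⟩
    rw [hd.levels.dist_eq_two hd.comp huK h1 hne h4 (.inr h6)]
    simp [Expr.eval]
  · obtain ⟨j, hj⟩ : ∃ j, σ.a aLv v = σ.a aLv u + (j + 1) := ⟨σ.a aLv v - σ.a aLv u - 1, by omega⟩
    obtain ⟨hjn, e1, e2, e3⟩ := hd.levels.dist_eq hd.comp hch huK (by omega) h1 hj
    have hR : (sub (arr aLv (var vT)) (arr aLv (var vS))).eval σ = j + 1 := by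
      simp only [Expr.eval, hu, hv]
      omega
    have hdist : ∀ {c}, c = (delGraph G K).dist u v →
        IsPairDist (delGraph G K) (σ.a aLv) u v c := fun hc =>
      ⟨fun h => absurd hr h, fun _ h => absurd h h2, fun _ _ => hc⟩
    rw [hR]
    refine .ite (fun h7 => .set ⟨by omega, hdist ?_⟩) fun h7 => .ite
      (fun h8 => .set ⟨by omega, hdist ?_⟩) fun h8 => .ite
      (fun h9 => .set ⟨by omega, hdist ?_⟩) fun h9 => .set ⟨by omega, hdist ?_⟩
    all_goals simp only [Cond.Holds, Expr.eval, St.setV_v, St.setV_a, hu, hv, hN, if_true,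
      show vS ≠ vR by decide, show vT ≠ vR by decide, show vN ≠ vR by decide, if_false,
      Nat.add_sub_cancel, hA j hjn.le, hB j hjn.le, hd.adj] at *
    · exact (e1 h7).symm
    · exact (e2 h7 (.inl h8)).symm
    · exact (e2 h7 (.inr h9)).symm
    · exact (e3 h7 (not_or.2 ⟨h8, h9⟩)).symm
  · have hr := fun h => h1 (hcomp.1 h)
    exact ⟨fun _ => by simp [Expr.eval, hN], fun h => absurd h hr, fun h => absurd h hr⟩

end Imp

/-! ### Including walks through the deletion set -/

namespace Imp

open Imp.Expr WordRAM

/-- The list `S` and the distances from its members. -/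
structure IsRowData {n : ℕ} (G : SimpleGraph (Fin n)) (S : List (Fin n)) (σ : St) : Prop where
  size : σ.v vN = n
  len : σ.v vLen = S.length
  entry : ∀ (j : ℕ) (hj : j < S.length), σ.a aIn (σ.v vBase + j) = (S[j] : ℕ)
  row : ∀ x ∈ S, ∀ v : Fin n, σ.a aRow (x * n + v) = G.dist x v

theorem IsRowData.of_eq {n : ℕ} {G : SimpleGraph (Fin n)} {S : List (Fin n)} {σ σ' : St}
    (h : IsRowData G S σ) (hv : ∀ x ∈ [vN, vLen, vBase], σ'.v x = σ.v x)
    (ha : ∀ a ∈ [aIn, aRow], σ'.a a = σ.a a) : IsRowData G S σ' := by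
  have h1 := hv vN (by decide)
  have h2 := hv vLen (by decide)
  have h3 := hv vBase (by decide)
  have h4 := ha aIn (by decide)
  have h5 := ha aRow (by decide)
  exact ⟨h1.trans h.size, h2.trans h.len, by rw [h3, h4]; exact h.entry, by rw [h5]; exact h.row⟩

/-- Improve the distance `vCur` of `vS` and `vT` by walks through the members of the list. -/
def viaList : Cmd :=
  .for vI (const 0) (var vLen) (.cmin vCur
    (add (arr aRow (add (mul (arr aIn (add (var vBase) (var vI))) (var vN)) (var vS)))
      (arr aRow (add (mul (arr aIn (add (var vBase) (var vI))) (var vN)) (var vT)))))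

/-- A sum of two table entries is not flat. The command `cmin` admits it nevertheless, as a minimum
never exceeds the old value. -/
theorem WP.viaList {n : ℕ} {G : SimpleGraph (Fin n)} {S : List (Fin n)} {σ : St}
    (h : IsRowData G S σ) {u v : Fin n} (hu : σ.v vS = u) (hv : σ.v vT = v) :
    WP viaList σ fun t σ' => t ≤ 3 * S.length + 2 ∧ σ'.v vCur ≤ σ.v vCur ∧
      (∀ x ∈ S, σ'.v vCur ≤ G.dist x u + G.dist x v) ∧
      (σ'.v vCur = σ.v vCur ∨ ∃ x ∈ S, σ'.v vCur = G.dist x u + G.dist x v) := by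
  refine (WP.for (fun k σ' => σ'.v vCur ≤ σ.v vCur ∧
      (∀ x ∈ S.take k, σ'.v vCur ≤ G.dist x u + G.dist x v) ∧
      (σ'.v vCur = σ.v vCur ∨ ∃ x ∈ S, σ'.v vCur = G.dist x u + G.dist x v)) (fun _ => 1) 0
    S.length rfl (Nat.zero_le _) (by decide) ?_ ?_ ?_).mono ?_
  · exact fun σ' hF => (hF.v _ (by decide)).trans h.len
  · simp
  · rintro k σ' - hk hF hkv ⟨h1, h2, h3⟩
    have h' : IsRowData G S σ' := h.of_eq (fun x hx => hF.v x (by revert x; decide))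
      (fun a ha => hF.a a (by revert a; decide))
    have hu' : σ'.v vS = u := (hF.v _ (by decide)).trans hu
    have hv' : σ'.v vT = v := (hF.v _ (by decide)).trans hv
    refine .cmin ⟨le_rfl, ?_⟩
    simp only [Expr.eval, hkv, h'.entry k hk, h'.size, hu', hv', h'.row _ (List.getElem_mem hk),
      St.setV_v, show vCur ≠ vI by decide, if_true, if_false]
    refine ⟨(min_le_left _ _).trans h1, fun x hx => ?_, ?_⟩
    · rw [List.take_succ_eq_append_getElem hk, List.mem_append, List.mem_singleton] at hx
      rcases hx with hx | rfl
      · exact (min_le_left _ _).trans (h2 x hx)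
      · exact min_le_right _ _
    · rcases min_choice (σ'.v vCur) (G.dist S[k] u + G.dist S[k] v) with hm | hm
      · rw [hm]
        exact h3
      · exact .inr ⟨S[k], List.getElem_mem hk, hm⟩
  · rintro t σ' - ⟨ht, h1, h2, h3⟩
    rw [List.take_length] at h2
    simp only [Finset.sum_const, smul_eq_mul, Nat.card_Ico, Nat.sub_zero] at ht
    exact ⟨by omega, h1, h2, h3⟩

/-- The maximum of `vAns` and the distances between the vertices `v` with `flag[v] = 0`. -/
def pairLoop : Cmd :=
  .for vS (const 0) (var vN) (.when (.eq (arr aFlag (var vS)) (const 0))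
    (iterArr aPA (var vS) ;; iterArr aPB (arr aHor (var vS)) ;;
    .for vT (const 0) (var vN) (.when (.eq (arr aFlag (var vT)) (const 0))
      (pairDist ;; viaList ;; .when (.lt (var vAns) (var vCur)) (.set vAns (var vCur))))))

/-- A shortest walk in `G` meets `S`, and then a sum of two rows attains its length, or it is a walk
in `G - S`. Conversely all candidates are at least the distance in `G`, also the value `n` for
different components; the only exception is `0` for a pair in the wrong order. -/
theorem IsPairDist.min_eq {n : ℕ} {G : SimpleGraph (Fin n)} (hG : G.Connected) {S : List (Fin n)}
    {Lv : ℕ → ℕ} {u v : Fin n} {c d : ℕ} (h : IsPairDist (delGraph G S.toFinset) Lv u v c)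
    (h1 : d ≤ c) (h2 : ∀ x ∈ S, d ≤ G.dist x u + G.dist x v)
    (h3 : d = c ∨ ∃ x ∈ S, d = G.dist x u + G.dist x v) :
    d ≤ G.dist u v ∧
      (G.dist u v ≤ d ∨ (delGraph G S.toFinset).Reachable u v ∧ Lv v < Lv u) := by
  constructor
  · rcases exists_dist_add_dist_le_or hG S.toFinset u v with ⟨x, hx, hle⟩ | ⟨hr, hle⟩
    · exact (h2 x (by simpa using hx)).trans hle
    · by_cases hlt : Lv v < Lv u
      · have := h.of_lt hr hlt
        omega
      · have := h.of_le hr (not_lt.1 hlt)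
        omega
  · rcases h3 with rfl | ⟨x, -, rfl⟩
    · by_cases hr : (delGraph G S.toFinset).Reachable u v
      · by_cases hlt : Lv v < Lv u
        · exact .inr ⟨hr, hlt⟩
        · rw [h.of_le hr (not_lt.1 hlt)]
          exact .inl (dist_le_dist_delGraph hr)
      · rw [h.of_not_reachable hr]
        exact .inl (dist_lt_card_of_reachable (hG.preconnected u v)).le
    · rw [SimpleGraph.dist_comm (u := x) (v := u)]
      exact .inl hG.dist_triangle

theorem WP.pairStep {n : ℕ} {G : SimpleGraph (Fin n)} (hG : G.Connected) {S : List (Fin n)} {σ : St}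
    (hd : IsDistData G S.toFinset σ) (hrow : IsRowData G S σ) {u v : Fin n} (hu : σ.v vS = u)
    (hv : σ.v vT = v) (huK : u ∉ S.toFinset) (hvK : v ∉ S.toFinset)
    (hA : ∀ j ≤ n, σ.a aPA j = (σ.a aNx)^[j] u)
    (hB : ∀ j ≤ n, σ.a aPB j = (σ.a aNx)^[j] (σ.a aHor u)) (hans : σ.v vAns ≤ G.diam) :
    WP (Imp.pairDist ;; Imp.viaList ;; .when (.lt (var vAns) (var vCur)) (.set vAns (var vCur))) σ
      fun t σ' => t ≤ 3 * S.length + 16 ∧ σ.v vAns ≤ σ'.v vAns ∧ σ'.v vAns ≤ G.diam ∧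
        (G.dist u v ≤ σ'.v vAns ∨
          (delGraph G S.toFinset).Reachable u v ∧ σ.a aLv v < σ.a aLv u) := by
  refine .seq' (WP.pairDist hd hu hv huK hvK hA hB) ?_
  rintro t1 σ1 hF1 ⟨ht1, hp⟩
  refine .seq' (WP.viaList (hrow.of_eq (fun x hx => hF1.v x (by revert x; decide))
    (fun a ha => hF1.a a (by revert a; decide))) ((hF1.v _ (by decide)).trans hu)
    ((hF1.v _ (by decide)).trans hv)) ?_
  rintro t2 σ2 hF2 ⟨ht2, h1, h2, h3⟩
  obtain ⟨g1, g2⟩ := hp.min_eq hG h1 h2 h3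
  have ha : σ2.v vAns = σ.v vAns := (hF2.v _ (by decide)).trans (hF1.v _ (by decide))
  have hdiam := dist_le_diam_of_connected hG u v
  refine .ite (fun hb => .set ⟨by omega, ?_⟩) fun hb => .skip ⟨by omega, ?_⟩
  all_goals simp only [Cond.Holds, Expr.eval, ha, St.setV_v, if_true] at hb ⊢
  · exact ⟨hb.le, g1.trans hdiam, g2⟩
  · exact ⟨le_rfl, hans, g2.imp_left fun h => h.trans (not_lt.1 hb)⟩

/-- Two tables of iterates are prepared for each first vertex in linear time; then each pair costs
`O(|S| + 1)`. -/
theorem WP.pairLoop {n : ℕ} {G : SimpleGraph (Fin n)} {L : Fin n → List (Fin n)} (hG : G.Connected)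
    {S : List (Fin n)} {σ : St}
    (hin : Input L σ) (hK : IsFlag aFlag S.toFinset σ) (hd : IsDistData G S.toFinset σ)
    (hrow : IsRowData G S σ) (hans : σ.v vAns ≤ G.diam) :
    WP pairLoop σ fun t σ' => t ≤ n * (n * (3 * S.length + 19) + 6 * n + 20) + 2 ∧
      σ.v vAns ≤ σ'.v vAns ∧ σ'.v vAns ≤ G.diam ∧
      ∀ u v, u ∉ S.toFinset → v ∉ S.toFinset → G.dist u v ≤ σ'.v vAns := by
  refine (WP.for (fun k σ' => σ.v vAns ≤ σ'.v vAns ∧ σ'.v vAns ≤ G.diam ∧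
      ∀ u v : Fin n, (u : ℕ) < k → u ∉ S.toFinset → v ∉ S.toFinset → G.dist u v ≤ σ'.v vAns ∨
        (delGraph G S.toFinset).Reachable u v ∧ σ.a aLv v < σ.a aLv u)
    (fun _ => n * (3 * S.length + 19) + 6 * n + 18) 0 n rfl (Nat.zero_le _) (by decide)
    ?_ ?_ ?_).mono ?_
  · exact fun σ' hF => (hF.v vN (by decide)).trans hin.size
  · exact ⟨le_rfl, hans, fun u v hu => absurd hu (Nat.not_lt_zero _)⟩
  · rintro k σ' - hk hF hkv ⟨h1, h2, h3⟩
    set s : Fin n := ⟨k, hk⟩ with hs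
    have hin' : Input L σ' := hin.of_eq (hF.v _ (by decide)) (hF.a _ (by decide))
    have hK' : IsFlag aFlag S.toFinset σ' := hK.of_eq (hF.a _ (by decide))
    have hd' : IsDistData G S.toFinset σ' := hd.of_eq (hF.v _ (by decide))
      (fun a ha => hF.a a (by revert a; decide))
    have hrow' : IsRowData G S σ' := hrow.of_eq (fun x hx => hF.v x (by revert x; decide))
      (fun a ha => hF.a a (by revert a; decide))
    have hKk : σ'.a aFlag k = _ := hK' s
    refine .ite (fun hb => ?_) fun hb => .skip ⟨by omega, by simpa using h1, by simpa using h2,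
      fun u v huk hu hv => ?_⟩
    all_goals simp only [Cond.Holds, Expr.eval, hkv] at hb
    · have hsK : s ∉ S.toFinset := fun h => by
        rw [if_pos h] at hKk
        exact absurd (hKk.symm.trans hb) one_ne_zero
      refine .seq' (WP.iterArr hin' (by decide)) ?_
      rintro t1 σ1 hF1 ⟨ht1, hA⟩
      have hin1 : Input L σ1 := hin'.of_eq (hF1.v _ (by decide)) (hF1.a _ (by decide))
      refine .seq' (WP.iterArr hin1 (by decide)) ?_
      rintro t2 σ2 hF2 ⟨ht2, hB⟩
      have hS1 : σ1.v vS = s := (hF1.v _ (by decide)).trans hkv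
      have hS2 : σ2.v vS = s := (hF2.v _ (by decide)).trans hS1
      have hv2 : ∀ x, x ≠ vV → σ2.v x = σ'.v x := fun x hx =>
        (hF2.v x (by simpa [Imp.iterArr, Cmd.for, Cmd.vars] using hx)).trans
          (hF1.v x (by simpa [Imp.iterArr, Cmd.for, Cmd.vars] using hx))
      have ha2 : ∀ a, a ≠ aPA → a ≠ aPB → σ2.a a = σ'.a a := fun a h1 h2 =>
        (hF2.a a (by simpa [Imp.iterArr, Cmd.for, Cmd.arrs] using h2)).trans
          (hF1.a a (by simpa [Imp.iterArr, Cmd.for, Cmd.arrs] using h1))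
      have hd2 : IsDistData G S.toFinset σ2 := hd'.of_eq (hv2 _ (by decide))
        (fun a ha => ha2 a (by revert a; decide) (by revert a; decide))
      have hrow2 : IsRowData G S σ2 := hrow'.of_eq (fun x hx => hv2 x (by revert x; decide))
        (fun a ha => ha2 a (by revert a; decide) (by revert a; decide))
      have hA2 : ∀ j ≤ n, σ2.a aPA j = (σ2.a aNx)^[j] s := fun j hj => by
        rw [hF2.a aPA (by decide), hA j hj, ha2 aNx (by decide) (by decide)]
        simp only [Expr.eval, hkv, hs]
      have hB2 : ∀ j ≤ n, σ2.a aPB j = (σ2.a aNx)^[j] (σ2.a aHor s) := fun j hj => by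
        rw [hB j hj, hF2.a aNx (by decide), hF2.a aHor (by decide)]
        simp only [Expr.eval, hS1]
      refine (WP.for (fun j σ3 => σ'.v vAns ≤ σ3.v vAns ∧ σ3.v vAns ≤ G.diam ∧
          ∀ v : Fin n, (v : ℕ) < j → v ∉ S.toFinset → G.dist s v ≤ σ3.v vAns ∨
            (delGraph G S.toFinset).Reachable s v ∧ σ.a aLv v < σ.a aLv s)
        (fun _ => 3 * S.length + 17) 0 n rfl (Nat.zero_le _) (by decide) ?_ ?_ ?_).mono ?_
      · exact fun σ3 hF3 => (hF3.v vN (by decide)).trans hd2.size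
      · have := hv2 vAns (by decide)
        simp [this, h2]
      · rintro j σ3 - hj hF3 hjv ⟨g1, g2, g3⟩
        have hd3 : IsDistData G S.toFinset σ3 := hd2.of_eq (hF3.v _ (by decide))
          (fun a ha => hF3.a a (by revert a; decide))
        have hrow3 : IsRowData G S σ3 := hrow2.of_eq (fun x hx => hF3.v x (by revert x; decide))
          (fun a ha => hF3.a a (by revert a; decide))
        have hKj : σ3.a aFlag j = if (⟨j, hj⟩ : Fin n) ∈ S.toFinset then 1 else 0 := by
          rw [hF3.a _ (by decide), ha2 _ (by decide) (by decide)]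
          exact hK' ⟨j, hj⟩
        have hLv : σ3.a aLv = σ.a aLv := by
          rw [hF3.a _ (by decide), ha2 _ (by decide) (by decide), hF.a _ (by decide)]
        refine .ite (fun hb => ?_) fun hb => .skip ⟨by omega, by simpa using g1, by simpa using g2,
          fun v hvj hv => ?_⟩
        all_goals simp only [Cond.Holds, Expr.eval, hjv] at hb
        · have hjK : (⟨j, hj⟩ : Fin n) ∉ S.toFinset := fun h => by
            rw [if_pos h] at hKj
            exact absurd (hKj.symm.trans hb) one_ne_zero
          refine (WP.pairStep hG hd3 hrow3 (u := s) (v := ⟨j, hj⟩)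
            ((hF3.v _ (by decide)).trans hS2) hjv hsK hjK ?_ ?_ g2).mono ?_
          · rw [hF3.a aPA (by decide), hF3.a aNx (by decide)]
            exact hA2
          · rw [hF3.a aPB (by decide), hF3.a aNx (by decide), hF3.a aHor (by decide)]
            exact hB2
          · rintro t4 σ4 - ⟨ht4, e1, e2, e3⟩
            refine ⟨by omega, by simpa using g1.trans e1, by simpa using e2, fun v hvj hv => ?_⟩
            simp only [St.setV_v, show vAns ≠ vT by decide, if_false]
            by_cases hvj' : (v : ℕ) = j
            · rw [show v = ⟨j, hj⟩ from Fin.ext hvj', ← hLv]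
              exact e3
            · exact (g3 v (by omega) hv).imp_left fun h => h.trans e1
        · simp only [St.setV_v, show vAns ≠ vT by decide, if_false]
          refine g3 v ?_ hv
          have : (v : ℕ) ≠ j := by
            rintro rfl
            rw [if_neg hv] at hKj
            exact hb hKj
          omega
      · rintro t3 σ3 - ⟨ht3, g1, g2, g3⟩
        simp only [Finset.sum_const, smul_eq_mul, Nat.card_Ico, Nat.sub_zero, Nat.add_assoc,
          Nat.reduceAdd] at ht3
        refine ⟨by omega, by simpa using h1.trans g1, by simpa using g2, fun u v huk hu hv => ?_⟩
        simp only [St.setV_v, show vAns ≠ vS by decide, if_false]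
        by_cases huk' : (u : ℕ) = k
        · rw [show u = s from Fin.ext huk']
          exact g3 v v.2 hv
        · exact (h3 u v (by omega) hu hv).imp_left fun h => h.trans g1
    · simp only [St.setV_v, show vAns ≠ vS by decide, if_false]
      refine h3 u v ?_ hu hv
      have : (u : ℕ) ≠ k := by
        rintro rfl
        rw [if_neg (by simpa [hs] using hu)] at hKk
        exact hb hKk
      omega
  · rintro t σ' - ⟨ht, h1, h2, h3⟩
    refine ⟨by simpa using ht, h1, h2, fun u v hu hv => ?_⟩
    -- If `(u, v)` was skipped because of its levels, then `(v, u)` was not.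
    rcases h3 u v u.2 hu hv with h | ⟨-, hlt⟩
    · exact h
    · rcases h3 v u v.2 hv hu with h | ⟨-, hlt'⟩
      · rwa [SimpleGraph.dist_comm]
      · omega

end Imp

/-! ### The algorithm for a given interval deletion set -/

theorem IsIntervalDeletionSet.exists_intervalOn {n : ℕ} {G : SimpleGraph (Fin n)}
    {K : Finset (Fin n)} (h : IsIntervalDeletionSet G K) :
    ∃ l r : Fin n → ℝ, IntervalOn (Imp.delGraph G K) {v | v ∉ K} l r := by
  classical
  obtain ⟨l, r, hle, hadj⟩ := h
  refine ⟨fun v => if hv : v ∉ K then l ⟨v, hv⟩ else 0, fun v => if hv : v ∉ K then r ⟨v, hv⟩ else 0,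
    fun v hv => ?_, fun u hu v hv huv => ?_⟩
  · replace hv : v ∉ K := hv
    rw [dif_pos hv, dif_pos hv]
    exact hle _
  · replace hu : u ∉ K := hu
    replace hv : v ∉ K := hv
    rw [dif_pos hu, dif_pos hv, dif_pos hu, dif_pos hv]
    have h1 := hadj ⟨u, hu⟩ ⟨v, hv⟩ (by simpa using huv)
    rw [SimpleGraph.comap_adj, Set.Icc_inter_Icc, Set.nonempty_Icc, sup_le_iff, le_inf_iff,
      le_inf_iff] at h1
    have h2 := hle ⟨u, hu⟩
    have h3 := hle ⟨v, hv⟩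
    constructor
    · rintro ⟨h4, -, -⟩
      have := h1.1 h4
      exact ⟨this.1.2, this.2.1⟩
    · rintro ⟨h4, h5⟩
      exact ⟨h1.2 ⟨⟨h2, h4⟩, h5, h3⟩, hu, hv⟩

namespace Imp

open Imp.Expr WordRAM

theorem encodeGraphAndList_getD_length {n : ℕ} (L : Fin n → List (Fin n)) (S : List (Fin n)) :
    (encodeGraphAndList L S).getD (n + 2 + listOffset L n) 0 = S.length := by
  rw [encodeGraphAndList, List.getD_append_right _ _ _ _ (by rw [length_encodeGraph]),
    length_encodeGraph, Nat.sub_self]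
  rfl

theorem encodeGraphAndList_getD_entry {n : ℕ} (L : Fin n → List (Fin n)) (S : List (Fin n)) {j : ℕ}
    (hj : j < S.length) :
    (encodeGraphAndList L S).getD (n + 3 + listOffset L n + j) 0 = (S[j] : ℕ) := by
  rw [encodeGraphAndList, List.getD_append_right _ _ _ _ (by rw [length_encodeGraph]; omega),
    length_encodeGraph, show n + 3 + listOffset L n + j - (n + 2 + listOffset L n) = j + 1 by omega,
    List.getD_cons_succ, List.getD_eq_getElem _ _ (by simpa using hj)]
  simp

theorem length_encodeGraphAndList {n : ℕ} (L : Fin n → List (Fin n)) (S : List (Fin n)) :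
    (encodeGraphAndList L S).length = n + 3 + listOffset L n + S.length := by
  rw [encodeGraphAndList, List.length_append, length_encodeGraph, List.length_cons, List.length_map]
  omega

theorem cells_encodeGraphAndList {n : ℕ} (L : Fin n → List (Fin n)) (S : List (Fin n)) :
    cells (encodeGraphAndList L S) = (encodeGraphAndList L S).length := by
  have h0 : (encodeGraphAndList L S).getD 0 0 = n := encodeGraph_getD_zero L _
  have h1 : (encodeGraphAndList L S).getD (n + 1) 0 = listOffset L n :=
    encodeGraph_getD_offset L _ le_rfl
  have h2 := encodeGraphAndList_getD_length L S
  rw [length_encodeGraphAndList]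
  unfold cells
  simp only [h0, h1, h2]
  omega

/-- Read the list that follows the adjacency lists. -/
def readList : Cmd :=
  .set vBase (add (arr aIn (add (var vN) (const 1))) (const 3)) ;;
  .for vI (const 0) (var vN) (.inc vBase) ;;
  .set vLen (arr aIn (sub (var vBase) (const 1))) ;;
  .for vI (const 0) (var vLen) (.store aFlag (arr aIn (add (var vBase) (var vI))) (const 1))

/-- The base address is the sum of `n + 3` and an offset. Adding two variable values is not a flat
assignment, so the variable is incremented `n` times instead. -/
theorem WP.readList {n : ℕ} {L : Fin n → List (Fin n)} {S : List (Fin n)} {σ : St}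
    (hin : Input L σ) (hlen : σ.a aIn (n + 2 + listOffset L n) = S.length)
    (hS : ∀ (j : ℕ) (hj : j < S.length), σ.a aIn (n + 3 + listOffset L n + j) = (S[j] : ℕ))
    (h0 : IsFlag aFlag (∅ : Finset (Fin n)) σ) :
    WP readList σ fun t σ' => t ≤ 3 * n + 3 * S.length + 6 ∧ IsFlag aFlag S.toFinset σ' ∧
      σ'.v vLen = S.length ∧ σ'.v vBase = n + 3 + listOffset L n := by
  refine .seq (.set ?_)
  have hoff := hin.off n le_rfl
  rw [show (add (arr aIn (add (var vN) (const 1))) (const 3)).eval σ = listOffset L n + 3 by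
    simp [hin.size, hoff]]
  refine .seq' (WP.for (fun k σ' => σ'.v vBase = k + 3 + listOffset L n) (fun _ => 1) 0 n rfl
    (Nat.zero_le _) (by decide) ?_ ?_ ?_) ?_
  · exact fun σ' hF => (hF.v vN (by decide)).trans (by simpa using hin.size)
  · simp
    omega
  · intro k σ' _ _ _ _ hI
    refine .set ⟨le_rfl, ?_⟩
    simp [hI]
    omega
  rintro t1 σ1 hF1 ⟨ht1, hb1⟩
  have ha1 : σ1.a = σ.a := by
    funext a
    rw [hF1.a a (by simp [Cmd.for, Cmd.arrs])]
    rfl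
  refine .seq (.set ?_)
  rw [show (arr aIn (sub (var vBase) (const 1))).eval σ1 = S.length by
    simp only [Expr.eval, hb1, ha1]
    rw [← hlen]
    congr 1
    omega]
  refine (WP.for (fun k σ' => IsFlag aFlag (S.take k).toFinset σ') (fun _ => 1) 0 S.length rfl
    (Nat.zero_le _) (by decide) ?_ ?_ ?_).mono ?_
  · exact fun σ' hF => (hF.v vLen (by decide)).trans (by simp)
  · simpa using h0.of_eq (σ' := (σ1.setV vLen S.length).setV vI 0) (by simp [ha1])
  · intro k σ' _ hk hF hkv hI
    refine .store ⟨le_rfl, ?_⟩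
    have hb : σ'.v vBase = n + 3 + listOffset L n :=
      (hF.v _ (by decide)).trans (by simpa using hb1)
    have he : (arr aIn (add (var vBase) (var vI))).eval σ' = (S[k] : ℕ) := by
      simp only [Expr.eval, hb, hkv, hF.a aIn (by decide), St.setV_a, ha1, hS k hk]
    rw [he]
    have := hI.insert S[k]
    rw [List.take_succ_eq_append_getElem hk, List.toFinset_append,
      show [S[k]].toFinset = {S[k]} from rfl, Finset.union_comm, ← Finset.insert_eq]
    exact this
  · rintro t2 σ2 hF2 ⟨ht2, hI⟩
    rw [List.take_length] at hI
    simp only [Finset.sum_const, smul_eq_mul, Nat.card_Ico, Nat.sub_zero] at ht1 ht2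
    refine ⟨by omega, hI, (hF2.v _ (by decide)).trans (by simp),
      (hF2.v _ (by decide)).trans (by simpa using hb1)⟩

/-- The diameter, via a deletion set to interval graphs. -/
def intervalProg : Cmd :=
  readSize ;; readList ;; eccLoop ;; buildAdj ;; allLevels ;; chooseNbrs ;; pairLoop

theorem listOffset_le_sq {n : ℕ} {G : SimpleGraph (Fin n)} {L : Fin n → List (Fin n)}
    (hL : IsAdjLists G L) : listOffset L n ≤ n ^ 2 := by
  rw [listOffset_eq_sum]
  refine (Finset.sum_le_card_nsmul _ _ n fun v _ => hL.length_le v).trans ?_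
  simp [sq]

/-- Pairs that meet `S` are covered by the rows, all others by the loop over pairs. As `2m ≤ n^2`,
the searches from `S` cost `O(|S| n^2)`, like the minimisation over `S`; everything else is
`O(n^2)`. -/
theorem WP.intervalProg {n : ℕ} {G : SimpleGraph (Fin n)} {L : Fin n → List (Fin n)}
    {S : List (Fin n)} (hG : G.Connected) (hL : IsAdjLists G L) (hS : S.Nodup)
    (hI : IsIntervalDeletionSet G S.toFinset) :
    WP intervalProg (St.init (encodeGraphAndList L S)) fun t σ' =>
      t ≤ 1000 * (max 1 S.length * n ^ 2) ∧ σ'.v vAns = G.diam := by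
  classical
  obtain ⟨l, r, hI⟩ := hI.exists_intervalOn
  have hin : Input L ((St.init (encodeGraphAndList L S)).setV vN n) := input_init L _
  have h0 : (encodeGraphAndList L S).getD 0 0 = n := encodeGraph_getD_zero L _
  refine .seq (.set ?_)
  rw [show (arr aIn (const 0)).eval (St.init (encodeGraphAndList L S)) = n from h0]
  set σ := (St.init (encodeGraphAndList L S)).setV vN n with hσ
  have hz : ∀ a, a ≠ aIn → ∀ i, σ.a a i = 0 := by
    intro a ha i
    simp [hσ, St.init, ha]
  have hz' : ∀ a, a ≠ aIn → IsFlag a (∅ : Finset (Fin n)) σ := fun a ha v => by simp [hz a ha]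
  refine .seq' (WP.readList hin (encodeGraphAndList_getD_length L S)
    (fun j hj => encodeGraphAndList_getD_entry L S hj) (hz' _ (by decide))) ?_
  rintro t1 σ1 hF1 ⟨ht1, hK1, hlen1, hbase1⟩
  have hin1 : Input L σ1 := hin.of_eq (hF1.v _ (by decide)) (hF1.a _ (by decide))
  have hans1 : σ1.v vAns = 0 := (hF1.v _ (by decide)).trans (by simp [hσ, St.init])
  refine .seq' (WP.eccLoop (F := S.toFinset) hG hL hin1 hK1
    ((hz' aSrc (by decide)).of_eq (hF1.a _ (by decide)))
    ((hz' aZero (by decide)).of_eq (hF1.a _ (by decide))) (by omega)) ?_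
  rintro t2 σ2 hF2 ⟨ht2, -, hans2, hsrc2, hrow2⟩
  have hin2 : Input L σ2 := hin1.of_eq (hF2.v _ (by decide)) (hF2.a _ (by decide))
  refine .seq' (WP.buildAdj hL hin2 fun i => ?_) ?_
  · rw [hF2.a _ (by decide), hF1.a _ (by decide)]
    exact hz _ (by decide) i
  rintro t3 σ3 hF3 ⟨ht3, hadj3⟩
  have hin3 : Input L σ3 := hin2.of_eq (hF3.v _ (by decide)) (hF3.a _ (by decide))
  have hz3 : ∀ a, a ≠ aIn → a ∉ Imp.readList.arrs → a ∉ Imp.eccLoop.arrs → a ∉ Imp.buildAdj.arrs →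
      IsFlag a (∅ : Finset (Fin n)) σ3 := fun a h1 h2 h3 h4 =>
    (hz' a h1).of_eq ((hF3.a a h4).trans ((hF2.a a h3).trans (hF1.a a h2)))
  refine .seq' (WP.allLevels (K := S.toFinset) hL hin3
    (hK1.of_eq ((hF3.a _ (by decide)).trans (hF2.a _ (by decide))))
    (hsrc2.of_eq (hF3.a _ (by decide)))
    (hz3 aLv (by decide) (by decide) (by decide) (by decide))
    (hz3 aCp (by decide) (by decide) (by decide) (by decide)) hI) ?_
  rintro t4 σ4 hF4 ⟨ht4, hlev4, hcp4⟩
  have hin4 : Input L σ4 := hin3.of_eq (hF4.v _ (by decide)) (hF4.a _ (by decide))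
  refine .seq' (WP.chooseNbrs hL hin4 (fun v => σ4.a aLv v) _ (fun _ => rfl) fun _ => rfl) ?_
  rintro t5 σ5 hF5 ⟨ht5, hnx5, hlast5, hhor5⟩
  have hin5 : Input L σ5 := hin4.of_eq (hF5.v _ (by decide)) (hF5.a _ (by decide))
  have hans5 : σ5.v vAns = σ2.v vAns :=
    (hF5.v _ (by decide)).trans ((hF4.v _ (by decide)).trans (hF3.v _ (by decide)))
  have hd5 : IsDistData G S.toFinset σ5 := by
    refine ⟨hin5.size, ?_, ?_, ?_, ?_⟩
    · rw [hF5.a aLv (by decide), hF5.a aCp (by decide), hF5.a aSm (by decide)]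
      exact hlev4
    · rw [hF5.a aCp (by decide)]
      exact hcp4
    · rw [hF5.a aLv (by decide)]
      exact ⟨_, fun {_} v => by convert rfl, hnx5, hlast5, hhor5⟩
    · rw [hF5.a aAdj (by decide), hF4.a aAdj (by decide)]
      exact hadj3
  have hrow5 : IsRowData G S σ5 := by
    refine ⟨hin5.size, ?_, ?_, ?_⟩
    · rw [hF5.v vLen (by decide), hF4.v vLen (by decide), hF3.v vLen (by decide),
        hF2.v vLen (by decide), hlen1]
    · intro j hj
      rw [hF5.v vBase (by decide), hF4.v vBase (by decide), hF3.v vBase (by decide),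
        hF2.v vBase (by decide), hbase1, hF5.a aIn (by decide), hF4.a aIn (by decide),
        hF3.a aIn (by decide), hF2.a aIn (by decide), hF1.a aIn (by decide)]
      exact encodeGraphAndList_getD_entry L S hj
    · intro x hx v
      rw [hF5.a aRow (by decide), hF4.a aRow (by decide), hF3.a aRow (by decide)]
      exact (hrow2 x (by simpa using hx) v).2
  refine (WP.pairLoop hG hin5 (hK1.of_eq ?_) hd5 hrow5 (by omega)).mono ?_
  · rw [hF5.a _ (by decide), hF4.a _ (by decide), hF3.a _ (by decide), hF2.a _ (by decide)]
  rintro t6 σ6 - ⟨ht6, hle6, hans6, hpair6⟩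
  refine ⟨?_, le_antisymm hans6 (diam_le_of_forall hG fun u v => ?_)⟩
  · have hn : 1 ≤ n := by
      obtain ⟨v⟩ := hG.nonempty
      exact v.pos
    have hoff := listOffset_le_sq hL
    rw [List.toFinset_card_of_nodup hS] at ht2
    set s := S.length with hs
    set M := max 1 s with hM
    have hM1 : 1 ≤ M := le_max_left _ _
    have hsM : s ≤ M := le_max_right _ _
    have hnn : n ≤ n ^ 2 := Nat.le_self_pow two_ne_zero n
    have e1 : s * (40 * n + 40 + 7 * listOffset L n) ≤ M * (87 * n ^ 2) :=
      Nat.mul_le_mul hsM (by omega)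
    have e2 : n ^ 2 ≤ M * n ^ 2 := Nat.le_mul_of_pos_left _ hM1
    have e3 : n ^ 2 * s ≤ M * n ^ 2 := by rw [mul_comm]; exact Nat.mul_le_mul_right _ hsM
    have e4 : n * (n * (3 * s + 19) + 6 * n + 20) = 3 * (n ^ 2 * s) + 25 * n ^ 2 + 20 * n := by ring
    have e5 : s ≤ M * n ^ 2 := hsM.trans (Nat.le_mul_of_pos_right _ (by omega))
    have e6 : M * (87 * n ^ 2) = 87 * (M * n ^ 2) := by ring
    omega
  · by_cases hu : u ∈ S.toFinset
    · exact (hrow2 u hu v).1.trans (by omega)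
    · by_cases hv : v ∈ S.toFinset
      · rw [SimpleGraph.dist_comm]
        exact (hrow2 v hv u).1.trans (by omega)
      · exact hpair6 u v hu hv

end Imp

open WordRAM

theorem exists_program_interval : ∃ (p : Program) (k : ℕ) (C : ℝ),
    ∀ (n : ℕ) (G : SimpleGraph (Fin n)) (L : Fin n → List (Fin n)) (S : List (Fin n)),
      G.Connected → IsAdjLists G L → S.Nodup → IsIntervalDeletionSet G S.toFinset →
        OutputsWithin p k (encodeGraphAndList L S) G.diam
          (C * (max 1 (S.length : ℝ) * (n : ℝ) ^ 2)) ∧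
        (S.length = distToInterval G →
          OutputsWithin p k (encodeGraphAndList L S) G.diam
            (C * (max 1 (distToInterval G : ℝ) * (n : ℝ) ^ 2))) := by
  -- Both `max 1 |S|` and `n` are at most the input length, so the time is at most `1000` times its
  -- cube.
  obtain ⟨p, k, κ, h⟩ := Imp.outputsWithin_of_big Imp.intervalProg (by decide) 1000 3
  refine ⟨p, k, κ * 1006, fun n G L S hG hL hS hI => ?_⟩
  obtain ⟨t, σ, hbig, ht, hans⟩ := Imp.WP.intervalProg hG hL hS hI
  have hlen := Imp.length_encodeGraphAndList L S
  have hcells := Imp.cells_encodeGraphAndList L S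
  have hoff := Imp.listOffset_le_sq hL
  have hn : 1 ≤ n := by
    obtain ⟨v⟩ := hG.nonempty
    exact v.pos
  have key : OutputsWithin p k (encodeGraphAndList L S) G.diam
      (κ * 1006 * (max 1 (S.length : ℝ) * (n : ℝ) ^ 2)) := by
    rw [← hans]
    refine h _ t σ (by omega) (Imp.getD_le_of_forall fun m hm => ?_) hcells.ge (by omega) hbig
      ?_ _ ?_
    · rw [encodeGraphAndList, List.mem_append, List.mem_cons, List.mem_map] at hm
      rcases hm with hm | rfl | ⟨v, -, rfl⟩
      · have := Imp.le_of_mem_encodeGraph L hm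
        rw [Imp.length_encodeGraph] at this
        omega
      · omega
      · have := v.2
        omega
    · refine ht.trans (Nat.mul_le_mul_left _ ?_)
      have h1 : max 1 S.length ≤ (encodeGraphAndList L S).length := by omega
      have h2 : n ≤ (encodeGraphAndList L S).length := by omega
      rw [pow_succ' _ 2]
      exact Nat.mul_le_mul h1 (Nat.pow_le_pow_left h2 2)
    · have hle : t + (encodeGraphAndList L S).length ≤ 1006 * (max 1 S.length * n ^ 2) := by
        rw [hlen]
        have hM1 : 1 ≤ max 1 S.length := le_max_left _ _
        have hnn : n ≤ n ^ 2 := Nat.le_self_pow two_ne_zero n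
        have e1 : n ^ 2 ≤ max 1 S.length * n ^ 2 := Nat.le_mul_of_pos_left _ hM1
        have e2 : S.length ≤ max 1 S.length * n ^ 2 :=
          (le_max_right _ _).trans (Nat.le_mul_of_pos_right _ (by omega))
        omega
      calc (κ * (t + (encodeGraphAndList L S).length : ℕ) : ℝ)
          ≤ κ * (1006 * (max 1 S.length * n ^ 2) : ℕ) := by gcongr
        _ = _ := by push_cast; ring
  exact ⟨key, fun hi => hi ▸ key⟩

theorem mainTheorem8 :
    -- distance `i` to interval graphs, the deletion set being given
    (∃ (p : WordRAM.Program) (k : ℕ) (C : ℝ),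
      ∀ (n : ℕ) (G : SimpleGraph (Fin n)) (L : Fin n → List (Fin n)) (S : List (Fin n)),
        G.Connected → IsAdjLists G L → S.Nodup → IsIntervalDeletionSet G S.toFinset →
          WordRAM.OutputsWithin p k (encodeGraphAndList L S) G.diam
            (C * (max 1 (S.length : ℝ) * (n : ℝ) ^ 2)) ∧
          (S.length = distToInterval G →
            WordRAM.OutputsWithin p k (encodeGraphAndList L S) G.diam
              (C * (max 1 (distToInterval G : ℝ) * (n : ℝ) ^ 2)))) ∧
    -- distance `c` to clique
    (∃ (p : WordRAM.Program) (k : ℕ) (C : ℝ),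
      ∀ (n : ℕ) (G : SimpleGraph (Fin n)) [DecidableRel G.Adj] (L : Fin n → List (Fin n)),
        G.Connected → IsAdjLists G L →
          WordRAM.OutputsWithin p k (encodeGraph L) G.diam
            (C * (max 1 (distToClique G : ℝ) * ((n : ℝ) + (G.edgeFinset.card : ℝ))))) ∧
    -- average degree `a`
    (∃ (p : WordRAM.Program) (k : ℕ) (C : ℝ),
      ∀ (n : ℕ) (G : SimpleGraph (Fin n)) [DecidableRel G.Adj] (L : Fin n → List (Fin n)),
        G.Connected → IsAdjLists G L →
          WordRAM.OutputsWithin p k (encodeGraph L) G.diam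
            (C * (max 1 (averageDegree G) * (n : ℝ) ^ 2))) ∧
    -- maximum degree `Δ` and diameter `d`
    (∃ (p : WordRAM.Program) (k : ℕ) (C : ℝ),
      ∀ (n : ℕ) (G : SimpleGraph (Fin n)) [DecidableRel G.Adj] (L : Fin n → List (Fin n)),
        G.Connected → IsAdjLists G L →
          WordRAM.OutputsWithin p k (encodeGraph L) G.diam
            (C * max 1 (G.maxDegree : ℝ) ^ (2 * G.diam + 3))) ∧
    -- domination number `γ` and maximum degree `Δ`
    (∃ (p : WordRAM.Program) (k : ℕ) (C : ℝ),
      ∀ (n : ℕ) (G : SimpleGraph (Fin n)) [DecidableRel G.Adj] (L : Fin n → List (Fin n)),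
        G.Connected → IsAdjLists G L →
          WordRAM.OutputsWithin p k (encodeGraph L) G.diam
            (C * ((dominationNumber G : ℝ) ^ 2 * max 1 (G.maxDegree : ℝ) ^ 3))) := by
  exact ⟨exists_program_interval, exists_program_distToClique, exists_program_averageDegree,
    exists_program_maxDegree_diam, exists_program_dominationNumber⟩
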